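/- **Notation.** Work over $\mathbb Q$. Let $\mathrm{Ass}_2=\mathbb Q\langle\langle x,y\rangle\rangle$ (noncommutative power series); *weight* is the total degree and *depth* the degree in $y$. Let $\mathfrak{lie}_2\subset \mathrm{Ass}_2$ be the degree-completed free Lie algebra on $x,y$, let $C_i=\mathrm{ad}(x)^{i-1}(y)$ for $i\ge1$, and let $\mathfrak{lie}_C\subset\mathfrak{lie}_2$ be the degree completion of the Lie algebra generated by the $C_i$. If the part of depth $r$ and weight $d+r$ of $b$ is $\sum_{\underline a} k_{\underline a}C_{a_1}\cdots C_{a_r}$, put $B^r_d(u_1,\dots,u_r)=\sum_{\underline a} k_{\underline a}u_1^{a_1-1}\cdots u_r^{a_r-1}$, a homogeneous polynomial of degree $d$ in commuting variables, and let $B^r=\sum_d B^r_d$ (a polynomial if $b$ is one; all conditions on $B^r$ below are imposed degree by degree). Let $push$ be the linear operator on $\mathrm{Ass}_2$ with $push(x^{a_0}yx^{a_1}y\cdots yx^{a_r})=x^{a_r}yx^{a_0}y\cdots yx^{a_{r-1}}$. A series $b$ is *push-invariant* if $push(b)=b$; $f$ is *push-neutral* if $f^r+push(f^r)+\cdots+push^r(f^r)=0$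 for the depth $r$ part $f^r$ of $f$, for all $r\ge1$; and $b=c+xb^x+yb^y$ is *circ-neutral* if $b^y$ is push-neutral (a condition on the parts of $b$ of depth $>1$). * $\mathfrak{lkv}$ is the space of push-invariant and circ-neutral $b\in\mathfrak{lie}_C$ all of whose terms have weight $\ge 3$. * $\mathfrak{krv}_{ell}$ is the space of $b\in\mathfrak{lie}_C$ such that $B^r_*=B^r/\bigl(u_1\cdots u_r(u_1+\cdots+u_r)\bigr)$ satisfies (i) $B^r_*(u_0,u_1,\dots,u_{r-1})=B^r_*(u_1,\dots,u_r)$ with $u_0=-u_1-\cdots-u_r$, for all $r\ge1$, and (ii) for all $r>1$, up to adding a constant to $\bar B^r_*$, the sum of $\bar B^r_*(v_1,\dots,v_r)=B^r_*(v_r,v_{r-1}-v_r,\dots,v_1-v_2)$ over the $r$ cyclic permutations of $(v_1,\dots,v_r)$ is $0$. Let $\mathfrak{krv}_{ell}^0\subset\mathfrak{krv}_{ell}$ be the subspace where no constants have to be added in (ii). * $\mathfrak{oder}_2$ is the space of derivations $D$ of $\mathfrak{lie}_2$ with $D([x,y])=0$ such that neither $D(x)$ nor $D(y)$ has a linear term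 in $x$. **Proposition.** For each $b\in\mathfrak{krv}_{ell}$ there is a unique $D_b\in\mathfrak{oder}_2$ with $D_b(x)=b$; so the bracket of derivations gives the bracket $\langle b,b'\rangle=[D_b,D_{b'}](x)=D_b(b')-D_{b'}(b)$ on $\mathfrak{krv}_{ell}$. The formula $$b(x,y)\longmapsto [x,\,b(x,[x,y])]$$ defines an injective linear map $\mathfrak{lkv}\hookrightarrow\mathfrak{krv}_{ell}$, with values in $\mathfrak{krv}_{ell}^0$, whose image is a Lie subalgebra: it is closed under $\langle\ ,\ \rangle$, i.e. the derivations $D_b$, for $b$ in the image, form a Lie subalgebra of $\mathrm{Der}(\mathfrak{lie}_2)$. Each $b\in\mathfrak{lkv}$ has a unique associated family $(B^r)_r$, and on these families the map is $$B^r(u_1,\dots,u_r)\longmapsto u_1\cdots u_r(u_1+\cdots+u_r)\,B^r(u_1,\dots,u_r).$$ -/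

import Mathlib

namespace EllKV

noncomputable section

/-! ### The completed free associative algebra `ℚ⟨⟨x, y⟩⟩` -/

/-- Words in the two letters `x` (coded by `0`) and `y` (coded by `1`). -/
abbrev Word : Type := List (Fin 2)

/-- Noncommutative formal power series in `x` and `y` over `ℚ`: a series `f` is the family of its
coefficients `f w`, for `w` a word. -/
def Series : Type := Word → ℚ

namespace Series

instance : AddCommGroup Series := inferInstanceAs (AddCommGroup (Word → ℚ))
instance : Module ℚ Series := inferInstanceAs (Module ℚ (Word → ℚ))

@[ext] theorem ext {f g : Series} (h : ∀ w, f w = g w) : f = g := funext h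

@[simp] theorem add_apply (f g : Series) (w : Word) : (f + g) w = f w + g w := rfl
@[simp] theorem sub_apply (f g : Series) (w : Word) : (f - g) w = f w - g w := rfl
@[simp] theorem zero_apply (w : Word) : (0 : Series) w = 0 := rfl
@[simp] theorem smul_apply (c : ℚ) (f : Series) (w : Word) : (c • f) w = c * f w := rfl

/-- The series consisting of the single word `w`, with coefficient `1`. -/
def single (w : Word) : Series := fun v => if v = w then 1 else 0

instance : One Series := ⟨single []⟩

/-- The concatenation product: the coefficient of `w` in `f g` is the sum of
`f u * g v` over all factorizations `w = u v`. -/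
instance : Mul Series :=
  ⟨fun f g w => ∑ i ∈ Finset.range (w.length + 1), f (w.take i) * g (w.drop i)⟩

theorem mul_apply (f g : Series) (w : Word) :
    (f * g) w = ∑ i ∈ Finset.range (w.length + 1), f (w.take i) * g (w.drop i) := rfl

/-- The series `f^a` in the decomposition `f = c + x f^x + y f^y`. -/
def tailPart (a : Fin 2) : Series →ₗ[ℚ] Series where
  toFun f w := f (a :: w)
  map_add' _ _ := rfl
  map_smul' _ _ := rfl

theorem tailPart_apply (a : Fin 2) (f : Series) (w : Word) : tailPart a f w = f (a :: w) := rfl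

theorem mul_nil (f g : Series) : (f * g) [] = f [] * g [] := by
  simp [mul_apply]

theorem mul_cons (f g : Series) (a : Fin 2) (w : Word) :
    (f * g) (a :: w) = f [] * g (a :: w) + (tailPart a f * g) w := by
  rw [mul_apply, mul_apply, List.length_cons, Finset.sum_range_succ', add_comm]
  simp [tailPart_apply]

theorem tailPart_mul (a : Fin 2) (f g : Series) :
    tailPart a (f * g) = f [] • tailPart a g + tailPart a f * g := by
  ext w
  rw [tailPart_apply, mul_cons]
  rfl

theorem add_mul' (f g h : Series) : (f + g) * h = f * h + g * h := by
  ext w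
  simp [mul_apply, add_mul, Finset.sum_add_distrib]

theorem mul_add' (f g h : Series) : f * (g + h) = f * g + f * h := by
  ext w
  simp [mul_apply, mul_add, Finset.sum_add_distrib]

theorem smul_mul' (c : ℚ) (f g : Series) : (c • f) * g = c • (f * g) := by
  ext w
  simp [mul_apply, Finset.mul_sum, mul_assoc]

theorem mul_smul' (c : ℚ) (f g : Series) : f * (c • g) = c • (f * g) := by
  ext w
  simp [mul_apply, Finset.mul_sum, mul_left_comm]

theorem mul_assoc' (f g h : Series) : f * g * h = f * (g * h) := by
  ext w
  induction w generalizing f g h with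
  | nil => simp [mul_nil, mul_assoc]
  | cons a w ih =>
    rw [mul_cons, mul_cons, mul_cons, tailPart_mul, add_mul', smul_mul', add_apply, smul_apply,
      ih, mul_nil]
    ring

theorem zero_mul' (f : Series) : 0 * f = 0 := by
  ext w
  simp [mul_apply]

theorem mul_zero' (f : Series) : f * 0 = 0 := by
  ext w
  simp [mul_apply]

theorem one_apply (w : Word) : (1 : Series) w = if w = [] then 1 else 0 := rfl

theorem one_mul' (f : Series) : 1 * f = f := by
  ext w
  cases w with
  | nil => simp [mul_nil, one_apply]
  | cons a w =>
    have h : tailPart a (1 : Series) = 0 := by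
      ext v
      simp [tailPart_apply, one_apply]
    rw [mul_cons, h, zero_mul']
    simp [one_apply]

theorem mul_one' (f : Series) : f * 1 = f := by
  ext w
  induction w generalizing f with
  | nil => simp [mul_nil, one_apply]
  | cons a w ih =>
    rw [mul_cons, ih]
    simp [tailPart_apply, one_apply]

instance : Ring Series where
  __ := (inferInstance : AddCommGroup Series)
  mul_assoc := mul_assoc'
  one_mul := one_mul'
  mul_one := mul_one'
  left_distrib := mul_add'
  right_distrib := add_mul'
  zero_mul := zero_mul'
  mul_zero := mul_zero'

instance : Algebra ℚ Series := Algebra.ofModule smul_mul' mul_smul'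

/-- The bracket is the commutator. -/
instance : LieRing Series := LieRing.ofAssociativeRing

instance : LieAlgebra ℚ Series := LieAlgebra.ofAssociativeAlgebra

end Series

/-- The variable `x`. -/
def X : Series := Series.single [0]

/-- The variable `y`. -/
def Y : Series := Series.single [1]

/-- The part of weight `n` (total degree `n`) of a series. -/
def weightPart (n : ℕ) : Series →ₗ[ℚ] Series where
  toFun f w := if w.length = n then f w else 0
  map_add' f g := by
    ext w
    rw [Series.add_apply]
    change (if w.length = n then f w + g w else 0) = (if w.length = n then f w else 0) + (if w.length = n then g w else 0)
    split_ifs <;> simp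
  map_smul' c f := by
    ext w
    rw [Series.smul_apply]
    change (if w.length = n then c * f w else 0) = c * (if w.length = n then f w else 0)
    split_ifs <;> simp

/-- The part of depth `r` (degree `r` in `y`) of a series. -/
def depthPart (r : ℕ) : Series →ₗ[ℚ] Series where
  toFun f w := if w.count 1 = r then f w else 0
  map_add' f g := by
    ext w
    rw [Series.add_apply]
    change (if w.count 1 = r then f w + g w else 0) = (if w.count 1 = r then f w else 0) + (if w.count 1 = r then g w else 0)
    split_ifs <;> simp
  map_smul' c f := by
    ext w
    rw [Series.smul_apply]
    change (if w.count 1 = r then c * f w else 0) = c * (if w.count 1 = r then f w else 0)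
    split_ifs <;> simp

/-- Substitution `f(g₀, g₁)` of series `g₀, g₁` without constant term for `x, y` in `f`: the sum
over all words `w` of `f w` times the product of the `g`'s along `w`. The coefficient of `v`
only receives contributions from words `w` that are not longer than `v`. -/
def substitute (g : Fin 2 → Series) (f : Series) : Series := fun v =>
  ∑ n ∈ Finset.range (v.length + 1), ∑ w : Fin n → Fin 2,
    f (List.ofFn w) * (List.ofFn fun i => g (w i)).prod v

/-! ### Lie series -/

theorem weightPart_mul (n : ℕ) (f g : Series) :
    weightPart n (f * g) =
      ∑ p ∈ Finset.HasAntidiagonal.antidiagonal n, weightPart p.1 f * weightPart p.2 g := by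
  ext w
  have hs : ∀ (s : Finset (ℕ × ℕ)) (F : ℕ × ℕ → Series), (∑ p ∈ s, F p) w = ∑ p ∈ s, F p w :=
    fun s F => Finset.sum_apply (M := fun _ : Word => ℚ) w s F
  rw [hs]
  change (if w.length = n then (f * g) w else 0) = _
  simp only [Series.mul_apply]
  rw [Finset.sum_comm]
  change _ = ∑ i ∈ Finset.range (w.length + 1), ∑ p ∈ Finset.HasAntidiagonal.antidiagonal n,
    (if (w.take i).length = p.1 then f (w.take i) else 0) *
      (if (w.drop i).length = p.2 then g (w.drop i) else 0)
  have key : ∀ i ≤ w.length, ∀ p : ℕ × ℕ,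
      (if (w.take i).length = p.1 then f (w.take i) else 0) *
        (if (w.drop i).length = p.2 then g (w.drop i) else 0) =
      if p = (i, w.length - i) then f (w.take i) * g (w.drop i) else 0 := by
    rintro i hi ⟨a, b⟩
    rw [List.length_take, List.length_drop, min_eq_left hi]
    by_cases h1 : i = a <;> by_cases h2 : w.length - i = b <;>
      simp [h1, h2, Prod.ext_iff, eq_comm]
  have hif : ∀ i ∈ Finset.range (w.length + 1),
      (∑ p ∈ Finset.HasAntidiagonal.antidiagonal n,
        (if (w.take i).length = p.1 then f (w.take i) else 0) *
          (if (w.drop i).length = p.2 then g (w.drop i) else 0)) =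
      if w.length = n then f (w.take i) * g (w.drop i) else 0 := by
    intro i hi
    have hi' : i ≤ w.length := Nat.lt_succ_iff.mp (Finset.mem_range.mp hi)
    rw [Finset.sum_congr rfl fun p _ => key i hi' p, Finset.sum_ite_eq']
    refine if_congr ?_ rfl rfl
    rw [Finset.HasAntidiagonal.mem_antidiagonal]
    simp only
    omega
  rw [Finset.sum_congr rfl hif]
  split_ifs <;> simp

theorem weightPart_lie (n : ℕ) (f g : Series) :
    weightPart n ⁅f, g⁆ =
      ∑ p ∈ Finset.HasAntidiagonal.antidiagonal n, ⁅weightPart p.1 f, weightPart p.2 g⁆ := by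
  simp only [Ring.lie_def, map_sub, weightPart_mul, Finset.sum_sub_distrib]
  congr 1
  rw [← Finset.Nat.sum_antidiagonal_swap]
  rfl

/-- The degree completion of a (weight-graded) Lie algebra `L` of polynomials: the series all of
whose homogeneous parts lie in `L`. -/
def degreeCompletion (L : LieSubalgebra ℚ Series) : LieSubalgebra ℚ Series where
  carrier := {f | ∀ n, weightPart n f ∈ L}
  add_mem' hf hg n := by rw [map_add]; exact L.add_mem (hf n) (hg n)
  zero_mem' n := by rw [map_zero]; exact L.zero_mem
  smul_mem' c f hf n := by rw [map_smul]; exact L.smul_mem c (hf n)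
  lie_mem' {f g} hf hg n := by
    rw [weightPart_lie]
    exact sum_mem fun p _ => L.lie_mem (hf p.1) (hg p.2)

/-- `lie₂`: the degree completion of the free Lie algebra on `x, y`, realized as the Lie algebra
of Lie series inside `ℚ⟨⟨x, y⟩⟩`. -/
def lie2 : LieSubalgebra ℚ Series := degreeCompletion (LieSubalgebra.lieSpan ℚ Series {X, Y})

/-- `C i = ad(x)^(i-1) (y)`, for `i ≥ 1`. -/
def C (i : ℕ) : Series := (fun f => ⁅X, f⁆)^[i - 1] Y

/-- `lie_C`: the degree completion of the Lie algebra generated by the `C i`, `i ≥ 1`. -/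
def lieC : LieSubalgebra ℚ Series :=
  degreeCompletion (LieSubalgebra.lieSpan ℚ Series {f | ∃ i, 1 ≤ i ∧ f = C i})

theorem weightPart_single (n : ℕ) (w : Word) :
    weightPart n (Series.single w) = if w.length = n then Series.single w else 0 := by
  ext v
  change (if v.length = n then (if v = w then (1 : ℚ) else 0) else 0) = _
  by_cases hv : v = w
  · subst hv
    by_cases h : v.length = n <;> simp [h, Series.single]
  · by_cases h : w.length = n <;> simp [h, hv, Series.single]

theorem X_mem_lie2 : X ∈ lie2 := fun n => by
  rw [X, weightPart_single]
  split_ifs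
  · exact LieSubalgebra.subset_lieSpan (by simp)
  · exact zero_mem _

theorem Y_mem_lie2 : Y ∈ lie2 := fun n => by
  rw [Y, weightPart_single]
  split_ifs
  · exact LieSubalgebra.subset_lieSpan (by simp)
  · exact zero_mem _

/-- `x` as an element of `lie₂`. -/
def xLie : lie2 := ⟨X, X_mem_lie2⟩

/-- `y` as an element of `lie₂`. -/
def yLie : lie2 := ⟨Y, Y_mem_lie2⟩

/-- `oder₂`: the derivations `D` of `lie₂` that annihilate `[x, y]` and are such that neither
`D x` nor `D y` has a linear term in `x`. The bracket is the commutator of derivations. -/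
def oder2 : Submodule ℚ (LieDerivation ℚ lie2 lie2) where
  carrier := {D | D ⁅xLie, yLie⁆ = 0 ∧ (D xLie : Series) [0] = 0 ∧ (D yLie : Series) [0] = 0}
  add_mem' := by
    rintro D E ⟨h1, h2, h3⟩ ⟨k1, k2, k3⟩
    refine ⟨?_, ?_, ?_⟩
    · rw [LieDerivation.add_apply, h1, k1, add_zero]
    · simp [h2, k2]
    · simp [h3, k3]
  zero_mem' := by simp
  smul_mem' := by
    rintro c D ⟨h1, h2, h3⟩
    refine ⟨?_, ?_, ?_⟩
    · rw [LieDerivation.smul_apply, h1, smul_zero]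
    · simp [h2]
    · simp [h3]

/-! ### The linearized Kashiwara-Vergne Lie algebra -/

/-- The inverse of the push permutation of words: the word `x^a₀ y x^a₁ y ⋯ y x^aᵣ` is mapped to
`x^a₁ y ⋯ y x^aᵣ y x^a₀`. -/
def unpushWord (w : Word) : Word := List.intercalate [1] ((w.splitOn 1).rotate 1)

/-- The push operator, the linear operator mapping the word `x^a₀ y x^a₁ y ⋯ y x^aᵣ` to
`x^aᵣ y x^a₀ y ⋯ y x^aᵣ₋₁`; so the coefficient of `w` in `push f` is that of the inverse image of
`w` in `f`. -/
def push : Series →ₗ[ℚ] Series where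
  toFun f w := f (unpushWord w)
  map_add' _ _ := rfl
  map_smul' _ _ := rfl

/-- `f^r + push (f^r) + ⋯ + push^r (f^r) = 0` for all `r ≥ 1`, where `f^r` is the part of
depth `r` of `f`. -/
def PushNeutral (f : Series) : Prop :=
  ∀ r : ℕ, 1 ≤ r → ∑ i ∈ Finset.range (r + 1), (push ^ i) (depthPart r f) = 0

/-- `b` is circ-neutral: the parts of depth `r > 1` of `b = c + x b^x + y b^y` are such that
`b^y` (whose corresponding parts have depth `r - 1 ≥ 1`) is push-neutral. -/
def CircNeutral (b : Series) : Prop := PushNeutral (Series.tailPart 1 b)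

/-- `lkv`: the push-invariant, circ-neutral elements of `lie_C` of degree at least `3`. -/
def lkv : Submodule ℚ Series where
  carrier := {b | b ∈ lieC ∧ (∀ n < 3, weightPart n b = 0) ∧ push b = b ∧ CircNeutral b}
  add_mem' := by
    rintro f g ⟨h1, h2, h3, h4⟩ ⟨k1, k2, k3, k4⟩
    refine ⟨add_mem h1 k1, fun n hn => ?_, ?_, fun r hr => ?_⟩
    · rw [map_add, h2 n hn, k2 n hn, add_zero]
    · rw [map_add, h3, k3]
    · simp only [map_add, Finset.sum_add_distrib, h4 r hr, k4 r hr, add_zero]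
  zero_mem' := ⟨zero_mem _, fun n _ => map_zero _, map_zero _, fun r _ => by simp⟩
  smul_mem' := by
    rintro c f ⟨h1, h2, h3, h4⟩
    refine ⟨lieC.smul_mem c h1, fun n hn => ?_, ?_, fun r hr => ?_⟩
    · rw [map_smul, h2 n hn, smul_zero]
    · rw [map_smul, h3]
    · simp only [map_smul, ← Finset.smul_sum, h4 r hr, smul_zero]

/-! ### Moulds -/

/-- Families of polynomials `B^r_d ∈ ℚ[u₁, …, uᵣ]`; `B^r_d` stands for the part of degree `d` of
the depth `r` component `B^r` of a mould. -/
abbrev PolyFamily : Type := (r : ℕ) → ℕ → MvPolynomial (Fin r) ℚ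

/-- The linear map sending the monomial `u₁^(a₁-1) ⋯ uᵣ^(aᵣ-1)` to `C_a₁ ⋯ C_aᵣ`. -/
def polyToSeries (r : ℕ) : MvPolynomial (Fin r) ℚ →ₗ[ℚ] Series :=
  (MvPolynomial.basisMonomials (Fin r) ℚ).constr ℚ fun m => (List.ofFn fun i => C (m i + 1)).prod

/-- `B` is the family of polynomials associated with the series `b`: for all `r` and `d`, `B^r_d` is
homogeneous of degree `d`, and if `B^r_d = ∑ k_a u₁^(a₁-1) ⋯ uᵣ^(aᵣ-1)` then the part of `b` of
depth `r` and weight `d + r` is `∑ k_a C_a₁ ⋯ C_aᵣ`. (A monomial `C_a₁ ⋯ C_aᵣ` has weight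
`a₁ + ⋯ + aᵣ`.) -/
def IsMouldOf (b : Series) (B : PolyFamily) : Prop :=
  ∀ r d : ℕ, (B r d).IsHomogeneous d ∧
    weightPart (d + r) (depthPart r b) = polyToSeries r (B r d)

/-- Multiplication of `B^r` by `u₁ ⋯ uᵣ (u₁ + ⋯ + uᵣ)`, for every `r`. This factor is homogeneous
of degree `r + 1`. -/
def Delta (B : PolyFamily) : PolyFamily := fun r d =>
  if r + 1 ≤ d then
    (∏ i, MvPolynomial.X i) * (∑ i, MvPolynomial.X i) * B r (d - (r + 1))
  else 0

/-- The field of rational functions `ℚ(u₁, …, uᵣ)` (or `ℚ(v₁, …, vᵣ)`). -/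
abbrev RatFun (r : ℕ) : Type := FractionRing (MvPolynomial (Fin r) ℚ)

/-- The variables of `ℚ(u₁, …, uᵣ)`. -/
def ratVar (r : ℕ) (i : Fin r) : RatFun r :=
  algebraMap (MvPolynomial (Fin r) ℚ) (RatFun r) (MvPolynomial.X i)

/-- The value at the arguments `g₁, …, gᵣ` of the rational function
`B_* = B / (u₁ ⋯ uᵣ (u₁ + ⋯ + uᵣ))`. -/
def starValue {r : ℕ} (p : MvPolynomial (Fin r) ℚ) (g : Fin r → RatFun r) : RatFun r :=
  MvPolynomial.eval₂ (Rat.castHom (RatFun r)) g p / ((∏ i, g i) * ∑ i, g i)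

/-- The arguments `(u₀, u₁, …, uᵣ₋₁)`, where `u₀ = -u₁ - ⋯ - uᵣ`. -/
def pushArgs {r : ℕ} (u : Fin r → RatFun r) : Fin r → RatFun r := fun i =>
  if (i : ℕ) = 0 then -∑ j, u j else u ⟨(i : ℕ) - 1, lt_of_le_of_lt (Nat.sub_le _ _) i.isLt⟩

/-- The arguments `(vᵣ, vᵣ₋₁ - vᵣ, …, v₁ - v₂)`. -/
def swapArgs {r : ℕ} (v : Fin r → RatFun r) : Fin r → RatFun r := fun i =>
  if (i : ℕ) = 0 then v (Fin.rev i)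
  else v (Fin.rev i) - v (Fin.rev ⟨(i : ℕ) - 1, lt_of_le_of_lt (Nat.sub_le _ _) i.isLt⟩)

/-- `B_*` is push-invariant: `B_*(u₀, u₁, …, uᵣ₋₁) = B_*(u₁, …, uᵣ)`. -/
def StarPushInvariant {r : ℕ} (p : MvPolynomial (Fin r) ℚ) : Prop :=
  starValue p (pushArgs (ratVar r)) = starValue p (ratVar r)

/-- `B̄_* + c` is circ-neutral, where `B̄_*(v₁, …, vᵣ) = B_*(vᵣ, vᵣ₋₁ - vᵣ, …, v₁ - v₂)` is the swap
of `B_*`: the sum of its values over the `r` cyclic permutations of `(v₁, …, vᵣ)` is zero. -/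
def StarCircNeutralAdd {r : ℕ} (p : MvPolynomial (Fin r) ℚ) (c : ℚ) : Prop :=
  ∑ k : Fin r,
    (starValue p (swapArgs fun i => ratVar r (i + k)) + (c : RatFun r)) = 0

theorem starValue_add {r : ℕ} (p q : MvPolynomial (Fin r) ℚ) (g : Fin r → RatFun r) :
    starValue (p + q) g = starValue p g + starValue q g := by
  simp [starValue, add_div]

theorem starValue_smul {r : ℕ} (c : ℚ) (p : MvPolynomial (Fin r) ℚ) (g : Fin r → RatFun r) :
    starValue (c • p) g = (c : RatFun r) * starValue p g := by
  rw [starValue, starValue, MvPolynomial.smul_eq_C_mul, MvPolynomial.eval₂_mul,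
    MvPolynomial.eval₂_C, mul_div_assoc]
  rfl

theorem IsMouldOf.add {b b' : Series} {B B' : PolyFamily} (h : IsMouldOf b B)
    (h' : IsMouldOf b' B') : IsMouldOf (b + b') (B + B') := fun r d =>
  ⟨(h r d).1.add (h' r d).1, by
    rw [map_add, map_add, (h r d).2, (h' r d).2, ← map_add]; rfl⟩

theorem IsMouldOf.smul {b : Series} {B : PolyFamily} (c : ℚ) (h : IsMouldOf b B) :
    IsMouldOf (c • b) (c • B) := fun r d =>
  ⟨(MvPolynomial.homogeneousSubmodule (Fin r) ℚ d).smul_mem c (h r d).1, by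
    rw [map_smul, map_smul, (h r d).2, ← map_smul]; rfl⟩

theorem IsMouldOf.zero : IsMouldOf 0 0 := fun r d =>
  ⟨MvPolynomial.isHomogeneous_zero _ _ _, by
    rw [map_zero, map_zero]; exact (map_zero (polyToSeries r)).symm⟩

/-- The elements `b` of `lie_C` such that, `B` being the associated family of polynomials, `B_*` is
push-invariant in all depths `r ≥ 1` and the swap of `B_*` is circ-neutral in all depths `r > 1` up
to adding in each depth (and weight) a constant from `S`. -/
def krvEllUpTo (S : Submodule ℚ ℚ) : Submodule ℚ Series where
  carrier := {b | b ∈ lieC ∧ ∃ B : PolyFamily, IsMouldOf b B ∧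
    (∀ r d, 1 ≤ r → StarPushInvariant (B r d)) ∧
    (∀ r d, 1 < r → ∃ c ∈ S, StarCircNeutralAdd (B r d) c)}
  add_mem' := by
    rintro f g ⟨h1, B, h2, h3, h4⟩ ⟨k1, B', k2, k3, k4⟩
    refine ⟨add_mem h1 k1, B + B', h2.add k2, fun r d hr => ?_, fun r d hr => ?_⟩
    · have h := h3 r d hr
      have k := k3 r d hr
      simp only [StarPushInvariant] at h k ⊢
      simp only [Pi.add_apply, starValue_add, h, k]
    · obtain ⟨c, hc, h⟩ := h4 r d hr
      obtain ⟨c', hc', k⟩ := k4 r d hr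
      refine ⟨c + c', add_mem hc hc', ?_⟩
      simp only [StarCircNeutralAdd] at h k ⊢
      simp only [Pi.add_apply, starValue_add, Rat.cast_add]
      rw [← add_zero (0 : RatFun r)]
      nth_rewrite 1 [← h]
      rw [← k, ← Finset.sum_add_distrib]
      exact Finset.sum_congr rfl fun i _ => by ring
  zero_mem' := by
    refine ⟨zero_mem _, 0, IsMouldOf.zero, fun r d _ => ?_, fun r d _ => ⟨0, zero_mem _, ?_⟩⟩
    · simp [StarPushInvariant, starValue]
    · simp [StarCircNeutralAdd, starValue]
  smul_mem' := by
    rintro a f ⟨h1, B, h2, h3, h4⟩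
    refine ⟨lieC.smul_mem a h1, a • B, h2.smul a, fun r d hr => ?_, fun r d hr => ?_⟩
    · have h := h3 r d hr
      simp only [StarPushInvariant] at h ⊢
      simp only [Pi.smul_apply, starValue_smul, h]
    · obtain ⟨c, hc, h⟩ := h4 r d hr
      refine ⟨a • c, S.smul_mem a hc, ?_⟩
      simp only [StarCircNeutralAdd] at h ⊢
      simp only [Pi.smul_apply, starValue_smul, smul_eq_mul, Rat.cast_mul]
      rw [← mul_zero (a : RatFun r), ← h, Finset.mul_sum]
      exact Finset.sum_congr rfl fun i _ => by ring

/-- `krv_ell`, the elliptic Kashiwara-Vergne space: circ-neutrality is required up to adding on an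
arbitrary constant-valued mould. -/
def krvEll : Submodule ℚ Series := krvEllUpTo ⊤

/-- The subspace of `krv_ell` defined by circ-neutrality without the addition of constants. -/
def krvEllStrict : Submodule ℚ Series := krvEllUpTo ⊥

end

end EllKV

open EllKV

/-! The argument has three independent ingredients.

Derivations. A derivation in `oder2` with D(x) = b must have D(y) = a with [x, a] = [y, b]. In the
associative algebra this equation is solvable in a exactly when b is push-invariant
(`push_eq_self_of_lie_eq`, `exists_lie_eq_of_push_eq_self`). The centralizer of x consists of series
in x alone (`eq_zero_of_lie_X_eq_zero`), so a is unique once terms of depth 0 are excluded. A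
Dynkin-type argument shows that a is a Lie series as soon as [x, a] is one
(`mem_lie2_of_lie_X_mem`). Derivations of the completed algebra are automatically continuous
(`lieDerivation_mem_fil`), so D is determined by (b, a).

Bracket. Let E_b be the derivation x ↦ 0, y ↦ [b, y]. If D(x) = [x, b(x, [x, y])] and D([x, y]) = 0,
then the substitution y ↦ [x, y] intertwines E_b - ad b with D (`lieDerivation_substitute`). Hence
[D, D'](x) = [x, c(x, [x, y])] with c = E_b(b') - E_b'(b) - [b, b'], and it remains to see that c
lies in `lkv`. Push-invariance follows by applying E_b and E_b' to the equations [x, a'] = [y, b']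
and [x, a] = [y, b]. Circ-neutrality of b says that the cyclic class of y b^y vanishes in depth at
least 2 (`circNeutral_iff`). This class is a divergence: up to commutators, y c^y = E_b(y b'^y) -
E_b'(y b^y) (`cyc_iharaBracket`). Derivations descend to cyclic words, and the remaining depth 1
part is killed because [b, y] = -[x, a] (`cyc_der_ihara_eq_zero`).

Moulds. Encode the word x^a₀ y ⋯ y x^aᵣ as the monomial t₀^a₀ ⋯ tᵣ^aᵣ. Then C_a₁ ⋯ C_aᵣ is the
monomial in u of exponents aᵢ - 1 under uᵢ = tᵢ₋₁ - tᵢ (`polyToSeries_eq`). Bracketing with x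
multiplies by t₀ - tᵣ = u₁ + ⋯ + uᵣ, and y ↦ [x, y] replaces each C_i by C_(i+1), that is,
multiplies by u₁ ⋯ uᵣ. This gives the formula for the map on families, and injectivity. The operator
push rotates t₀, …, tᵣ cyclically and fixes the factor u₁ ⋯ uᵣ (u₁ + ⋯ + uᵣ). Setting t₀ = 0 selects
the words of b starting with y, and tₘ = -vᵣ₊₁₋ₘ turns the arguments into those of the swap. So the
conditions defining `lkv` become those defining `krvEllStrict`. -/

namespace EllKV

open Series Finset

/-! ### Letters and the recursive structure of series -/

/-- The letter `c`, as a series. -/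
noncomputable def letter (c : Fin 2) : Series := single [c]

theorem letter_zero : letter 0 = X := rfl

theorem letter_one : letter 1 = Y := rfl

theorem sum_apply' {ι : Type*} (s : Finset ι) (F : ι → Series) (w : Word) :
    (∑ i ∈ s, F i) w = ∑ i ∈ s, F i w :=
  Finset.sum_apply (M := fun _ : Word => ℚ) w s F

theorem tailPart_single_cons (a c : Fin 2) (w : Word) :
    tailPart a (single (c :: w)) = if a = c then single w else 0 := by
  ext v
  by_cases h : a = c <;> simp [tailPart_apply, single, h]

theorem tailPart_letter (a c : Fin 2) : tailPart a (letter c) = if a = c then 1 else 0 :=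
  tailPart_single_cons a c []

@[simp] theorem tailPart_one (a : Fin 2) : tailPart a (1 : Series) = 0 := by
  ext v
  simp [tailPart_apply, one_apply]

@[simp] theorem letter_nil (c : Fin 2) : letter c [] = 0 := by simp [letter, single]

theorem letter_mul_nil (c : Fin 2) (f : Series) : (letter c * f) [] = 0 := by
  simp [mul_nil]

theorem letter_mul_cons (c e : Fin 2) (f : Series) (w : Word) :
    (letter c * f) (e :: w) = if e = c then f w else 0 := by
  rw [mul_cons, tailPart_letter]
  split_ifs <;> simp

theorem tailPart_letter_mul (a c : Fin 2) (f : Series) :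
    tailPart a (letter c * f) = if a = c then f else 0 := by
  ext w
  rw [tailPart_apply, letter_mul_cons]
  split_ifs <;> simp

theorem mul_letter_nil (c : Fin 2) (f : Series) : (f * letter c) [] = 0 := by
  simp [mul_nil]

theorem mul_letter_concat (c e : Fin 2) (f : Series) (w : Word) :
    (f * letter c) (w ++ [e]) = if e = c then f w else 0 := by
  induction w generalizing f with
  | nil =>
    rw [List.nil_append, mul_cons, mul_letter_nil]
    simp [letter, single]
  | cons a w ih =>
    rw [List.cons_append, mul_cons, ih, tailPart_apply]
    simp [letter, single]

theorem eq_sum_letter (f : Series) :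
    f = f [] • (1 : Series) + ∑ c, letter c * tailPart c f := by
  ext w
  rw [add_apply, sum_apply', Fin.sum_univ_two]
  cases w with
  | nil => simp [letter_mul_nil, one_apply]
  | cons a w =>
    rw [letter_mul_cons, letter_mul_cons]
    fin_cases a <;> simp [one_apply, tailPart_apply]

theorem lie_apply_nil (f g : Series) : ⁅f, g⁆ [] = 0 := by
  rw [Ring.lie_def, sub_apply, mul_nil, mul_nil]
  ring

/-! ### The weight filtration -/

/-- The series all of whose terms have weight at least `n`. -/
def fil (n : ℕ) : Submodule ℚ Series where
  carrier := {f | ∀ w : Word, w.length < n → f w = 0}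
  add_mem' hf hg w hw := by rw [add_apply, hf w hw, hg w hw, add_zero]
  zero_mem' _ _ := rfl
  smul_mem' c f hf w hw := by rw [smul_apply, hf w hw, mul_zero]

theorem mem_fil_zero (f : Series) : f ∈ fil 0 := fun _ hw => absurd hw (Nat.not_lt_zero _)

theorem mem_fil_one {f : Series} : f ∈ fil 1 ↔ f [] = 0 := by
  refine ⟨fun h => h [] (by simp), fun h w hw => ?_⟩
  rw [List.length_eq_zero_iff.mp (Nat.lt_one_iff.mp hw), h]

theorem fil_anti {m n : ℕ} (h : m ≤ n) : fil n ≤ fil m := fun _ hf w hw => hf w (by omega)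

theorem mul_mem_fil {m n : ℕ} {f g : Series} (hf : f ∈ fil m) (hg : g ∈ fil n) :
    f * g ∈ fil (m + n) := by
  intro w hw
  rw [mul_apply]
  refine sum_eq_zero fun i hi => ?_
  rw [mem_range] at hi
  by_cases h : i < m
  · rw [hf _ (by rw [List.length_take]; omega), zero_mul]
  · rw [hg _ (by rw [List.length_drop]; omega), mul_zero]

theorem lie_mem_fil {m n : ℕ} {f g : Series} (hf : f ∈ fil m) (hg : g ∈ fil n) :
    ⁅f, g⁆ ∈ fil (m + n) := by
  rw [Ring.lie_def]
  exact sub_mem (mul_mem_fil hf hg) (by rw [add_comm]; exact mul_mem_fil hg hf)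

theorem tailPart_mem_fil {n : ℕ} {f : Series} (a : Fin 2) (hf : f ∈ fil (n + 1)) :
    tailPart a f ∈ fil n := fun w hw => hf (a :: w) (by simpa using hw)

/-- The weight filtration is separated. Identities between recursively given operators are proved
below by induction on the weight modulo which they hold, each letter split off gaining one. -/
theorem eq_of_forall_sub_mem_fil {f g : Series} (h : ∀ n, f - g ∈ fil n) : f = g := by
  ext w
  have := h (w.length + 1) w (Nat.lt_succ_self _)
  rwa [sub_apply, sub_eq_zero] at this

theorem weightPart_apply (n : ℕ) (f : Series) (w : Word) :
    weightPart n f w = if w.length = n then f w else 0 := rfl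

theorem depthPart_apply (n : ℕ) (f : Series) (w : Word) :
    depthPart n f w = if w.count 1 = n then f w else 0 := rfl

theorem weightPart_weightPart (m n : ℕ) (f : Series) :
    weightPart m (weightPart n f) = if m = n then weightPart n f else 0 := by
  ext w
  rw [weightPart_apply, weightPart_apply]
  by_cases h : m = n
  · subst h
    by_cases h' : w.length = m <;> simp [h', weightPart_apply]
  · by_cases h' : w.length = m <;> simp [h', h]

theorem weightPart_eq_zero_of_mem_fil {m n : ℕ} {f : Series} (hf : f ∈ fil n) (h : m < n) :
    weightPart m f = 0 := by
  ext w
  rw [weightPart_apply]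
  split_ifs with hw
  · rw [hf w (by omega), zero_apply]
  · rfl

theorem mem_fil_of_weightPart {n : ℕ} {f : Series} (h : ∀ m < n, weightPart m f = 0) :
    f ∈ fil n := fun w hw => by
  have := congrArg (fun g : Series => g w) (h w.length hw)
  simpa [weightPart_apply] using this

theorem sub_sum_weightPart_mem_fil (n : ℕ) (f : Series) :
    f - ∑ m ∈ range n, weightPart m f ∈ fil n := fun w hw => by
  rw [sub_apply, sum_apply', sub_eq_zero]
  simp only [weightPart_apply]
  rw [sum_ite_eq, if_pos (mem_range.2 hw)]

/-- A linear map compatible with the weight filtration is determined by its values on homogeneous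
series. -/
theorem eq_of_weightPart {T T' : Series →ₗ[ℚ] Series} (hT : ∀ n, ∀ f ∈ fil n, T f ∈ fil n)
    (hT' : ∀ n, ∀ f ∈ fil n, T' f ∈ fil n) {f : Series}
    (h : ∀ n, T (weightPart n f) = T' (weightPart n f)) : T f = T' f := by
  refine eq_of_forall_sub_mem_fil fun n => ?_
  have hr := sub_sum_weightPart_mem_fil n f
  have e : T f - T' f = T (f - ∑ m ∈ range n, weightPart m f)
      - T' (f - ∑ m ∈ range n, weightPart m f) := by
    simp only [map_sub, map_sum, h]
    abel
  rw [e]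
  exact sub_mem (hT n _ hr) (hT' n _ hr)

/-- Only the finitely many parts of f of weight at most n contribute to the weight n part of T f. -/
theorem map_mem_degreeCompletion {L : LieSubalgebra ℚ Series} {T : Series →ₗ[ℚ] Series}
    (hT : ∀ n, ∀ f ∈ fil n, T f ∈ fil n) {f : Series}
    (h : ∀ n, T (weightPart n f) ∈ degreeCompletion L) : T f ∈ degreeCompletion L := by
  intro n
  have hr := hT _ _ (sub_sum_weightPart_mem_fil (n + 1) f)
  have e := weightPart_eq_zero_of_mem_fil hr (Nat.lt_succ_self n)
  rw [map_sub, map_sub, sub_eq_zero] at e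
  rw [e, map_sum]
  exact sum_mem (fun m _ => h m) n

/-! ### Continuous derivations -/

/-- The coefficients of the derivation with values `d c` on the letters `c`. -/
noncomputable def derCoeff (d : Fin 2 → Series) : Word → Series → ℚ
  | [], f => (∑ e, d e * tailPart e f) []
  | c :: w, f => (∑ e, d e * tailPart e f) (c :: w) + derCoeff d w (tailPart c f)

theorem derCoeff_add (d : Fin 2 → Series) (w : Word) (f g : Series) :
    derCoeff d w (f + g) = derCoeff d w f + derCoeff d w g := by
  induction w generalizing f g with
  | nil => simp only [derCoeff, map_add, mul_add, sum_add_distrib, add_apply]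
  | cons c w ih =>
    simp only [derCoeff, map_add, mul_add, sum_add_distrib, add_apply, ih]
    ring

theorem derCoeff_smul (d : Fin 2 → Series) (w : Word) (a : ℚ) (f : Series) :
    derCoeff d w (a • f) = a * derCoeff d w f := by
  induction w generalizing f with
  | nil => simp only [derCoeff, map_smul, mul_smul_comm, ← smul_sum, smul_apply]
  | cons c w ih =>
    simp only [derCoeff, map_smul, mul_smul_comm, ← smul_sum, smul_apply, ih]
    ring

/-- The continuous derivation of `ℚ⟨⟨x, y⟩⟩` with values `d 0` at `x` and `d 1` at `y`. -/
noncomputable def der (d : Fin 2 → Series) : Series →ₗ[ℚ] Series where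
  toFun f w := derCoeff d w f
  map_add' f g := by
    ext w
    exact derCoeff_add d w f g
  map_smul' a f := by
    ext w
    exact derCoeff_smul d w a f

theorem der_nil (d : Fin 2 → Series) (f : Series) :
    der d f [] = (∑ e, d e * tailPart e f) [] := rfl

theorem der_cons (d : Fin 2 → Series) (f : Series) (c : Fin 2) (w : Word) :
    der d f (c :: w) = (∑ e, d e * tailPart e f) (c :: w) + der d (tailPart c f) w := rfl

/-- The Leibniz rule applied to f = f(∅) + Σ e f^e; `derCoeff` is this recursion read coefficient by
coefficient. -/
theorem der_eq (d : Fin 2 → Series) (f : Series) :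
    der d f = ∑ e, (d e * tailPart e f + letter e * der d (tailPart e f)) := by
  ext w
  rw [sum_add_distrib, add_apply]
  cases w with
  | nil =>
    rw [der_nil, sum_apply' univ (fun e => letter e * der d (tailPart e f))]
    simp [letter_mul_nil]
  | cons c w =>
    rw [der_cons, sum_apply' univ (fun e => letter e * der d (tailPart e f))]
    simp [letter_mul_cons]

theorem tailPart_der (d : Fin 2 → Series) (f : Series) (c : Fin 2) :
    tailPart c (der d f) = tailPart c (∑ e, d e * tailPart e f) + der d (tailPart c f) := rfl

theorem der_one (d : Fin 2 → Series) : der d 1 = 0 := by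
  rw [der_eq]
  simp

theorem der_letter (d : Fin 2 → Series) (c : Fin 2) : der d (letter c) = d c := by
  rw [der_eq]
  simp only [tailPart_letter]
  rw [sum_eq_single c]
  · simp [der_one]
  · intro e _ he
    simp [he]
  · simp

theorem der_mul (d : Fin 2 → Series) (f g : Series) :
    der d (f * g) = der d f * g + f * der d g := by
  have hS : ∀ f g : Series, (∑ e, d e * tailPart e (f * g)) =
      f [] • (∑ e, d e * tailPart e g) + (∑ e, d e * tailPart e f) * g := by
    intro f g
    simp only [tailPart_mul, mul_add, sum_add_distrib, mul_smul_comm, smul_sum, sum_mul, mul_assoc]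
  ext w
  induction w generalizing f g with
  | nil =>
    rw [der_nil, hS, add_apply, add_apply, smul_apply, mul_nil, mul_nil f, mul_nil, der_nil,
      der_nil]
    ring
  | cons c w ih =>
    have e1 : (f [] • (∑ e, d e * tailPart e g) + (∑ e, d e * tailPart e f) * g) (c :: w) =
        f [] * (∑ e, d e * tailPart e g) (c :: w) + ((∑ e, d e * tailPart e f) * g) (c :: w) := rfl
    have e2 : (f [] • der d (tailPart c g) + der d (tailPart c f * g)) w =
        f [] * der d (tailPart c g) w + der d (tailPart c f * g) w := rfl
    have e3 : (der d f * g + f * der d g) (c :: w) =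
        (der d f * g) (c :: w) + (f * der d g) (c :: w) := rfl
    have e4 : (der d (tailPart c f) * g + tailPart c f * der d g) w =
        (der d (tailPart c f) * g) w + (tailPart c f * der d g) w := rfl
    have e5 : (tailPart c (∑ e, d e * tailPart e f) * g + der d (tailPart c f) * g) w =
        (tailPart c (∑ e, d e * tailPart e f) * g) w + (der d (tailPart c f) * g) w := rfl
    rw [der_cons, hS, tailPart_mul, map_add, map_smul, e1, e2, ih, e3, e4, mul_cons, mul_cons (der d f),
      mul_cons f, der_nil, tailPart_der, der_cons, add_mul, e5]
    ring

theorem der_lie (d : Fin 2 → Series) (f g : Series) :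
    der d ⁅f, g⁆ = ⁅der d f, g⁆ + ⁅f, der d g⁆ := by
  simp only [Ring.lie_def, map_sub, der_mul]
  abel

theorem der_mem_fil {d : Fin 2 → Series} (hd : ∀ c, d c [] = 0) (n : ℕ) (f : Series)
    (hf : f ∈ fil n) : der d f ∈ fil n := by
  intro w hw
  have hS : ∀ (n : ℕ) (f : Series), f ∈ fil n → (∑ e, d e * tailPart e f) ∈ fil n := by
    intro n f hf
    cases n with
    | zero => exact mem_fil_zero _
    | succ n =>
      rw [add_comm]
      exact sum_mem fun e _ => mul_mem_fil (mem_fil_one.2 (hd e)) (tailPart_mem_fil e hf)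
  induction w generalizing n f with
  | nil => exact hS n f hf [] hw
  | cons c w ih =>
    cases n with
    | zero => exact absurd hw (Nat.not_lt_zero _)
    | succ n =>
      rw [der_cons, hS _ f hf _ hw, zero_add]
      exact ih n (tailPart c f) (tailPart_mem_fil c hf) (by simpa using hw)

theorem der_apply_nil {d : Fin 2 → Series} (hd : ∀ c, d c [] = 0) (f : Series) :
    der d f [] = 0 := by
  rw [der_nil, sum_apply']
  simp [mul_nil, hd]

theorem der_apply_singleton (d : Fin 2 → Series) (hd : ∀ c, d c [] = 0) (f : Series) (a : Fin 2) :
    der d f [a] = ∑ e, d e [a] * f [e] := by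
  rw [der_cons, der_apply_nil hd, sum_apply', add_zero]
  refine sum_congr rfl fun e _ => ?_
  rw [mul_cons, hd, mul_nil, zero_mul, zero_add]
  rfl

theorem der_sub_apply (d d' : Fin 2 → Series) (f : Series) :
    der (d - d') f = der d f - der d' f := by
  ext w
  rw [sub_apply]
  induction w generalizing f with
  | nil =>
    simp only [der_nil, Pi.sub_apply, sub_mul, sum_sub_distrib, sub_apply]
  | cons c w ih =>
    simp only [der_cons, ih, Pi.sub_apply, sub_mul, sum_sub_distrib, sub_apply]
    ring

/-- L contains the Lie algebra spanned by S, so the Leibniz rule reduces the claim to the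
generators. -/
theorem der_lieSpan_le {d : Fin 2 → Series} {S : Set Series} {L : LieSubalgebra ℚ Series}
    (hS : S ⊆ L) (hd : ∀ s ∈ S, der d s ∈ L) {f : Series}
    (hf : f ∈ LieSubalgebra.lieSpan ℚ Series S) : der d f ∈ L := by
  induction hf using LieSubalgebra.lieSpan_induction with
  | mem s hs => exact hd s hs
  | zero => rw [map_zero]; exact zero_mem _
  | add f g _ _ hf hg => rw [map_add]; exact add_mem hf hg
  | smul a f _ hf => rw [map_smul]; exact L.smul_mem a hf
  | lie f g hf hg hf' hg' =>
    rw [der_lie]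
    have hle := LieSubalgebra.lieSpan_le.2 hS
    exact add_mem (L.lie_mem hf' (hle hg)) (L.lie_mem (hle hf) hg')

/-! ### Substitution -/

section Substitute

variable (g : Fin 2 → Series)

theorem substitute_add (f h : Series) :
    substitute g (f + h) = substitute g f + substitute g h := by
  ext v
  simp only [substitute, add_apply, add_mul, sum_add_distrib]

theorem substitute_smul (a : ℚ) (f : Series) : substitute g (a • f) = a • substitute g f := by
  ext v
  simp only [substitute, smul_apply, mul_sum, mul_assoc]

/-- Substitution as a linear map. -/
noncomputable def substLin : Series →ₗ[ℚ] Series where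
  toFun := substitute g
  map_add' := substitute_add g
  map_smul' := substitute_smul g

variable {g}

theorem prod_mem_fil (hg : ∀ c, g c [] = 0) (w : Word) :
    (w.map g).prod ∈ fil w.length := by
  induction w with
  | nil => exact mem_fil_zero _
  | cons c w ih =>
    rw [List.map_cons, List.prod_cons, List.length_cons, add_comm]
    exact mul_mem_fil (mem_fil_one.2 (hg c)) ih

theorem ofFn_prod_eq {n : ℕ} (w : Fin n → Fin 2) :
    (List.ofFn fun i => g (w i)).prod = ((List.ofFn w).map g).prod := by
  rw [List.map_ofFn]
  rfl

/-- A product of n series without constant term has weight at least n, so any bound above the length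
of v gives the same sum. The freedom in N is what allows the recursion `substitute_eq`. -/
theorem substitute_eq_sum (hg : ∀ c, g c [] = 0) (f : Series) (v : Word) (N : ℕ)
    (hN : v.length < N) :
    substitute g f v = ∑ n ∈ range N, ∑ w : Fin n → Fin 2,
      f (List.ofFn w) * (List.ofFn fun i => g (w i)).prod v := by
  rw [substitute]
  refine sum_subset (range_subset_range.2 hN) fun n _ hn => ?_
  refine sum_eq_zero fun w _ => ?_
  rw [ofFn_prod_eq, prod_mem_fil hg (List.ofFn w) v, mul_zero]
  rw [List.length_ofFn]
  simp only [mem_range, not_lt] at hn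
  omega

/-- This recursion on the first letter replaces the explicit sum over words in everything that
follows. -/
theorem substitute_eq (hg : ∀ c, g c [] = 0) (f : Series) :
    substitute g f = f [] • (1 : Series) + ∑ c, g c * substitute g (tailPart c f) := by
  ext v
  rw [substitute_eq_sum hg f v (v.length + 1 + 1) (by omega), sum_range_succ', add_comm, add_apply,
    sum_apply']
  congr 1
  · simp
  · simp only [mul_apply]
    have : ∀ c : Fin 2, ∀ i ∈ range (v.length + 1),
        g c (v.take i) * substitute g (tailPart c f) (v.drop i) =
        ∑ n ∈ range (v.length + 1), ∑ w : Fin n → Fin 2, f (c :: List.ofFn w) *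
          (g c (v.take i) * (List.ofFn fun i => g (w i)).prod (v.drop i)) := by
      intro c i _
      rw [substitute_eq_sum hg _ (v.drop i) (v.length + 1) (by rw [List.length_drop]; omega),
        mul_sum]
      refine sum_congr rfl fun n _ => ?_
      rw [mul_sum]
      refine sum_congr rfl fun w _ => ?_
      rw [tailPart_apply]
      ring
    rw [sum_congr rfl fun c _ => sum_congr rfl (this c)]
    rw [sum_congr rfl fun c _ => sum_comm, sum_comm]
    refine sum_congr rfl fun n _ => ?_
    rw [← (Fin.consEquiv fun _ : Fin (n + 1) => Fin 2).sum_comp, Fintype.sum_prod_type]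
    refine sum_congr rfl fun c _ => ?_
    rw [sum_comm]
    refine sum_congr rfl fun w _ => ?_
    rw [← mul_sum]
    simp only [Fin.consEquiv_apply, List.ofFn_succ, Fin.cons_zero, Fin.cons_succ, List.prod_cons]
    rw [mul_apply]

theorem substitute_one (hg : ∀ c, g c [] = 0) : substitute g 1 = 1 := by
  have h0 : substitute g 0 = 0 := map_zero (substLin g)
  rw [substitute_eq hg]
  simp [h0, one_apply]

theorem substitute_letter (hg : ∀ c, g c [] = 0) (c : Fin 2) :
    substitute g (letter c) = g c := by
  have h0 : substitute g 0 = 0 := map_zero (substLin g)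
  rw [substitute_eq hg, letter_nil, zero_smul, zero_add, sum_eq_single c]
  · rw [tailPart_letter, if_pos rfl, substitute_one hg, mul_one]
  · intro e _ he
    rw [tailPart_letter, if_neg he, h0, mul_zero]
  · simp

/-- If `h [] = 0` and `f`, `f'` agree below weight `n`, then `h f`, `h f'` agree below `n + 1`. -/
theorem mul_sub_mem_fil {h f f' : Series} {n : ℕ} (hh : h [] = 0) (hf : f - f' ∈ fil n) :
    h * f - h * f' ∈ fil (n + 1) := by
  rw [← mul_sub, add_comm]
  exact mul_mem_fil (mem_fil_one.2 hh) hf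

/-- Both sides satisfy the same recursion in f. Since each g c has no constant term, agreement
modulo weight n for the tails gives agreement modulo weight n + 1. -/
theorem substitute_mul (hg : ∀ c, g c [] = 0) (f h : Series) :
    substitute g (f * h) = substitute g f * substitute g h := by
  refine eq_of_forall_sub_mem_fil fun n => ?_
  induction n generalizing f h with
  | zero => exact mem_fil_zero _
  | succ n ih =>
    have e1 : substitute g (f * h) = f [] • substitute g h +
        ∑ c, g c * substitute g (tailPart c f * h) := by
      rw [substitute_eq hg, substitute_eq hg h]
      simp only [tailPart_mul, substitute_add, substitute_smul, mul_add, sum_add_distrib, smul_add,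
        smul_sum, smul_smul, mul_nil, mul_smul_comm, add_assoc]
    have e2 : substitute g f * substitute g h = f [] • substitute g h +
        ∑ c, g c * (substitute g (tailPart c f) * substitute g h) := by
      nth_rewrite 1 [substitute_eq hg f]
      rw [add_mul, smul_mul_assoc, one_mul, sum_mul]
      simp only [mul_assoc]
    rw [e1, e2, add_sub_add_left_eq_sub, ← sum_sub_distrib]
    exact sum_mem fun c _ => mul_sub_mem_fil (hg c) (ih _ _)

theorem substitute_lie (hg : ∀ c, g c [] = 0) (f h : Series) :
    substitute g ⁅f, h⁆ = ⁅substitute g f, substitute g h⁆ := by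
  have := (substLin g).map_sub (f * h) (h * f)
  rw [Ring.lie_def, Ring.lie_def, ← substitute_mul hg, ← substitute_mul hg]
  exact this

theorem substitute_mem_fil (hg : ∀ c, g c [] = 0) (n : ℕ) (f : Series) (hf : f ∈ fil n) :
    substitute g f ∈ fil n := by
  induction n generalizing f with
  | zero => exact mem_fil_zero _
  | succ n ih =>
    rw [substitute_eq hg, hf [] (Nat.succ_pos n), zero_smul, zero_add, add_comm]
    exact sum_mem fun c _ => mul_mem_fil (mem_fil_one.2 (hg c)) (ih _ (tailPart_mem_fil c hf))

/-- A derivation and a substitution intertwine as soon as they do so on letters. -/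
theorem der_substitute (hg : ∀ c, g c [] = 0) {d d' : Fin 2 → Series}
    (h : ∀ c, der d (g c) = substitute g (d' c)) (f : Series) :
    der d (substitute g f) = substitute g (der d' f) := by
  refine eq_of_forall_sub_mem_fil fun n => ?_
  induction n generalizing f with
  | zero => exact mem_fil_zero _
  | succ n ih =>
    have hs : ∀ F : Fin 2 → Series, substitute g (∑ c, F c) = ∑ c, substitute g (F c) :=
      fun F => map_sum (substLin g) F univ
    rw [der_eq d' f, hs, substitute_eq hg, map_add, map_smul, der_one, smul_zero, zero_add, map_sum,
      ← sum_sub_distrib]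
    refine sum_mem fun c _ => ?_
    rw [der_mul, substitute_add, substitute_mul hg, substitute_mul hg, h, substitute_letter hg,
      add_sub_add_left_eq_sub]
    exact mul_sub_mem_fil (hg c) (ih _)

theorem substitute_lieSpan_le (hg : ∀ c, g c [] = 0) {S : Set Series}
    {L : LieSubalgebra ℚ Series} (hS : ∀ s ∈ S, substitute g s ∈ L) {f : Series}
    (hf : f ∈ LieSubalgebra.lieSpan ℚ Series S) : substitute g f ∈ L := by
  induction hf using LieSubalgebra.lieSpan_induction with
  | mem s hs => exact hS s hs
  | zero =>
    have h0 : substitute g 0 = 0 := map_zero (substLin g)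
    rw [h0]
    exact zero_mem L
  | add f g _ _ hf hg => rw [substitute_add]; exact add_mem hf hg
  | smul a f _ hf => rw [substitute_smul]; exact L.smul_mem a hf
  | lie f g _ _ hf' hg' => rw [substitute_lie hg]; exact L.lie_mem hf' hg'

end Substitute


/-! ### Words without `y` and the centralizer of `x` -/

theorem word_eq_replicate_or_right (w : Word) :
    (∃ k, w = List.replicate k 0) ∨ ∃ M j, w = M ++ 1 :: List.replicate j 0 := by
  induction w with
  | nil => exact Or.inl ⟨0, rfl⟩
  | cons c w ih =>
    rcases ih with ⟨k, rfl⟩ | ⟨M, j, rfl⟩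
    · fin_cases c
      · exact Or.inl ⟨k + 1, rfl⟩
      · exact Or.inr ⟨[], k, rfl⟩
    · exact Or.inr ⟨c :: M, j, rfl⟩

theorem word_eq_replicate_or_left (w : Word) :
    (∃ k, w = List.replicate k 0) ∨ ∃ i N, w = List.replicate i 0 ++ 1 :: N := by
  induction w with
  | nil => exact Or.inl ⟨0, rfl⟩
  | cons c w ih =>
    fin_cases c
    · rcases ih with ⟨k, rfl⟩ | ⟨i, N, rfl⟩
      · exact Or.inl ⟨k + 1, rfl⟩
      · exact Or.inr ⟨i + 1, N, rfl⟩
    · exact Or.inr ⟨0, w, rfl⟩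

/-- Depth 0 parts are power series in x alone, and these commute. -/
theorem lie_apply_replicate (f g : Series) (k : ℕ) : ⁅f, g⁆ (List.replicate k 0) = 0 := by
  rw [Ring.lie_def, sub_apply, sub_eq_zero, mul_apply, mul_apply, ← sum_range_reflect]
  refine sum_congr rfl fun i hi => ?_
  simp only [List.length_replicate, mem_range] at hi ⊢
  rw [List.take_replicate, List.drop_replicate, List.take_replicate, List.drop_replicate, mul_comm]
  congr 3 <;> omega

/-- `f` has no terms of depth `0`. -/
def NoDepthZero (f : Series) : Prop := ∀ k, f (List.replicate k 0) = 0

theorem NoDepthZero.apply_nil {f : Series} (h : NoDepthZero f) : f [] = 0 := h 0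

theorem noDepthZero_lie (f g : Series) : NoDepthZero ⁅f, g⁆ := lie_apply_replicate f g

/-- If x f = f x, words ending in y have coefficient 0, and a trailing x can be moved to the front
without changing the coefficient. Moving all x's behind the last y leaves a word ending in y, so
only powers of x can survive. -/
theorem eq_zero_of_lie_X_eq_zero {f : Series} (hf : NoDepthZero f) (h : ⁅X, f⁆ = 0) : f = 0 := by
  have hc : ∀ w e, f (w ++ [e]) = if e = 0 then f (0 :: w) else 0 := by
    intro w e
    have := congrArg (fun g : Series => g (0 :: (w ++ [e]))) h
    simp only [Ring.lie_def, sub_apply, ← letter_zero, letter_mul_cons, zero_apply, sub_eq_zero,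
      if_true] at this
    rw [this, ← List.cons_append, mul_letter_concat]
  have key : ∀ j M, f (M ++ 1 :: List.replicate j 0) = 0 := by
    intro j
    induction j with
    | zero =>
      intro M
      rw [List.replicate_zero, hc]
      simp
    | succ j ih =>
      intro M
      rw [List.replicate_succ', ← List.cons_append, ← List.append_assoc, hc, if_pos rfl,
        ← List.cons_append, ih]
  ext w
  rcases word_eq_replicate_or_right w with ⟨k, rfl⟩ | ⟨M, j, rfl⟩
  · exact hf k
  · exact key j M

/-! ### Lie polynomials and Lie series -/

theorem letter_mem_lieSpan (c : Fin 2) : letter c ∈ LieSubalgebra.lieSpan ℚ Series {X, Y} := by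
  fin_cases c
  · exact LieSubalgebra.subset_lieSpan (by simp [letter_zero])
  · exact LieSubalgebra.subset_lieSpan (by simp [letter_one])

theorem lieSpan_le_lie2 : LieSubalgebra.lieSpan ℚ Series {X, Y} ≤ lie2 := by
  rw [LieSubalgebra.lieSpan_le]
  rintro f (rfl | rfl)
  · exact X_mem_lie2
  · exact Y_mem_lie2

theorem weightPart_mem_lie2 {f : Series} (hf : f ∈ lie2) (n : ℕ) : weightPart n f ∈ lie2 :=
  lieSpan_le_lie2 (hf n)

theorem eq_of_forall_weightPart {f g : Series} (h : ∀ n, weightPart n f = weightPart n g) :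
    f = g := by
  ext w
  simpa [weightPart_apply] using congrArg (fun g : Series => g w) (h w.length)

theorem weightPart_succ_letter_mul (n : ℕ) (c : Fin 2) (f : Series) :
    weightPart (n + 1) (letter c * f) = letter c * weightPart n f := by
  ext w
  cases w with
  | nil => rw [weightPart_apply, letter_mul_nil, letter_mul_nil, ite_self]
  | cons e w =>
    rw [weightPart_apply, letter_mul_cons, letter_mul_cons, weightPart_apply]
    by_cases h : w.length = n <;> simp [h]

theorem weightPart_succ_mul_letter (n : ℕ) (c : Fin 2) (f : Series) :
    weightPart (n + 1) (f * letter c) = weightPart n f * letter c := by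
  ext w
  rcases List.eq_nil_or_concat' w with rfl | ⟨w, e, rfl⟩
  · rw [weightPart_apply, mul_letter_nil, mul_letter_nil, ite_self]
  · rw [weightPart_apply, mul_letter_concat, mul_letter_concat, weightPart_apply]
    by_cases h : w.length = n <;> simp [h]

theorem weightPart_succ_lie_letter (n : ℕ) (c : Fin 2) (f : Series) :
    weightPart (n + 1) ⁅letter c, f⁆ = ⁅letter c, weightPart n f⁆ := by
  rw [Ring.lie_def, Ring.lie_def, map_sub, weightPart_succ_letter_mul, weightPart_succ_mul_letter]

theorem weightPart_zero_of_nil {f : Series} (h : f [] = 0) : weightPart 0 f = 0 :=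
  weightPart_eq_zero_of_mem_fil (mem_fil_one.2 h) Nat.one_pos

/-- Brackets have no depth 0 terms, so the only power of x in a Lie polynomial is the linear one
coming from the generator. -/
theorem lieSpan_apply_nil {f : Series} (hf : f ∈ LieSubalgebra.lieSpan ℚ Series {X, Y}) :
    f [] = 0 ∧ ∀ k, f (List.replicate (k + 2) 0) = 0 := by
  induction hf using LieSubalgebra.lieSpan_induction with
  | mem s hs =>
    rcases hs with rfl | rfl <;>
      simp [X, Y, single, List.replicate_succ]
  | zero => exact ⟨rfl, fun _ => rfl⟩
  | add f g _ _ hf hg =>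
    exact ⟨by rw [add_apply, hf.1, hg.1, add_zero], fun k => by
      rw [add_apply, hf.2, hg.2, add_zero]⟩
  | smul a f _ hf =>
    exact ⟨by rw [smul_apply, hf.1, mul_zero], fun k => by rw [smul_apply, hf.2, mul_zero]⟩
  | lie f g _ _ _ _ => exact ⟨lie_apply_nil f g, fun k => lie_apply_replicate f g _⟩

theorem apply_nil_of_mem_lie2 {f : Series} (hf : f ∈ lie2) : f [] = 0 := by
  simpa [weightPart_apply] using (lieSpan_apply_nil (hf 0)).1

theorem noDepthZero_of_mem_lie2 {f : Series} (hf : f ∈ lie2) (h : f [0] = 0) :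
    NoDepthZero f := by
  rintro (_ | _ | k)
  · exact apply_nil_of_mem_lie2 hf
  · exact h
  · simpa [weightPart_apply] using (lieSpan_apply_nil (hf (k + 2))).2 k

theorem mem_fil_one_of_mem_lie2 {f : Series} (hf : f ∈ lie2) : f ∈ fil 1 :=
  mem_fil_one.2 (apply_nil_of_mem_lie2 hf)

/-- By the Jacobi identity [[f, f'], g] = [f, [f', g]] - [f', [f, g]], so the left argument can be
broken up until it is a letter; hence the induction over all g at once. -/
theorem lie_lieSpan_decomposition {f g : Series}
    (hf : f ∈ LieSubalgebra.lieSpan ℚ Series {X, Y})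
    (hg : g ∈ LieSubalgebra.lieSpan ℚ Series {X, Y}) :
    ∃ g₀ ∈ LieSubalgebra.lieSpan ℚ Series {X, Y}, ∃ g₁ ∈ LieSubalgebra.lieSpan ℚ Series {X, Y},
      ⁅f, g⁆ = ⁅X, g₀⁆ + ⁅Y, g₁⁆ := by
  induction hf using LieSubalgebra.lieSpan_induction generalizing g with
  | mem s hs =>
    rcases hs with rfl | rfl
    · exact ⟨g, hg, 0, zero_mem _, by simp⟩
    · exact ⟨0, zero_mem _, g, hg, by simp⟩
  | zero => exact ⟨0, zero_mem _, 0, zero_mem _, by simp⟩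
  | add f f' _ _ h h' =>
    obtain ⟨g₀, h₀, g₁, h₁, e⟩ := h hg
    obtain ⟨g₀', h₀', g₁', h₁', e'⟩ := h' hg
    exact ⟨g₀ + g₀', add_mem h₀ h₀', g₁ + g₁', add_mem h₁ h₁', by
      rw [add_lie, e, e', lie_add, lie_add]; abel⟩
  | smul a f _ h =>
    obtain ⟨g₀, h₀, g₁, h₁, e⟩ := h hg
    exact ⟨a • g₀, LieSubalgebra.smul_mem _ a h₀, a • g₁, LieSubalgebra.smul_mem _ a h₁, by
      rw [smul_lie, e, lie_smul, lie_smul, smul_add]⟩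
  | lie f f' hf hf' h h' =>
    obtain ⟨g₀, h₀, g₁, h₁, e⟩ := h (LieSubalgebra.lie_mem _ hf' hg)
    obtain ⟨g₀', h₀', g₁', h₁', e'⟩ := h' (LieSubalgebra.lie_mem _ hf hg)
    exact ⟨g₀ - g₀', sub_mem h₀ h₀', g₁ - g₁', sub_mem h₁ h₁', by
      rw [lie_lie, e, e', lie_sub, lie_sub]; abel⟩

theorem lieSpan_decomposition {f : Series} (hf : f ∈ LieSubalgebra.lieSpan ℚ Series {X, Y}) :
    ∃ a b : ℚ, ∃ g₀ ∈ LieSubalgebra.lieSpan ℚ Series {X, Y},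
      ∃ g₁ ∈ LieSubalgebra.lieSpan ℚ Series {X, Y},
      f = a • X + b • Y + (⁅X, g₀⁆ + ⁅Y, g₁⁆) := by
  induction hf using LieSubalgebra.lieSpan_induction with
  | mem s hs =>
    rcases hs with rfl | rfl
    · exact ⟨1, 0, 0, zero_mem _, 0, zero_mem _, by simp⟩
    · exact ⟨0, 1, 0, zero_mem _, 0, zero_mem _, by simp⟩
  | zero => exact ⟨0, 0, 0, zero_mem _, 0, zero_mem _, by simp⟩
  | add f f' _ _ h h' =>
    obtain ⟨a, b, g₀, h₀, g₁, h₁, e⟩ := h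
    obtain ⟨a', b', g₀', h₀', g₁', h₁', e'⟩ := h'
    exact ⟨a + a', b + b', g₀ + g₀', add_mem h₀ h₀', g₁ + g₁', add_mem h₁ h₁', by
      rw [e, e', lie_add, lie_add, add_smul, add_smul]; abel⟩
  | smul r f _ h =>
    obtain ⟨a, b, g₀, h₀, g₁, h₁, e⟩ := h
    exact ⟨r * a, r * b, r • g₀, LieSubalgebra.smul_mem _ r h₀, r • g₁,
      LieSubalgebra.smul_mem _ r h₁, by
      rw [e, lie_smul, lie_smul, smul_add, smul_add, smul_add, smul_smul, smul_smul]⟩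
  | lie f f' hf hf' _ _ =>
    obtain ⟨g₀, h₀, g₁, h₁, e⟩ := lie_lieSpan_decomposition hf hf'
    exact ⟨0, 0, g₀, h₀, g₁, h₁, by simp [e]⟩

/-- The series with given homogeneous parts. -/
def assemble (g : ℕ → Series) : Series := fun w => g w.length w

theorem weightPart_assemble {g : ℕ → Series} (hg : ∀ m, weightPart m (g m) = g m) (m : ℕ) :
    weightPart m (assemble g) = g m := by
  ext w
  rw [← hg m, weightPart_apply, weightPart_apply, assemble]
  split_ifs with h
  · rw [h]
  · rfl

/-- A Lie series of weight at least `n + 2` is `[x, g₀] + [y, g₁]` for Lie series `g₀`, `g₁` of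
weight at least `n + 1`. -/
theorem lie2_decomposition {n : ℕ} {f : Series} (hf : f ∈ lie2) (hn : f ∈ fil (n + 2)) :
    ∃ g₀ ∈ lie2, ∃ g₁ ∈ lie2, g₀ ∈ fil (n + 1) ∧ g₁ ∈ fil (n + 1) ∧ f = ⁅X, g₀⁆ + ⁅Y, g₁⁆ := by
  have h : ∀ m, ∃ g₀ ∈ LieSubalgebra.lieSpan ℚ Series {X, Y},
      ∃ g₁ ∈ LieSubalgebra.lieSpan ℚ Series {X, Y}, weightPart m g₀ = g₀ ∧ weightPart m g₁ = g₁ ∧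
        (m < n + 1 → g₀ = 0 ∧ g₁ = 0) ∧ weightPart (m + 1) f = ⁅X, g₀⁆ + ⁅Y, g₁⁆ := by
    intro m
    -- Zero is chosen in low weights so that the assembled series inherit the weight bound.
    by_cases hm : m < n + 1
    · refine ⟨0, zero_mem _, 0, zero_mem _, map_zero _, map_zero _, fun _ => ⟨rfl, rfl⟩, ?_⟩
      rw [weightPart_eq_zero_of_mem_fil hn (by omega)]
      simp
    · obtain ⟨a, b, g₀, h₀, g₁, h₁, e⟩ := lieSpan_decomposition (hf (m + 1))
      refine ⟨_, lieSpan_le_lie2 h₀ m, _, lieSpan_le_lie2 h₁ m, ?_, ?_, fun h => absurd h hm, ?_⟩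
      · rw [weightPart_weightPart, if_pos rfl]
      · rw [weightPart_weightPart, if_pos rfl]
      · have e' := congrArg (weightPart (m + 1)) e
        rw [weightPart_weightPart, if_pos rfl] at e'
        have hX : weightPart (m + 1) X = 0 := by
          rw [X, weightPart_single, if_neg]
          simp only [List.length_singleton]
          omega
        have hY : weightPart (m + 1) Y = 0 := by
          rw [Y, weightPart_single, if_neg]
          simp only [List.length_singleton]
          omega
        rw [e', map_add, map_add, map_smul, map_smul, hX, hY, map_add, ← letter_zero, ← letter_one,
          weightPart_succ_lie_letter, weightPart_succ_lie_letter]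
        simp
  choose g₀ h₀ g₁ h₁ w₀ w₁ hz e using h
  have W₀ := weightPart_assemble w₀
  have W₁ := weightPart_assemble w₁
  refine ⟨assemble g₀, fun m => ?_, assemble g₁, fun m => ?_,
    mem_fil_of_weightPart fun m hm => ?_, mem_fil_of_weightPart fun m hm => ?_,
    eq_of_forall_weightPart fun m => ?_⟩
  · rw [W₀]; exact h₀ m
  · rw [W₁]; exact h₁ m
  · rw [W₀]; exact (hz m hm).1
  · rw [W₁]; exact (hz m hm).2
  · cases m with
    | zero =>
      rw [weightPart_eq_zero_of_mem_fil hn (by omega), weightPart_zero_of_nil]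
      rw [Series.add_apply, lie_apply_nil, lie_apply_nil, add_zero]
    | succ m =>
      rw [map_add, ← letter_zero, ← letter_one, weightPart_succ_lie_letter,
        weightPart_succ_lie_letter, W₀, W₁, e]
      rfl

/-! ### Derivations of `lie₂` -/

theorem der_mem_lie2 {d : Fin 2 → Series} (hd : ∀ c, d c ∈ lie2) {f : Series} (hf : f ∈ lie2) :
    der d f ∈ lie2 := by
  refine map_mem_degreeCompletion (der_mem_fil fun c => apply_nil_of_mem_lie2 (hd c)) fun n => ?_
  refine der_lieSpan_le (L := lie2) (S := {X, Y}) ?_ ?_ (hf n)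
  · rintro s (rfl | rfl)
    · exact X_mem_lie2
    · exact Y_mem_lie2
  · rintro s (rfl | rfl)
    · rw [← letter_zero, der_letter]; exact hd 0
    · rw [← letter_one, der_letter]; exact hd 1

/-- The derivation of `lie₂` with given values at `x` and `y`. -/
noncomputable def lie2Der (d : Fin 2 → Series) (hd : ∀ c, d c ∈ lie2) :
    LieDerivation ℚ lie2 lie2 where
  toFun f := ⟨der d f, der_mem_lie2 hd f.2⟩
  map_add' f g := Subtype.ext (map_add (der d) _ _)
  map_smul' a f := Subtype.ext (map_smul (der d) _ _)
  leibniz' f g := by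
    refine Subtype.ext ?_
    change der d ⁅(f : Series), (g : Series)⁆ = ⁅(f : Series), der d g⁆ - ⁅(g : Series), der d f⁆
    rw [der_lie, ← lie_skew (g : Series) (der d f)]
    abel

theorem coe_lie2Der (d : Fin 2 → Series) (hd : ∀ c, d c ∈ lie2) (f : lie2) :
    (lie2Der d hd f : Series) = der d f := rfl

/-- The values of a derivation at `x` and `y`. -/
noncomputable def derValues (D : LieDerivation ℚ lie2 lie2) : Fin 2 → Series :=
  ![(D xLie : Series), (D yLie : Series)]

theorem derValues_mem (D : LieDerivation ℚ lie2 lie2) (c : Fin 2) : derValues D c ∈ lie2 := by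
  fin_cases c
  · exact (D xLie).2
  · exact (D yLie).2

theorem derValues_nil (D : LieDerivation ℚ lie2 lie2) (c : Fin 2) : derValues D c [] = 0 :=
  apply_nil_of_mem_lie2 (derValues_mem D c)

theorem coe_lieDerivation_lie (D : LieDerivation ℚ lie2 lie2) (f g : lie2) :
    (D ⁅f, g⁆ : Series) = ⁅(f : Series), (D g : Series)⁆ - ⁅(g : Series), (D f : Series)⁆ := by
  rw [LieDerivation.apply_lie_eq_sub]
  rfl

/-- Derivations of `lie₂` are automatically continuous. -/
theorem lieDerivation_mem_fil (D : LieDerivation ℚ lie2 lie2) (n : ℕ) (f : lie2)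
    (hf : (f : Series) ∈ fil n) : (D f : Series) ∈ fil n := by
  induction n generalizing f with
  | zero => exact mem_fil_zero _
  | succ n ih =>
    cases n with
    | zero => exact mem_fil_one_of_mem_lie2 (D f).2
    | succ n =>
      -- D is only assumed linear over ℚ. The bound comes from writing f with just two brackets: in
      -- D[c, g] = [c, D g] - [g, D c] both c and D c have weight at least 1, and D g is covered by
      -- induction.
      obtain ⟨g₀, h₀, g₁, h₁, k₀, k₁, e⟩ := lie2_decomposition f.2 hf
      have e' : f = ⁅xLie, (⟨g₀, h₀⟩ : lie2)⁆ + ⁅yLie, (⟨g₁, h₁⟩ : lie2)⁆ := Subtype.ext e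
      have hl : ∀ (c g : lie2), (g : Series) ∈ fil (n + 1) → (D ⁅c, g⁆ : Series) ∈ fil (n + 1 + 1) := by
        intro c g hg
        rw [coe_lieDerivation_lie]
        refine sub_mem ?_ (lie_mem_fil hg (mem_fil_one_of_mem_lie2 (D c).2))
        rw [add_comm]
        exact lie_mem_fil (mem_fil_one_of_mem_lie2 c.2) (ih g hg)
      rw [e', map_add]
      exact add_mem (hl _ _ k₀) (hl _ _ k₁)

theorem lieDerivation_apply_of_mem_lieSpan (D : LieDerivation ℚ lie2 lie2) {f : Series}
    (hf : f ∈ LieSubalgebra.lieSpan ℚ Series {X, Y}) :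
    (D ⟨f, lieSpan_le_lie2 hf⟩ : Series) = der (derValues D) f := by
  induction hf using LieSubalgebra.lieSpan_induction with
  | mem s hs =>
    rcases hs with rfl | rfl
    · exact (der_letter (derValues D) 0).symm
    · exact (der_letter (derValues D) 1).symm
  | zero =>
    rw [map_zero]
    exact congrArg Subtype.val (map_zero D)
  | add f g hf hg h h' =>
    rw [map_add, ← h, ← h']
    exact congrArg Subtype.val
      (map_add D ⟨f, lieSpan_le_lie2 hf⟩ ⟨g, lieSpan_le_lie2 hg⟩)
  | smul a f hf h =>
    rw [map_smul, ← h]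
    exact congrArg Subtype.val (map_smul D a ⟨f, lieSpan_le_lie2 hf⟩)
  | lie f g hf hg h h' =>
    rw [der_lie, ← h, ← h']
    have := coe_lieDerivation_lie D ⟨f, lieSpan_le_lie2 hf⟩ ⟨g, lieSpan_le_lie2 hg⟩
    refine Eq.trans this ?_
    rw [← lie_skew _ g, sub_eq_add_neg, add_comm]

/-- A derivation of `lie₂` is determined by its values at `x` and `y`. -/
theorem lieDerivation_apply (D : LieDerivation ℚ lie2 lie2) (f : lie2) :
    (D f : Series) = der (derValues D) f := by
  refine eq_of_forall_sub_mem_fil fun n => ?_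
  -- On the truncation, a Lie polynomial, both sides agree by the Leibniz rule; on the remainder
  -- both sides have weight at least n.
  let s : lie2 := ∑ m ∈ range n, ⟨weightPart m f, weightPart_mem_lie2 f.2 m⟩
  have hs : (s : Series) = ∑ m ∈ range n, weightPart m (f : Series) := by
    exact map_sum (lie2.toSubmodule.subtype) _ _
  have hD : (D s : Series) = der (derValues D) s := by
    rw [hs, map_sum (der _), map_sum D]
    refine Eq.trans (map_sum (lie2.toSubmodule.subtype) _ _) (sum_congr rfl fun m _ => ?_)
    exact lieDerivation_apply_of_mem_lieSpan D (f.2 m)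
  have hr : ((f - s : lie2) : Series) ∈ fil n := by
    change (f : Series) - (s : Series) ∈ fil n
    rw [hs]
    exact sub_sum_weightPart_mem_fil n f
  have e : (D f : Series) - der (derValues D) f =
      (D (f - s) : Series) - der (derValues D) ((f - s : lie2) : Series) := by
    have h1 : (D (f - s) : Series) = (D f : Series) - (D s : Series) :=
      congrArg Subtype.val (map_sub D f s)
    have h2 : ((f - s : lie2) : Series) = (f : Series) - (s : Series) := rfl
    rw [h1, h2, map_sub, hD]
    abel
  rw [e]
  exact sub_mem (lieDerivation_mem_fil D n _ hr) (der_mem_fil (derValues_nil D) n _ hr)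


/-! ### Modules over the free associative algebra and the Dynkin operator -/

section Act

variable {M : Type*} [AddCommGroup M] [Module ℚ M]

/-- The action of (the part of weight at most `n` of) a series on a module on which the letters act
by `T`. -/
noncomputable def act (T : Fin 2 → Module.End ℚ M) : ℕ → Series → Module.End ℚ M
  | 0, f => f [] • (1 : Module.End ℚ M)
  | n + 1, f => f [] • (1 : Module.End ℚ M) + ∑ c, T c * act T n (tailPart c f)

/-- All terms of `f` have weight at most `n`. -/
def WeightLE (n : ℕ) (f : Series) : Prop := ∀ w : Word, n < w.length → f w = 0

theorem WeightLE.mono {m n : ℕ} {f : Series} (h : WeightLE m f) (hmn : m ≤ n) : WeightLE n f :=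
  fun w hw => h w (by omega)

theorem WeightLE.tailPart {n : ℕ} {f : Series} (h : WeightLE (n + 1) f) (c : Fin 2) :
    WeightLE n (Series.tailPart c f) := fun w hw => h (c :: w) (by simpa using hw)

theorem WeightLE.mul {m n : ℕ} {f g : Series} (hf : WeightLE m f) (hg : WeightLE n g) :
    WeightLE (m + n) (f * g) := by
  intro w hw
  rw [mul_apply]
  refine sum_eq_zero fun i hi => ?_
  rw [mem_range] at hi
  by_cases h : m < i
  · rw [hf _ (by rw [List.length_take]; omega), zero_mul]
  · rw [hg _ (by rw [List.length_drop]; omega), mul_zero]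

theorem WeightLE.sub {n : ℕ} {f g : Series} (hf : WeightLE n f) (hg : WeightLE n g) :
    WeightLE n (f - g) := fun w hw => by rw [sub_apply, hf w hw, hg w hw, sub_zero]

theorem WeightLE.lie {m n : ℕ} {f g : Series} (hf : WeightLE m f) (hg : WeightLE n g) :
    WeightLE (m + n) ⁅f, g⁆ := by
  rw [Ring.lie_def]
  exact (hf.mul hg).sub (by rw [add_comm]; exact hg.mul hf)

theorem weightLE_weightPart (n : ℕ) (f : Series) : WeightLE n (weightPart n f) := fun w hw => by
  rw [weightPart_apply, if_neg (by omega)]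

theorem weightLE_letter (c : Fin 2) : WeightLE 1 (letter c) := fun w hw => by
  rw [letter, single, if_neg]
  rintro rfl
  simp at hw

variable (T : Fin 2 → Module.End ℚ M)

theorem act_add (n : ℕ) (f g : Series) : act T n (f + g) = act T n f + act T n g := by
  induction n generalizing f g with
  | zero => simp only [act, Series.add_apply, add_smul]
  | succ n ih =>
    simp only [act, Series.add_apply, add_smul, map_add, ih, mul_add, sum_add_distrib]
    abel

theorem act_smul (n : ℕ) (a : ℚ) (f : Series) : act T n (a • f) = a • act T n f := by
  induction n generalizing f with
  | zero => simp only [act, Series.smul_apply, mul_smul]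
  | succ n ih =>
    simp only [act, Series.smul_apply, mul_smul, map_smul, ih, mul_smul_comm, ← smul_sum, smul_add]

theorem act_zero (n : ℕ) : act T n 0 = 0 := by
  have := act_smul T n 0 0
  rwa [zero_smul, zero_smul] at this

theorem act_sub (n : ℕ) (f g : Series) : act T n (f - g) = act T n f - act T n g := by
  have := act_add T n (f - g) g
  rw [sub_add_cancel] at this
  rw [this, add_sub_cancel_right]

theorem act_succ {n : ℕ} {f : Series} (h : WeightLE n f) : act T (n + 1) f = act T n f := by
  induction n generalizing f with
  | zero =>
    have : ∀ c, tailPart c f = 0 := fun c => by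
      ext w
      exact h (c :: w) (by simp)
    simp only [act, this, Series.zero_apply, zero_smul, mul_zero, sum_const_zero, add_zero]
  | succ n ih =>
    rw [act, act]
    simp only [ih (h.tailPart _)]

theorem act_of_le {m n : ℕ} (hmn : m ≤ n) {f : Series} (h : WeightLE m f) :
    act T n f = act T m f := by
  induction n, hmn using Nat.le_induction with
  | base => rfl
  | succ n hmn ih => rw [act_succ T (h.mono hmn), ih]

/-- An infinite series has no action on an arbitrary module, hence the truncation in `act`. On
polynomials the truncation is immaterial beyond the weight, and `act` is the algebra homomorphism
extending T. -/
theorem act_mul {m n : ℕ} {f g : Series} (hf : WeightLE m f) (hg : WeightLE n g) :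
    act T (m + n) (f * g) = act T m f * act T n g := by
  induction m generalizing f with
  | zero =>
    have : f = f [] • (1 : Series) := by
      ext w
      cases w with
      | nil => simp [one_apply]
      | cons c w => rw [hf _ (by simp)]; simp [one_apply]
    rw [zero_add, act]
    nth_rewrite 1 [this]
    rw [smul_mul_assoc, one_mul, act_smul, smul_mul_assoc, one_mul]
  | succ m ih =>
    have ih' := fun c => ih (hf.tailPart c)
    rw [Nat.succ_add, act, act]
    simp only [tailPart_mul, act_add, act_smul, ih', mul_nil, mul_add, sum_add_distrib, add_mul,
      sum_mul, mul_assoc]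
    rw [← add_assoc]
    congr 1
    have : act T (m + n + 1) g = act T n g := act_of_le T (by omega) hg
    rw [← this, act, smul_mul_assoc, one_mul, smul_add, smul_smul, smul_sum]
    simp only [mul_smul_comm]

theorem act_letter (c : Fin 2) : act T 1 (letter c) = T c := by
  simp only [act, letter_nil, zero_smul, zero_add, tailPart_apply]
  rw [sum_eq_single c]
  · simp [letter, single]
  · intro e _ he
    simp [letter, single, he]
  · simp

end Act

/-- The Euler derivation, multiplication by the weight. -/
theorem der_letter_apply (f : Series) (w : Word) : der letter f w = w.length * f w := by
  have hS : ∀ f : Series, ∀ w : Word, (∑ e, letter e * tailPart e f) w = if w = [] then 0 else f w := by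
    intro f w
    rw [sum_apply']
    cases w with
    | nil => simp [letter_mul_nil]
    | cons c w => simp [letter_mul_cons, tailPart_apply]
  induction w generalizing f with
  | nil => rw [der_nil, hS]; simp
  | cons c w ih =>
    rw [der_cons, hS, ih, tailPart_apply, if_neg (List.cons_ne_nil _ _), List.length_cons]
    push_cast
    ring

theorem der_letter_of_homogeneous {n : ℕ} {f : Series} (h : weightPart n f = f) :
    der letter f = (n : ℚ) • f := by
  ext w
  rw [der_letter_apply, smul_apply, ← h, weightPart_apply]
  split_ifs with hw
  · rw [hw]
  · simp

/-- The action of the letters on `Ass₂ × ℚ` whose extension to `Ass₂` combines the adjoint action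
with the Dynkin operator. -/
noncomputable def dynkin (c : Fin 2) : Module.End ℚ (Series × ℚ) where
  toFun p := (⁅letter c, p.1⁆ + p.2 • letter c, 0)
  map_add' p q := by
    ext1
    · simp only [Prod.fst_add, Prod.snd_add, lie_add, add_smul]
      abel
    · simp
  map_smul' a p := by
    ext1
    · simp only [Prod.smul_fst, Prod.smul_snd, lie_smul, smul_add, smul_smul, smul_eq_mul,
        RingHom.id_apply]
    · simp

theorem dynkin_apply (c : Fin 2) (p : Series × ℚ) :
    dynkin c p = (⁅letter c, p.1⁆ + p.2 • letter c, 0) := rfl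

/-- For a Lie polynomial, the action through `dynkin` is the adjoint action together with the
multiplication by the weight. -/
theorem act_dynkin_of_mem_lieSpan {f : Series}
    (hf : f ∈ LieSubalgebra.lieSpan ℚ Series {X, Y}) :
    ∃ n, WeightLE n f ∧ ∀ p, act dynkin n f p = (⁅f, p.1⁆ + p.2 • der letter f, 0) := by
  induction hf using LieSubalgebra.lieSpan_induction with
  | mem s hs =>
    have : ∃ c, s = letter c := by
      rcases hs with rfl | rfl
      · exact ⟨0, rfl⟩
      · exact ⟨1, rfl⟩
    obtain ⟨c, rfl⟩ := this
    exact ⟨1, weightLE_letter c, fun p => by rw [act_letter, dynkin_apply, der_letter]⟩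
  | zero => exact ⟨0, fun _ _ => rfl, fun p => by rw [act_zero]; simp; rfl⟩
  | add f g _ _ hf hg =>
    obtain ⟨m, hm, ef⟩ := hf
    obtain ⟨n, hn, eg⟩ := hg
    refine ⟨max m n, fun w hw => ?_, fun p => ?_⟩
    · rw [Series.add_apply, hm w (by omega), hn w (by omega), add_zero]
    · rw [act_add, act_of_le _ (le_max_left m n) hm, act_of_le _ (le_max_right m n) hn,
        LinearMap.add_apply, ef, eg, map_add, add_lie, smul_add]
      ext1
      · simp only [Prod.fst_add]
        abel
      · simp
  | smul a f _ hf =>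
    obtain ⟨m, hm, ef⟩ := hf
    refine ⟨m, fun w hw => by rw [Series.smul_apply, hm w hw, mul_zero], fun p => ?_⟩
    rw [act_smul, LinearMap.smul_apply, ef, map_smul, smul_lie, smul_comm p.2]
    ext1
    · simp only [Prod.smul_fst, smul_add]
    · simp
  | lie f g _ _ hf hg =>
    obtain ⟨m, hm, ef⟩ := hf
    obtain ⟨n, hn, eg⟩ := hg
    refine ⟨m + n, hm.lie hn, fun p => ?_⟩
    have e : act dynkin (m + n) ⁅f, g⁆ = act dynkin m f * act dynkin n g -
        act dynkin n g * act dynkin m f := by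
      rw [Ring.lie_def, act_sub, act_mul _ hm hn, add_comm m n, act_mul _ hn hm]
    -- The second coordinate vanishes after one application, so the commutator acts on (0, 1) by [f,
    -- E g] - [g, E f] with E the Euler derivation, which is E[f, g].
    rw [e, LinearMap.sub_apply, Module.End.mul_apply, Module.End.mul_apply, ef, eg, ef, eg, der_lie]
    ext1
    · simp only [Prod.fst_sub, zero_smul, add_zero, lie_add, lie_smul, smul_add, lie_lie,
        ← lie_skew (der letter f) g]
      simp only [smul_neg]
      abel
    · simp

theorem act_dynkin_snd (n : ℕ) (f : Series) (p : Series × ℚ) :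
    (act dynkin n f p).2 = f [] * p.2 := by
  cases n with
  | zero => simp [act]
  | succ n => simp [act, dynkin_apply]

/-- The series f is arbitrary: as with the Dynkin operator, the output is built from brackets with
letters. This is the source of Lie membership in `mem_lieSpan_of_lie_X_mem`. -/
theorem act_dynkin_fst_mem (n : ℕ) (f : Series) (p : Series × ℚ)
    (hp : p.1 ∈ LieSubalgebra.lieSpan ℚ Series {X, Y}) :
    (act dynkin n f p).1 ∈ LieSubalgebra.lieSpan ℚ Series {X, Y} := by
  induction n generalizing f with
  | zero => exact LieSubalgebra.smul_mem _ _ hp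
  | succ n ih =>
    have : (act dynkin (n + 1) f p).1 = f [] • p.1 + ∑ c, (dynkin c (act dynkin n (tailPart c f) p)).1 := by
      simp [act]
    rw [this]
    refine add_mem (LieSubalgebra.smul_mem _ _ hp) (sum_mem fun c _ => ?_)
    exact add_mem (LieSubalgebra.lie_mem _ (letter_mem_lieSpan c) (ih _))
      (LieSubalgebra.smul_mem _ _ (letter_mem_lieSpan c))

/-- Besides brackets, the only possible depth 0 contribution is the letter x, and its coefficient is
a multiple of f [0] = 0. -/
theorem noDepthZero_act_dynkin {n : ℕ} {f : Series} (hf : NoDepthZero f) (p : Series × ℚ) :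
    NoDepthZero (act dynkin n f p).1 := by
  intro k
  cases n with
  | zero =>
    have : (act dynkin 0 f p).1 = f [] • p.1 := rfl
    rw [this, hf.apply_nil, zero_smul]
    rfl
  | succ n =>
    have : (act dynkin (n + 1) f p).1 = f [] • p.1 + ∑ c, (dynkin c (act dynkin n (tailPart c f) p)).1 := by
      simp [act]
    rw [this, hf.apply_nil, zero_smul, zero_add, Fin.sum_univ_two, dynkin_apply, dynkin_apply,
      act_dynkin_snd, tailPart_apply, show f [0] = 0 from hf 1]
    simp only [Series.add_apply, lie_apply_replicate, Series.smul_apply]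
    have : letter 1 (List.replicate k 0) = 0 := by
      rcases k with _ | k <;> simp [letter, single, List.replicate_succ]
    rw [this]
    ring

/-- If `[x, a]` is a Lie polynomial then so is `a`, provided `a` has no terms of depth `0`. -/
theorem mem_lieSpan_of_lie_X_mem {n : ℕ} {a : Series} (hn : weightPart n a = a)
    (ha : NoDepthZero a) (h : ⁅X, a⁆ ∈ LieSubalgebra.lieSpan ℚ Series {X, Y}) :
    a ∈ LieSubalgebra.lieSpan ℚ Series {X, Y} := by
  have hle : WeightLE n a := hn ▸ weightLE_weightPart n a
  rcases Nat.eq_zero_or_pos n with rfl | hpos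
  · have : a = 0 := by
      rw [← hn]
      exact weightPart_zero_of_nil ha.apply_nil
    rw [this]
    exact zero_mem _
  obtain ⟨m, hm, e⟩ := act_dynkin_of_mem_lieSpan h
  have hle' : WeightLE (1 + n) ⁅X, a⁆ := (weightLE_letter 0).lie hle
  have e1 : act dynkin m ⁅X, a⁆ = dynkin 0 * act dynkin n a - act dynkin n a * dynkin 0 := by
    rw [← act_of_le dynkin (le_max_left m (1 + n)) hm, act_of_le dynkin (le_max_right m (1 + n)) hle',
      ← letter_zero, Ring.lie_def, act_sub, act_mul _ (weightLE_letter 0) hle, add_comm 1 n,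
      act_mul _ hle (weightLE_letter 0), act_letter]
  have hW : der letter ⁅X, a⁆ = ((n : ℚ) + 1) • ⁅X, a⁆ := by
    rw [der_letter_of_homogeneous (n := n + 1)]
    · push_cast
      rfl
    · rw [← letter_zero, weightPart_succ_lie_letter, hn]
  rw [e1] at e
  simp only [LinearMap.sub_apply, Module.End.mul_apply] at e
  -- The operator of [x, a] is known in two ways: as that of a Lie polynomial, and as the commutator
  -- of the operators of x and a. Let α and θ be the first coordinates of a acting on (x, 0) and (0,
  -- 1). The two evaluations give [x, α] = [[x, a], x] and [x, θ] - α = (n + 1)[x, a].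
  have eX := congrArg Prod.fst (e (X, 0))
  have e0 := congrArg Prod.fst (e (0, 1))
  have hd1 : dynkin 0 (X, 0) = 0 := by
    rw [dynkin_apply, letter_zero]
    simp
  have hd2 : dynkin 0 (0, 1) = (X, 0) := by
    rw [dynkin_apply, letter_zero]
    simp
  rw [hd1, map_zero, sub_zero, dynkin_apply, act_dynkin_snd] at eX
  rw [hd2, dynkin_apply, act_dynkin_snd, ha.apply_nil, hW] at e0
  simp only [mul_zero, zero_mul, zero_smul, add_zero, letter_zero, Prod.fst_sub, lie_zero, zero_add,
    one_smul] at eX e0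
  -- The first relation reads [x, α - [a, x]] = 0, so α = [a, x]. The second then becomes [x, θ] = n
  -- [x, a], hence θ = n a, and θ is a Lie polynomial.
  have hα : (act dynkin n a (X, 0)).1 = ⁅a, X⁆ := by
    rw [← sub_eq_zero]
    refine eq_zero_of_lie_X_eq_zero (fun k => ?_) ?_
    · rw [sub_apply, noDepthZero_act_dynkin ha _ k, noDepthZero_lie a X k, sub_zero]
    · rw [lie_sub, eX, lie_lie, lie_self, lie_zero, sub_zero, sub_self]
  have hθ : (act dynkin n a (0, 1)).1 = (n : ℚ) • a := by
    rw [← sub_eq_zero]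
    refine eq_zero_of_lie_X_eq_zero (fun k => ?_) ?_
    · rw [sub_apply, noDepthZero_act_dynkin ha _ k, smul_apply, ha k, mul_zero, sub_zero]
    · rw [hα, ← lie_skew a X, sub_neg_eq_add, add_smul, one_smul] at e0
      rw [lie_sub, lie_smul, add_right_cancel e0, sub_self]
  have hn0 : (n : ℚ) ≠ 0 := by positivity
  have : a = (n : ℚ)⁻¹ • (act dynkin n a (0, 1)).1 := by
    rw [hθ, smul_smul, inv_mul_cancel₀ hn0, one_smul]
  rw [this]
  exact LieSubalgebra.smul_mem _ _ (act_dynkin_fst_mem n a (0, 1) (zero_mem _))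

theorem mem_lie2_of_lie_X_mem {a : Series} (ha : NoDepthZero a) (h : ⁅X, a⁆ ∈ lie2) :
    a ∈ lie2 := by
  intro n
  refine mem_lieSpan_of_lie_X_mem (n := n) ?_ (fun k => ?_) ?_
  · rw [weightPart_weightPart, if_pos rfl]
  · rw [weightPart_apply, ha k, ite_self]
  · rw [← letter_zero, ← weightPart_succ_lie_letter]
    exact h (n + 1)

/-! ### Push-invariance -/

theorem one_notMem_replicate (k : ℕ) : (1 : Fin 2) ∉ List.replicate k (0 : Fin 2) := by
  simp [List.mem_replicate]

theorem unpushWord_replicate (k : ℕ) : unpushWord (List.replicate k 0) = List.replicate k 0 := by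
  rw [unpushWord, List.splitOn_eq_singleton (one_notMem_replicate k)]
  simp

theorem unpushWord_append (i : ℕ) (N : Word) :
    unpushWord (List.replicate i 0 ++ 1 :: N) = N ++ 1 :: List.replicate i 0 := by
  rw [unpushWord, List.splitOn_append_cons_self_of_not_mem (one_notMem_replicate i),
    List.rotate_cons_succ, List.rotate_zero,
    ← List.splitOn_eq_singleton (one_notMem_replicate i), ← List.splitOn_append_cons_self,
    List.intercalate_splitOn]

theorem push_eq_self_iff {b : Series} :
    push b = b ↔ ∀ i N, b (N ++ 1 :: List.replicate i 0) = b (List.replicate i 0 ++ 1 :: N) := by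
  constructor
  · intro h i N
    have := congrArg (fun g : Series => g (List.replicate i 0 ++ 1 :: N)) h
    rw [← unpushWord_append]
    exact this
  · intro h
    ext w
    change b (unpushWord w) = b w
    rcases word_eq_replicate_or_left w with ⟨k, rfl⟩ | ⟨i, N, rfl⟩
    · rw [unpushWord_replicate]
    · rw [unpushWord_append, h]

/-- If `[x, a] = [y, b]` then `b` is push-invariant. -/
theorem push_eq_self_of_lie_eq {a b : Series} (h : ⁅X, a⁆ = ⁅Y, b⁆) : push b = b := by
  rw [push_eq_self_iff]
  intro i M
  -- Sum the coefficients of the equation over the words x^k y M y x^(i-k), 0 ≤ k ≤ i. The two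
  -- halves of the commutator with x cancel after a shift of k, while the commutator with y
  -- contributes only at k = 0 and k = i, giving the two coefficients to be compared.
  let U : ℕ → ℕ → Word := fun k l => List.replicate k 0 ++ 1 :: (M ++ 1 :: List.replicate l 0)
  have hU : ∀ k l, U k (l + 1) = U k l ++ [0] := fun k l => by
    simp [U, List.replicate_succ']
  have hU0 : ∀ k, U k 0 = (List.replicate k 0 ++ 1 :: M) ++ [1] := fun k => by simp [U]
  have hV : ∀ k l, U (k + 1) l = 0 :: U k l := fun k l => by simp [U, List.replicate_succ]
  have hV0 : ∀ l, U 0 l = 1 :: (M ++ 1 :: List.replicate l 0) := fun l => by simp [U]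
  have hs : ∑ k ∈ range (i + 1), ⁅X, a⁆ (U k (i - k)) = ∑ k ∈ range (i + 1), ⁅Y, b⁆ (U k (i - k)) := by
    rw [h]
  simp only [Ring.lie_def, sub_apply, sum_sub_distrib, ← letter_zero, ← letter_one] at hs
  have h1 : ∑ k ∈ range (i + 1), (letter 0 * a) (U k (i - k)) =
      ∑ k ∈ range i, a (U k (i - (k + 1))) := by
    rw [sum_range_succ', hV0, letter_mul_cons, if_neg (by decide), add_zero]
    refine sum_congr rfl fun k _ => ?_
    rw [hV, letter_mul_cons, if_pos rfl]
  have h2 : ∑ k ∈ range (i + 1), (a * letter 0) (U k (i - k)) =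
      ∑ k ∈ range i, a (U k (i - (k + 1))) := by
    rw [sum_range_succ, Nat.sub_self, hU0, mul_letter_concat, if_neg (by decide), add_zero]
    refine sum_congr rfl fun k hk => ?_
    have hk := mem_range.1 hk
    rw [show i - k = i - (k + 1) + 1 by omega, hU, mul_letter_concat, if_pos rfl]
  have h3 : ∑ k ∈ range (i + 1), (letter 1 * b) (U k (i - k)) = b (M ++ 1 :: List.replicate i 0) := by
    rw [sum_range_succ', hV0, letter_mul_cons, if_pos rfl, sum_eq_zero, zero_add, Nat.sub_zero]
    intro k _
    rw [hV, letter_mul_cons, if_neg (by decide)]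
  have h4 : ∑ k ∈ range (i + 1), (b * letter 1) (U k (i - k)) = b (List.replicate i 0 ++ 1 :: M) := by
    rw [sum_range_succ, Nat.sub_self, hU0, mul_letter_concat, if_pos rfl, sum_eq_zero, zero_add]
    intro k hk
    have hk := mem_range.1 hk
    rw [show i - k = i - (k + 1) + 1 by omega, hU, mul_letter_concat, if_neg (by decide)]
  rw [h1, h2, h3, h4, sub_self] at hs
  linarith

/-- The series with coefficient `-b (N x^(i+j+1))` at `x^j y N`. -/
def conjugateCoeff (b : Series) (i : ℕ) : Word → ℚ
  | [] => 0
  | c :: N => if c = 0 then conjugateCoeff b (i + 1) N else -b (N ++ List.replicate (i + 1) 0)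

theorem conjugateCoeff_replicate (b : Series) (i k : ℕ) :
    conjugateCoeff b i (List.replicate k 0) = 0 := by
  induction k generalizing i with
  | zero => rfl
  | succ k ih => rw [List.replicate_succ, conjugateCoeff, if_pos rfl, ih]

theorem conjugateCoeff_append (b : Series) (i j : ℕ) (N : Word) :
    conjugateCoeff b i (List.replicate j 0 ++ 1 :: N) = -b (N ++ List.replicate (i + j + 1) 0) := by
  induction j generalizing i with
  | zero => rfl
  | succ j ih =>
    rw [List.replicate_succ, List.cons_append, conjugateCoeff, if_pos rfl, ih,
      show i + 1 + j + 1 = i + (j + 1) + 1 by omega]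

/-- A push-invariant `b` admits an `a` with `[x, a] = [y, b]`. -/
theorem exists_lie_eq_of_push_eq_self {b : Series} (hb : NoDepthZero b) (h : push b = b) :
    ∃ a, NoDepthZero a ∧ ⁅X, a⁆ = ⁅Y, b⁆ := by
  rw [push_eq_self_iff] at h
  -- The values are forced by words ending in x: the equation gives a(x^j y N) = a(y N x^j) = -b(N
  -- x^(j+1)). Words ending in y then impose exactly the push-invariance of b.
  refine ⟨fun w => conjugateCoeff b 0 w, conjugateCoeff_replicate b 0, ?_⟩
  set a : Series := fun w => conjugateCoeff b 0 w with ha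
  have ha' : ∀ j N, a (List.replicate j 0 ++ 1 :: N) = -b (N ++ List.replicate (j + 1) 0) := by
    intro j N
    have := conjugateCoeff_append b 0 j N
    rwa [zero_add] at this
  ext w
  rcases word_eq_replicate_or_left w with ⟨k, rfl⟩ | ⟨i, N, rfl⟩
  · rw [lie_apply_replicate, lie_apply_replicate]
  · simp only [Ring.lie_def, sub_apply, ← letter_zero, ← letter_one]
    have h1 : (letter 0 * a) (List.replicate i 0 ++ 1 :: N) =
        if i = 0 then 0 else -b (N ++ List.replicate i 0) := by
      cases i with
      | zero => rw [List.replicate_zero, List.nil_append, letter_mul_cons]; rfl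
      | succ i =>
        rw [List.replicate_succ, List.cons_append, letter_mul_cons, if_pos rfl, ha',
          if_neg (Nat.succ_ne_zero i), List.replicate_succ]
    have h2 : (letter 1 * b) (List.replicate i 0 ++ 1 :: N) = if i = 0 then b N else 0 := by
      cases i with
      | zero => rw [List.replicate_zero, List.nil_append, letter_mul_cons]; rfl
      | succ i =>
        rw [List.replicate_succ, List.cons_append, letter_mul_cons, if_neg (by decide),
          if_neg (Nat.succ_ne_zero i)]
    rw [h1, h2]
    rcases List.eq_nil_or_concat' N with rfl | ⟨N, e, rfl⟩
    · rw [mul_letter_concat, mul_letter_concat, if_neg (by decide : ¬(1 : Fin 2) = 0),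
        if_pos (rfl : (1 : Fin 2) = 1), hb i,
        List.nil_append, hb i, hb.apply_nil]
      simp
    · rw [← List.cons_append, ← List.append_assoc, mul_letter_concat, mul_letter_concat, ha']
      have hi : N ++ [0] ++ List.replicate i 0 = N ++ List.replicate (i + 1) 0 := by
        simp [List.replicate_succ]
      have hi' : N ++ [1] ++ List.replicate i 0 = N ++ 1 :: List.replicate i 0 := by simp
      by_cases he : e = 0
      · subst he
        rw [if_pos (rfl : (0 : Fin 2) = 0), if_neg (by decide : ¬(0 : Fin 2) = 1), hi]
        split_ifs with h0
        · subst h0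
          simp
        · simp
      · have he : e = 1 := by omega
        subst he
        rw [if_neg (by decide : ¬(1 : Fin 2) = 0), if_pos (rfl : (1 : Fin 2) = 1), hi', ← h]
        split_ifs with h0
        · subst h0
          simp
        · simp


/-! ### Words and their exponents -/

/-- The word `x^a₀ y x^a₁ y ⋯ y x^aᵣ`. -/
def wordOf (l : List ℕ) : Word := List.intercalate [1] (l.map fun m => List.replicate m 0)

theorem wordOf_singleton (m : ℕ) : wordOf [m] = List.replicate m 0 := by simp [wordOf]

theorem wordOf_cons (m : ℕ) {l : List ℕ} (h : l ≠ []) :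
    wordOf (m :: l) = List.replicate m 0 ++ 1 :: wordOf l := by
  rw [wordOf, List.map_cons, List.intercalate_cons_of_ne_nil (by simpa using h), wordOf]
  simp

theorem wordOf_concat (m : ℕ) {l : List ℕ} (h : l ≠ []) :
    wordOf (l ++ [m]) = wordOf l ++ 1 :: List.replicate m 0 := by
  induction l with
  | nil => exact absurd rfl h
  | cons a l ih =>
    rcases eq_or_ne l [] with rfl | hl
    · rw [List.singleton_append, wordOf_cons _ (by simp), wordOf_singleton, wordOf_singleton]
    · rw [List.cons_append, wordOf_cons _ (by simp), ih hl, wordOf_cons _ hl, List.append_assoc,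
        List.cons_append]

theorem count_wordOf (l : List ℕ) : (wordOf l).count 1 = l.length - 1 := by
  induction l with
  | nil => rfl
  | cons a l ih =>
    rcases eq_or_ne l [] with rfl | hl
    · rw [wordOf_singleton, List.count_replicate]
      simp
    · have : 0 < l.length := List.length_pos_iff.2 hl
      rw [wordOf_cons _ hl, List.count_append, List.count_cons_self, ih, List.count_replicate]
      simp only [List.length_cons]
      simp
      omega

theorem length_wordOf (l : List ℕ) : (wordOf l).length = l.sum + (l.length - 1) := by
  induction l with
  | nil => rfl
  | cons a l ih =>
    rcases eq_or_ne l [] with rfl | hl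
    · rw [wordOf_singleton]
      simp
    · have : 0 < l.length := List.length_pos_iff.2 hl
      rw [wordOf_cons _ hl, List.length_append, List.length_cons, ih]
      simp only [List.length_cons, List.length_replicate, List.sum_cons]
      omega

theorem exists_wordOf (w : Word) : ∃ l, l ≠ [] ∧ w = wordOf l := by
  induction w with
  | nil => exact ⟨[0], by simp, by rw [wordOf_singleton]; rfl⟩
  | cons c w ih =>
    obtain ⟨l, hl, rfl⟩ := ih
    fin_cases c
    · cases l with
      | nil => exact absurd rfl hl
      | cons m t =>
        refine ⟨(m + 1) :: t, by simp, ?_⟩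
        rcases eq_or_ne t [] with rfl | ht
        · rw [wordOf_singleton, wordOf_singleton]
          rfl
        · rw [wordOf_cons _ ht, wordOf_cons _ ht]
          rfl
    · exact ⟨0 :: l, by simp, by rw [wordOf_cons _ hl]; rfl⟩

theorem wordOf_injective {l l' : List ℕ} (h : l ≠ []) (h' : l' ≠ []) (e : wordOf l = wordOf l') :
    l = l' := by
  have key : ∀ l : List ℕ, l ≠ [] → (wordOf l).splitOn 1 = l.map fun m => List.replicate m 0 := by
    intro l hl
    refine List.splitOn_intercalate 1 ?_ (by simpa using hl)
    intro u hu
    obtain ⟨m, _, rfl⟩ := List.mem_map.1 hu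
    exact one_notMem_replicate m
  have e' := congrArg (fun w : Word => (w.splitOn 1).map List.length) e
  simpa [key l h, key l' h', Function.comp_def] using e'

theorem unpushWord_wordOf {l : List ℕ} (h : l ≠ []) : unpushWord (wordOf l) = wordOf (l.rotate 1) := by
  cases l with
  | nil => exact absurd rfl h
  | cons m t =>
    rcases eq_or_ne t [] with rfl | ht
    · rw [wordOf_singleton, unpushWord_replicate, List.rotate_singleton, wordOf_singleton]
    · rw [wordOf_cons _ ht, unpushWord_append, List.rotate_cons_succ, List.rotate_zero,
        wordOf_concat _ ht]

theorem unpushWord_iterate_wordOf {l : List ℕ} (h : l ≠ []) (i : ℕ) :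
    unpushWord^[i] (wordOf l) = wordOf (l.rotate i) := by
  induction i with
  | zero => rw [List.rotate_zero]; rfl
  | succ i ih =>
    rw [Function.iterate_succ_apply', ih, unpushWord_wordOf (by simpa [List.rotate_eq_nil_iff] using h),
      List.rotate_rotate]

theorem push_eq_self_iff_wordOf {b : Series} :
    push b = b ↔ ∀ l, l ≠ [] → b (wordOf (l.rotate 1)) = b (wordOf l) := by
  constructor
  · intro h l hl
    rw [← unpushWord_wordOf hl]
    exact congrArg (fun g : Series => g (wordOf l)) h
  · intro h
    ext w
    obtain ⟨l, hl, rfl⟩ := exists_wordOf w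
    change b (unpushWord (wordOf l)) = _
    rw [unpushWord_wordOf hl, h l hl]

theorem push_pow_apply (i : ℕ) (f : Series) (w : Word) :
    (push ^ i) f w = f (unpushWord^[i] w) := by
  induction i generalizing w with
  | zero => rfl
  | succ i ih =>
    rw [pow_succ', Module.End.mul_apply, Function.iterate_succ_apply, ← ih]
    rfl

/-- A word of depth r has r + 1 exponents and push rotates them, so r ≥ 1 becomes length at least 2.
-/
theorem pushNeutral_iff {h : Series} :
    PushNeutral h ↔ ∀ l : List ℕ, 2 ≤ l.length →
      ∑ j ∈ range l.length, h (wordOf (l.rotate j)) = 0 := by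
  have key : ∀ (r : ℕ) (l : List ℕ), l ≠ [] →
      (∑ i ∈ range (r + 1), (push ^ i) (depthPart r h)) (wordOf l) =
        if l.length = r + 1 then ∑ j ∈ range l.length, h (wordOf (l.rotate j)) else 0 := by
    intro r l hl
    have hpos := List.length_pos_iff.2 hl
    rw [sum_apply']
    simp only [push_pow_apply, unpushWord_iterate_wordOf hl, depthPart_apply, count_wordOf,
      List.length_rotate]
    split_ifs with h1 h2 h2
    · rw [h2]
    · omega
    · omega
    · simp
  constructor
  · intro hn l hl
    have hl0 : l ≠ [] := by rintro rfl; simp at hl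
    have h1 := key (l.length - 1) l hl0
    rw [hn (l.length - 1) (by omega), if_pos (by omega)] at h1
    exact h1.symm
  · intro hn r hr
    ext w
    obtain ⟨l, hl, rfl⟩ := exists_wordOf w
    rw [key r l hl]
    split_ifs with h1
    · exact hn l (by omega)
    · rfl

/-! ### Cyclic words -/

/-- The cyclic symmetrization of a series, which represents its class modulo commutators. -/
def cyc : Series →ₗ[ℚ] Series where
  toFun f w := ∑ i ∈ range w.length, f (w.rotate i)
  map_add' f g := by
    ext w
    exact sum_add_distrib
  map_smul' a f := by
    ext w
    exact (mul_sum _ _ _).symm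

theorem cyc_apply (f : Series) (w : Word) : cyc f w = ∑ i ∈ range w.length, f (w.rotate i) := rfl

theorem sum_range_shift (h : ℕ → ℚ) (n : ℕ) (hp : ∀ i, h (i + n) = h i) (j : ℕ) :
    ∑ i ∈ range n, h (i + j) = ∑ i ∈ range n, h i := by
  induction j with
  | zero => rfl
  | succ j ih =>
    rw [← ih]
    have h1 := sum_range_succ (fun i => h (i + j)) n
    rw [sum_range_succ', add_comm n j, hp, zero_add, add_right_cancel_iff] at h1
    rw [← h1]
    exact sum_congr rfl fun i _ => by rw [add_assoc, add_comm 1 j]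

theorem cyc_rotate (f : Series) (w : Word) (j : ℕ) : cyc f (w.rotate j) = cyc f w := by
  rw [cyc_apply, cyc_apply, List.length_rotate]
  rw [← sum_range_shift (fun i => f (w.rotate i)) w.length (fun i => ?_) j]
  · exact sum_congr rfl fun i _ => by rw [List.rotate_rotate, add_comm]
  · rw [add_comm, ← List.rotate_rotate, List.rotate_length]

/-- Both sides sum over a rotation of w and a cut of it into two factors; rotating by the length of
the first factor exchanges the factors. -/
theorem cyc_mul_comm (f g : Series) : cyc (f * g) = cyc (g * f) := by
  ext w
  simp only [cyc_apply, mul_apply, List.length_rotate]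
  rw [sum_comm, sum_comm (s := range w.length), ← sum_range_reflect]
  refine sum_congr rfl fun j hj => ?_
  have hj := mem_range.1 hj
  rw [← sum_range_shift (fun i => f ((w.rotate i).take _) * g ((w.rotate i).drop _)) w.length
    (fun i => ?_) j]
  · refine sum_congr rfl fun i _ => ?_
    have hr : w.rotate (i + j) = (w.rotate i).drop j ++ (w.rotate i).take j := by
      rw [← List.rotate_rotate, List.rotate_eq_drop_append_take (by rw [List.length_rotate]; omega)]
    have hl : ((w.rotate i).drop j).length = w.length + 1 - 1 - j := by
      rw [List.length_drop, List.length_rotate]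
      omega
    rw [hr, ← hl, List.take_left, List.drop_left, mul_comm]
  · rw [add_comm i, ← List.rotate_rotate, List.rotate_length]

theorem cyc_lie (f g : Series) : cyc ⁅f, g⁆ = 0 := by
  rw [Ring.lie_def, map_sub, cyc_mul_comm, sub_self]

theorem cyc_mem_fil (n : ℕ) (f : Series) (hf : f ∈ fil n) : cyc f ∈ fil n := fun w hw => by
  rw [cyc_apply]
  exact sum_eq_zero fun i _ => hf _ (by rwa [List.length_rotate])

/-- The operator rotating all words `i` times. -/
def rot (i : ℕ) : Series →ₗ[ℚ] Series where
  toFun f w := f (w.rotate i)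
  map_add' _ _ := rfl
  map_smul' _ _ := rfl

theorem rot_apply (i : ℕ) (f : Series) (w : Word) : rot i f w = f (w.rotate i) := rfl

/-- Splitting off last letters gives f = f(∅) + Σ g_c c, and rotating gives f(∅) + Σ c g_c. A word
and its rotation thus differ by commutators, which a derivation maps to commutators. -/
theorem sub_rot_one (f : Series) :
    ∃ g : Fin 2 → Series, f - rot 1 f = ∑ c, ⁅g c, letter c⁆ := by
  let g : Fin 2 → Series := fun c w => f (w ++ [c])
  have hg : ∀ c w, g c w = f (w ++ [c]) := fun _ _ => rfl
  refine ⟨g, ?_⟩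
  have h1 : f = f [] • (1 : Series) + ∑ c, g c * letter c := by
    ext w
    rw [Series.add_apply, sum_apply', Fin.sum_univ_two]
    rcases List.eq_nil_or_concat' w with rfl | ⟨w, e, rfl⟩
    · simp [mul_letter_nil, one_apply]
    · rw [mul_letter_concat, mul_letter_concat]
      fin_cases e <;> simp [one_apply, hg]
  have h2 : rot 1 f = f [] • (1 : Series) + ∑ c, letter c * g c := by
    ext w
    rw [Series.add_apply, sum_apply', Fin.sum_univ_two, rot_apply]
    cases w with
    | nil => simp [letter_mul_nil, one_apply]
    | cons e w =>
      rw [letter_mul_cons, letter_mul_cons, List.rotate_cons_succ, List.rotate_zero]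
      fin_cases e <;> simp [one_apply, hg]
  rw [h2]
  nth_rewrite 1 [h1]
  rw [add_sub_add_left_eq_sub, ← sum_sub_distrib]
  rfl

theorem cyc_der_rot (d : Fin 2 → Series) (i : ℕ) (f : Series) :
    cyc (der d (rot i f)) = cyc (der d f) := by
  induction i with
  | zero =>
    have : rot 0 f = f := by
      ext w
      rw [rot_apply, List.rotate_zero]
    rw [this]
  | succ i ih =>
    have e : rot (i + 1) f = rot 1 (rot i f) := by
      ext w
      rw [rot_apply, rot_apply, rot_apply, List.rotate_rotate, add_comm]
    obtain ⟨g, hg⟩ := sub_rot_one (rot i f)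
    rw [e, ← ih, eq_comm, ← sub_eq_zero, ← map_sub, ← map_sub, hg, map_sum, map_sum]
    refine sum_eq_zero fun c _ => ?_
    rw [der_lie, map_add, cyc_lie, cyc_lie, add_zero]

/-- Derivations act on cyclic words. In weight n, `cyc p` is the sum of the n rotations of p, and
the derivatives of all of these have the same cyclic class, so n times the class wanted is 0;
characteristic 0 finishes. -/
theorem cyc_der_eq_zero {d : Fin 2 → Series} (hd : ∀ c, d c [] = 0) {f : Series}
    (hf : cyc f = 0) : cyc (der d f) = 0 := by
  refine eq_of_weightPart (T := cyc ∘ₗ der d) (T' := 0)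
    (fun n f hf => cyc_mem_fil n _ (der_mem_fil hd n f hf)) (fun n _ _ => zero_mem _) fun n => ?_
  change cyc (der d (weightPart n f)) = 0
  set p := weightPart n f with hp
  have h0 : cyc p = 0 := by
    ext w
    have := congrArg (fun g : Series => g w) hf
    simp only [cyc_apply, hp, weightPart_apply, List.length_rotate, zero_apply] at this ⊢
    split_ifs
    · exact this
    · simp
  have hsum : cyc p = ∑ i ∈ range n, rot i p := by
    ext w
    rw [sum_apply']
    simp only [cyc_apply, rot_apply, hp, weightPart_apply, List.length_rotate]
    split_ifs with h
    · rw [h]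
    · simp
  have h1 : (n : ℚ) • cyc (der d p) = 0 := by
    have e : cyc (der d (cyc p)) = ∑ i ∈ range n, cyc (der d (rot i p)) := by
      rw [hsum, map_sum, map_sum]
    rw [h0, map_zero, map_zero, sum_congr rfl fun i _ => cyc_der_rot d i p, sum_const, card_range,
      ← Nat.cast_smul_eq_nsmul ℚ] at e
    exact e.symm
  rcases Nat.eq_zero_or_pos n with rfl | hn
  · have : p = p [] • (1 : Series) := by
      ext w
      cases w with
      | nil => simp [one_apply]
      | cons c w => simp [hp, weightPart_apply, one_apply]
    rw [this, map_smul, der_one, smul_zero, map_zero]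
  · have hn' : (n : ℚ) ≠ 0 := by positivity
    exact (smul_eq_zero.1 h1).resolve_left hn'

/-! ### Circ-neutrality through cyclic words -/

theorem cons_wordOf_rotate (m : ℕ) (t : List ℕ) :
    ((1 : Fin 2) :: wordOf (m :: t)).rotate (m + 1) = 1 :: wordOf ((m :: t).rotate 1) := by
  rcases eq_or_ne t [] with rfl | ht
  · rw [List.rotate_singleton, wordOf_singleton]
    have : ((1 : Fin 2) :: List.replicate m 0).length = m + 1 := by simp
    rw [← this, List.rotate_length]
  · rw [wordOf_cons _ ht, List.rotate_cons_succ (l := t), List.rotate_zero, wordOf_concat _ ht,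
      ← List.cons_append]
    have : ((1 : Fin 2) :: List.replicate m 0).length = m + 1 := by simp
    rw [← this, List.rotate_append_length_eq]
    rfl

/-- Rotating y x^m ⋯ by 1, …, m letters brings an x to the front, so only the unrotated word
contributes. -/
theorem sum_first_block (h : Series) (m : ℕ) (t : List ℕ) :
    ∑ i ∈ range (m + 1), (Y * h) (((1 : Fin 2) :: wordOf (m :: t)).rotate i) =
      h (wordOf (m :: t)) := by
  rw [sum_range_succ', List.rotate_zero, ← letter_one, letter_mul_cons, if_pos rfl, sum_eq_zero,
    zero_add]
  intro i hi
  have hi := mem_range.1 hi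
  obtain ⟨R, hR⟩ : ∃ R : Word, wordOf (m :: t) = List.replicate m 0 ++ R := by
    rcases eq_or_ne t [] with rfl | ht
    · exact ⟨[], by rw [wordOf_singleton, List.append_nil]⟩
    · exact ⟨_, wordOf_cons _ ht⟩
  rw [hR, List.rotate_eq_drop_append_take (by simp; omega), List.drop_succ_cons,
    List.drop_append_of_le_length (by simp; omega), List.drop_replicate,
    show m - i = (m - i - 1) + 1 by omega, List.replicate_succ, List.cons_append, List.cons_append,
    letter_mul_cons, if_neg (by decide)]

/-- Rotations are grouped by blocks y x^aⱼ, of length aⱼ + 1. Each block contributes one term, at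
its initial y, and passing to the next block rotates the list of exponents. -/
theorem sum_blocks (h : Series) (k : ℕ) (l : List ℕ) (hl : l ≠ []) :
    ∑ i ∈ range (∑ j ∈ range k, ((l.rotate j).headI + 1)), (Y * h) (((1 : Fin 2) :: wordOf l).rotate i) =
      ∑ j ∈ range k, h (wordOf (l.rotate j)) := by
  induction k generalizing l with
  | zero => simp
  | succ k ih =>
    have ih' := ih (l.rotate 1) (by simpa [List.rotate_eq_nil_iff] using hl)
    simp only [List.rotate_rotate] at ih'
    rw [sum_range_succ', sum_range_succ' (fun j => h (wordOf (l.rotate j))), List.rotate_zero]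
    simp only [add_comm 1] at ih'
    rw [← ih', add_comm, sum_range_add, add_comm]
    cases l with
    | nil => exact absurd rfl hl
    | cons m t =>
      congr 1
      · refine sum_congr rfl fun i _ => ?_
        rw [← cons_wordOf_rotate, List.rotate_rotate]
        rfl
      · exact sum_first_block h m t

theorem sum_headI_rotate (l : List ℕ) :
    ∑ j ∈ range l.length, ((l.rotate j).headI + 1) = l.sum + l.length := by
  rw [sum_add_distrib, sum_const, card_range, smul_eq_mul, mul_one]
  congr 1
  rw [← Fin.sum_univ_eq_sum_range (fun j => (l.rotate j).headI)]
  conv_rhs => rw [← List.ofFn_getElem (xs := l), List.sum_ofFn]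
  refine sum_congr rfl fun j _ => ?_
  have hj : (j : ℕ) < l.length := j.2
  have hne : 0 < (l.rotate j).length := by rw [List.length_rotate]; omega
  have h1 : ∀ (u : List ℕ) (hu : 0 < u.length), u.headI = u[0] := by
    rintro (_ | ⟨a, t⟩) hu
    · simp at hu
    · rfl
  rw [h1 _ hne, List.getElem_rotate]
  simp [Nat.mod_eq_of_lt hj]

theorem cyc_letter_mul_wordOf (h : Series) (l : List ℕ) (hl : l ≠ []) :
    cyc (Y * h) (1 :: wordOf l) = ∑ j ∈ range l.length, h (wordOf (l.rotate j)) := by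
  rw [← sum_blocks h l.length l hl, sum_headI_rotate, cyc_apply, List.length_cons, length_wordOf]
  have := List.length_pos_iff.2 hl
  rw [show l.sum + (l.length - 1) + 1 = l.sum + l.length by omega]

/-- Every word containing y has a rotation starting with y. The rotations of y w which start with y
correspond to the rotations of the exponents of w, so the push-sum of b^y at w is the cyclic sum of
y b^y at y w. The extra y turns depth at least 1 into depth at least 2. -/
theorem circNeutral_iff {b : Series} :
    CircNeutral b ↔ ∀ w : Word, 2 ≤ w.count 1 → cyc (Y * tailPart 1 b) w = 0 := by
  rw [CircNeutral, pushNeutral_iff]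
  constructor
  · intro h w hw
    have h1 : (1 : Fin 2) ∈ w := List.count_pos_iff.1 (by omega)
    obtain ⟨M, N, rfl⟩ := List.append_of_mem h1
    obtain ⟨l, hl, e⟩ := exists_wordOf (N ++ M)
    have h2 : (M ++ 1 :: N).rotate M.length = 1 :: wordOf l := by
      rw [List.rotate_append_length_eq, List.cons_append, e]
    rw [← cyc_rotate _ _ M.length, h2, cyc_letter_mul_wordOf _ _ hl]
    refine h l ?_
    have h3 := count_wordOf l
    rw [← e, List.count_append] at h3
    rw [List.count_append, List.count_cons_self] at hw
    omega
  · intro h l hl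
    have hl0 : l ≠ [] := by rintro rfl; simp at hl
    rw [← cyc_letter_mul_wordOf _ _ hl0]
    refine h _ ?_
    rw [List.count_cons_self, count_wordOf]
    omega


/-! ### Elliptic derivations -/

theorem lie_derValues_of_mem_oder2 {D : LieDerivation ℚ lie2 lie2} (hD : D ∈ oder2) :
    ⁅X, (D yLie : Series)⁆ = ⁅Y, (D xLie : Series)⁆ := by
  have h := coe_lieDerivation_lie D xLie yLie
  rw [hD.1] at h
  exact sub_eq_zero.1 h.symm

/-- A Lie series `b` without terms of depth `0` is the value at `x` of a unique derivation in
`oder₂` as soon as it is push-invariant. -/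
theorem existsUnique_oder2 {b : Series} (hb : b ∈ lie2) (h0 : NoDepthZero b) (hp : push b = b) :
    ∃! D : LieDerivation ℚ lie2 lie2, D ∈ oder2 ∧ (D xLie : Series) = b := by
  obtain ⟨a, ha0, ha⟩ := exists_lie_eq_of_push_eq_self h0 hp
  have ha2 : a ∈ lie2 := mem_lie2_of_lie_X_mem ha0 (ha ▸ lie2.lie_mem Y_mem_lie2 hb)
  have hd : ∀ c, (![b, a] : Fin 2 → Series) c ∈ lie2 := by
    intro c
    fin_cases c
    · exact hb
    · exact ha2
  have hx : (lie2Der _ hd xLie : Series) = b := der_letter ![b, a] 0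
  have hy : (lie2Der _ hd yLie : Series) = a := der_letter ![b, a] 1
  refine ⟨lie2Der _ hd, ⟨⟨?_, ?_, ?_⟩, hx⟩, ?_⟩
  · refine Subtype.ext ?_
    rw [coe_lieDerivation_lie, hx, hy]
    exact sub_eq_zero.2 ha
  · rw [hx]
    exact h0 1
  · rw [hy]
    exact ha0 1
  · rintro D ⟨hD, hDx⟩
    -- [x, D y] is prescribed, so D y is determined up to a series in x alone; in a Lie series this
    -- could only be a multiple of x, excluded by the definition of `oder2`.
    have hDy : (D yLie : Series) = a := by
      rw [← sub_eq_zero]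
      refine eq_zero_of_lie_X_eq_zero (fun k => ?_) ?_
      · rw [sub_apply, ha0 k, noDepthZero_of_mem_lie2 (D yLie).2 hD.2.2 k, sub_zero]
      · rw [lie_sub, lie_derValues_of_mem_oder2 hD, hDx, ha, sub_self]
    ext f : 1
    refine Subtype.ext ?_
    rw [lieDerivation_apply, coe_lie2Der, derValues, hDx, hDy]

theorem apply_singleton_of_mem_oder2 {D : LieDerivation ℚ lie2 lie2} (hD : D ∈ oder2) (f : lie2) :
    (D f : Series) [0] = 0 := by
  rw [lieDerivation_apply, der_apply_singleton _ (derValues_nil D), Fin.sum_univ_two]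
  change (D xLie : Series) [0] * _ + (D yLie : Series) [0] * _ = 0
  rw [hD.2.1, hD.2.2]
  ring

theorem lie_mem_oder2 {D D' : LieDerivation ℚ lie2 lie2} (hD : D ∈ oder2) (hD' : D' ∈ oder2) :
    ⁅D, D'⁆ ∈ oder2 := by
  have hl : ∀ f, (⁅D, D'⁆ f : Series) [0] = 0 := by
    intro f
    rw [LieDerivation.commutator_apply]
    change (D (D' f) : Series) [0] - (D' (D f) : Series) [0] = 0
    rw [apply_singleton_of_mem_oder2 hD, apply_singleton_of_mem_oder2 hD', sub_zero]
  refine ⟨?_, hl _, hl _⟩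
  rw [LieDerivation.commutator_apply, hD.1, hD'.1, map_zero, map_zero, sub_zero]

/-! ### The bracket of `lkv` -/

/-- The values at the letters of the derivation `x ↦ 0`, `y ↦ [b, y]`. -/
noncomputable def iharaValues (b : Series) : Fin 2 → Series := ![0, ⁅b, Y⁆]

theorem iharaValues_nil (b : Series) (c : Fin 2) : iharaValues b c [] = 0 := by
  fin_cases c
  · rfl
  · exact lie_apply_nil b Y

/-- The Lie bracket of `lkv`. -/
noncomputable def iharaBracket (b b' : Series) : Series :=
  der (iharaValues b) b' - der (iharaValues b') b - ⁅b, b'⁆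

theorem der_ihara_X (b : Series) : der (iharaValues b) X = 0 := der_letter (iharaValues b) 0

theorem der_ihara_Y (b : Series) : der (iharaValues b) Y = ⁅b, Y⁆ := der_letter (iharaValues b) 1

theorem lie_eq_of_constant (b : Series) (r : ℚ) : ⁅b, r • (1 : Series)⁆ = 0 := by
  rw [lie_smul, Ring.lie_def, mul_one, one_mul, sub_self, smul_zero]

/-- Being a continuous derivation, ad b is determined by its values on the letters; this puts it on
the same footing as the other derivations, so that `der_substitute` applies. -/
theorem der_lie_letter (b f : Series) :
    der (fun c => ⁅b, letter c⁆) f = ⁅b, f⁆ := by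
  refine eq_of_forall_sub_mem_fil fun n => ?_
  induction n generalizing f with
  | zero => exact mem_fil_zero _
  | succ n ih =>
    have e : ⁅b, f⁆ = ∑ c, (⁅b, letter c⁆ * tailPart c f + letter c * ⁅b, tailPart c f⁆) := by
      nth_rewrite 1 [eq_sum_letter f]
      rw [lie_add, lie_eq_of_constant, zero_add, lie_sum]
      refine sum_congr rfl fun c _ => ?_
      simp only [Ring.lie_def]
      noncomm_ring
    rw [e, der_eq, ← sum_sub_distrib]
    refine sum_mem fun c _ => ?_
    rw [add_sub_add_left_eq_sub]
    exact mul_sub_mem_fil (letter_nil c) (ih _)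

/-- The values at `x`, `y` of the substitution `y ↦ [x, y]`. -/
noncomputable def ellSubst : Fin 2 → Series := ![X, ⁅X, Y⁆]

theorem ellSubst_nil (c : Fin 2) : ellSubst c [] = 0 := by
  fin_cases c
  · exact letter_nil 0
  · exact lie_apply_nil X Y

theorem substitute_ellSubst_X : substitute ellSubst X = X := substitute_letter ellSubst_nil 0

/-- The derivation attached to `[x, b(x, [x, y])]` corresponds under the substitution
`y ↦ [x, y]` to the derivation `x ↦ [x, b]`, `y ↦ 0`. -/
theorem lieDerivation_substitute {D : LieDerivation ℚ lie2 lie2} (hD : D ∈ oder2) {b : Series}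
    (hx : (D xLie : Series) = ⁅X, substitute ellSubst b⁆) (f : Series) :
    der (derValues D) (substitute ellSubst f) =
      substitute ellSubst (der (iharaValues b) f - ⁅b, f⁆) := by
  rw [← der_lie_letter b, ← der_sub_apply]
  refine der_substitute ellSubst_nil (fun c => ?_) f
  fin_cases c
  · change der (derValues D) X = substitute ellSubst (0 - ⁅b, X⁆)
    have h1 : der (derValues D) X = (D xLie : Series) := der_letter (derValues D) 0
    rw [zero_sub, lie_skew, substitute_lie ellSubst_nil, substitute_ellSubst_X, h1, hx]
  · change der (derValues D) ⁅X, Y⁆ = substitute ellSubst (⁅b, Y⁆ - ⁅b, Y⁆)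
    have h0 : substitute ellSubst 0 = 0 := map_zero (substLin ellSubst)
    rw [sub_self, h0]
    have := lieDerivation_apply D ⁅xLie, yLie⁆
    rw [hD.1] at this
    exact this.symm

theorem substitute_sub (g : Fin 2 → Series) (f h : Series) :
    substitute g (f - h) = substitute g f - substitute g h := map_sub (substLin g) f h

/-- The computation takes place before substitution, with E_b - ad b, where E_b is x ↦ 0, y ↦ [b,
y]. This maps [x, b'] to [[x, b], b'] + [x, E_b(b') - [b, b']]. After antisymmetrizing, Jacobi turns
the first terms into [x, [b, b']], which cancels one of the two copies of -[x, [b, b']]. -/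
theorem lie_apply_xLie {D D' : LieDerivation ℚ lie2 lie2} (hD : D ∈ oder2) (hD' : D' ∈ oder2)
    {b b' : Series} (hx : (D xLie : Series) = ⁅X, substitute ellSubst b⁆)
    (hx' : (D' xLie : Series) = ⁅X, substitute ellSubst b'⁆) :
    (⁅D, D'⁆ xLie : Series) = ⁅X, substitute ellSubst (iharaBracket b b')⁆ := by
  have hX : ∀ f, ⁅X, substitute ellSubst f⁆ = substitute ellSubst ⁅X, f⁆ := fun f => by
    rw [substitute_lie ellSubst_nil, substitute_ellSubst_X]
  rw [LieDerivation.commutator_apply]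
  change (D (D' xLie) : Series) - (D' (D xLie) : Series) = _
  rw [lieDerivation_apply D (D' xLie), lieDerivation_apply D' (D xLie), hx, hx', hX, hX, hX,
    lieDerivation_substitute hD hx, lieDerivation_substitute hD' hx', ← substitute_sub]
  congr 1
  rw [der_lie, der_lie, der_ihara_X, der_ihara_X, iharaBracket]
  simp only [Ring.lie_def]
  noncomm_ring

/-- Push-invariance is preserved by the bracket. -/
theorem push_iharaBracket {b b' : Series} (hb : NoDepthZero b) (hb' : NoDepthZero b')
    (hp : push b = b) (hp' : push b' = b') : push (iharaBracket b b') = iharaBracket b b' := by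
  obtain ⟨a, -, ha⟩ := exists_lie_eq_of_push_eq_self hb hp
  obtain ⟨a', -, ha'⟩ := exists_lie_eq_of_push_eq_self hb' hp'
  -- The witness comes from applying E_b to [x, a'] = [y, b'], and symmetrically: E_b kills x, and
  -- the terms [[b, y], b'] - [[b', y], b] combine to -[y, [b, b']].
  refine push_eq_self_of_lie_eq (a := der (iharaValues b) a' - der (iharaValues b') a) ?_
  have h1 := congrArg (der (iharaValues b)) ha'
  have h2 := congrArg (der (iharaValues b')) ha
  rw [der_lie, der_lie, der_ihara_X, der_ihara_Y, zero_lie, zero_add] at h1 h2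
  rw [lie_sub, h1, h2, iharaBracket]
  simp only [Ring.lie_def]
  noncomm_ring

theorem tailPart_der_ihara {b : Series} (hb : b [] = 0) (f : Series) :
    tailPart 1 (der (iharaValues b) f) =
      (tailPart 1 b * Y - b) * tailPart 1 f + der (iharaValues b) (tailPart 1 f) := by
  rw [tailPart_der, Fin.sum_univ_two]
  change tailPart 1 (0 * tailPart 0 f + ⁅b, Y⁆ * tailPart 1 f) + _ = _
  have h1 : tailPart 1 (⁅b, Y⁆ : Series) = tailPart 1 b * Y - b := by
    rw [Ring.lie_def, map_sub, tailPart_mul, hb, zero_smul, zero_add, ← letter_one,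
      tailPart_letter_mul, if_pos rfl]
  rw [zero_mul, zero_add, tailPart_mul, lie_apply_nil, zero_smul, zero_add, h1]

/-- The divergence `tr (y b^y)` is a cocycle. -/
theorem cyc_iharaBracket {b b' : Series} (hb : b [] = 0) (hb' : b' [] = 0) :
    cyc (Y * tailPart 1 (iharaBracket b b')) =
      cyc (der (iharaValues b) (Y * tailPart 1 b')) -
        cyc (der (iharaValues b') (Y * tailPart 1 b)) := by
  have h1 : tailPart 1 (⁅b, b'⁆ : Series) = tailPart 1 b * b' - tailPart 1 b' * b := by
    rw [Ring.lie_def, map_sub, tailPart_mul, tailPart_mul, hb, hb', zero_smul, zero_smul, zero_add,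
      zero_add]
  -- An exact identity in the associative algebra; the correction terms are three commutators,
  -- invisible to `cyc`.
  have e : Y * tailPart 1 (iharaBracket b b') =
      der (iharaValues b) (Y * tailPart 1 b') - der (iharaValues b') (Y * tailPart 1 b) +
        (⁅Y * tailPart 1 b, Y * tailPart 1 b'⁆ + ⁅Y * tailPart 1 b', b⁆ - ⁅Y * tailPart 1 b, b'⁆) := by
    rw [iharaBracket, map_sub, map_sub, h1, tailPart_der_ihara hb, tailPart_der_ihara hb', der_mul,
      der_mul, der_ihara_Y, der_ihara_Y]
    simp only [Ring.lie_def]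
    noncomm_ring
  rw [e, map_add, map_sub, map_sub, map_add, cyc_lie, cyc_lie, cyc_lie]
  simp

/-- The derivation kills x, hence every series in x alone. -/
theorem der_ihara_depthPart_zero (b f : Series) : der (iharaValues b) (depthPart 0 f) = 0 := by
  have key : ∀ (w : Word) (h : Series), (∀ v : Word, (1 : Fin 2) ∈ v → h v = 0) →
      der (iharaValues b) h w = 0 := by
    intro w h hh
    have h0 : ∀ h : Series, (∀ v : Word, (1 : Fin 2) ∈ v → h v = 0) → tailPart 1 h = 0 :=
      fun h hh => by
        ext v
        exact hh (1 :: v) (by simp)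
    have hS : ∀ h : Series, (∀ v : Word, (1 : Fin 2) ∈ v → h v = 0) →
        ∑ e, iharaValues b e * tailPart e h = 0 := by
      intro h hh
      rw [Fin.sum_univ_two, h0 h hh, mul_zero, add_zero]
      exact zero_mul _
    induction w generalizing h with
    | nil => rw [der_nil, hS h hh, zero_apply]
    | cons c w ih =>
      rw [der_cons, hS h hh, zero_apply, zero_add]
      exact ih _ fun v hv => hh (c :: v) (List.mem_cons_of_mem _ hv)
  ext w
  refine key w _ fun v hv => ?_
  rw [depthPart_apply, if_neg]
  have := List.count_pos_iff.2 hv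
  omega

theorem X_mul_depthPart_zero (f : Series) : X * depthPart 0 f = depthPart 0 f * X := by
  rw [← sub_eq_zero, ← Ring.lie_def]
  ext w
  by_cases hw : (1 : Fin 2) ∈ w
  · have hz : ∀ v : Word, (1 : Fin 2) ∈ v → depthPart 0 f v = 0 := fun v hv => by
      rw [depthPart_apply, if_neg]
      have := List.count_pos_iff.2 hv
      omega
    rw [Ring.lie_def, sub_apply, ← letter_zero, zero_apply]
    have h1 : (letter 0 * depthPart 0 f) w = 0 := by
      cases w with
      | nil => simp at hw
      | cons c w =>
        rw [letter_mul_cons]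
        split_ifs with hc
        · subst hc
          exact hz w (by simpa using hw)
        · rfl
    have h2 : (depthPart 0 f * letter 0) w = 0 := by
      rcases List.eq_nil_or_concat' w with rfl | ⟨w, c, rfl⟩
      · simp at hw
      · rw [mul_letter_concat]
        split_ifs with hc
        · subst hc
          exact hz w (by simpa using hw)
        · rfl
    rw [h1, h2, sub_zero]
  · have : ∃ k, w = List.replicate k 0 := by
      rcases word_eq_replicate_or_left w with h | ⟨i, N, rfl⟩
      · exact h
      · simp at hw
    obtain ⟨k, rfl⟩ := this
    exact lie_apply_replicate _ _ k

/-- The derivation attached to a push-invariant `b` annihilates the divergence of a circ-neutral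
`b'`. -/
theorem cyc_der_ihara_eq_zero {b b' : Series} (hb : NoDepthZero b) (hp : push b = b)
    (hc : CircNeutral b') : cyc (der (iharaValues b) (Y * tailPart 1 b')) = 0 := by
  obtain ⟨a, -, ha⟩ := exists_lie_eq_of_push_eq_self hb hp
  rw [circNeutral_iff] at hc
  set h := tailPart 1 b' with hh
  set h₀ := depthPart 0 h with hh₀
  -- Circ-neutrality says nothing about the depth 1 part y h₀(x). Here push-invariance of b is what
  -- helps: [b, y] h₀ = -[x, a] h₀ = -[x, a h₀], since h₀ commutes with x.
  have h1 : cyc (der (iharaValues b) (Y * h₀)) = 0 := by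
    have e : der (iharaValues b) (Y * h₀) = -⁅X, a * h₀⁆ := by
      have hbY : ⁅b, Y⁆ = -⁅X, a⁆ := by rw [ha, lie_skew]
      rw [der_mul, der_ihara_Y, der_ihara_depthPart_zero, mul_zero, add_zero, hbY, Ring.lie_def,
        Ring.lie_def, mul_assoc a, ← X_mul_depthPart_zero]
      noncomm_ring
    rw [e, map_neg, cyc_lie, neg_zero]
  -- All terms of y (h - h₀) have depth at least 2, where circ-neutrality applies; the derivation
  -- preserves the vanishing of the cyclic class.
  have h2 : cyc (Y * (h - h₀)) = 0 := by
    ext w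
    rw [zero_apply]
    by_cases hw : 2 ≤ w.count 1
    · have h3 : cyc (Y * h₀) w = 0 := by
        rw [cyc_apply]
        refine sum_eq_zero fun i _ => ?_
        have hcnt : (w.rotate i).count 1 = w.count 1 := (List.rotate_perm w i).count_eq 1
        generalize w.rotate i = v at hcnt
        rw [← letter_one]
        cases v with
        | nil => exact letter_mul_nil _ _
        | cons c v =>
          rw [letter_mul_cons]
          split_ifs with hc
          · subst hc
            rw [List.count_cons_self] at hcnt
            rw [hh₀, depthPart_apply, if_neg (by omega)]
          · rfl
      rw [mul_sub, map_sub, sub_apply, hc w hw, h3, sub_zero]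
    · rw [cyc_apply]
      refine sum_eq_zero fun i _ => ?_
      have hcnt : (w.rotate i).count 1 = w.count 1 := (List.rotate_perm w i).count_eq 1
      generalize w.rotate i = v at hcnt
      rw [← letter_one]
      cases v with
      | nil => exact letter_mul_nil _ _
      | cons c v =>
        rw [letter_mul_cons]
        split_ifs with hc
        · subst hc
          rw [List.count_cons_self] at hcnt
          rw [sub_apply, hh₀, depthPart_apply, if_pos (by omega), sub_self]
        · rfl
  have e : Y * h = Y * h₀ + Y * (h - h₀) := by noncomm_ring
  rw [e, map_add, map_add, h1, cyc_der_eq_zero (iharaValues_nil b) h2, add_zero]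

theorem circNeutral_iharaBracket {b b' : Series} (hb : NoDepthZero b) (hb' : NoDepthZero b')
    (hp : push b = b) (hp' : push b' = b') (hc : CircNeutral b) (hc' : CircNeutral b') :
    CircNeutral (iharaBracket b b') := by
  rw [circNeutral_iff]
  intro w _
  rw [cyc_iharaBracket hb.apply_nil hb'.apply_nil, cyc_der_ihara_eq_zero hb hp hc',
    cyc_der_ihara_eq_zero hb' hp' hc, sub_zero, zero_apply]

/-! ### The Lie algebra `lie_C` -/

theorem C_one : C 1 = Y := rfl

theorem C_succ_succ (i : ℕ) : C (i + 2) = ⁅X, C (i + 1)⁆ :=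
  Function.iterate_succ_apply' (fun f => ⁅X, f⁆) i Y

theorem weightPart_C (i n : ℕ) : weightPart n (C (i + 1)) = if n = i + 1 then C (i + 1) else 0 := by
  induction i generalizing n with
  | zero =>
    rw [zero_add, C_one, Y, weightPart_single]
    simp only [List.length_singleton, eq_comm]
  | succ i ih =>
    rw [C_succ_succ]
    cases n with
    | zero => rw [weightPart_zero_of_nil (lie_apply_nil _ _), if_neg (by omega)]
    | succ n =>
      rw [← letter_zero, weightPart_succ_lie_letter, ih]
      simp only [Nat.add_right_cancel_iff]
      split_ifs <;> simp

theorem C_mem_lieC {i : ℕ} (hi : 1 ≤ i) : C i ∈ lieC := by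
  obtain ⟨i, rfl⟩ := Nat.exists_eq_add_of_le' hi
  intro n
  rw [weightPart_C]
  split_ifs
  · exact LieSubalgebra.subset_lieSpan ⟨i + 1, hi, rfl⟩
  · exact zero_mem _

theorem der_mem_lieC {d : Fin 2 → Series} (hd : ∀ c, d c [] = 0)
    (hC : ∀ i, der d (C (i + 1)) ∈ lieC) {f : Series} (hf : f ∈ lieC) : der d f ∈ lieC := by
  refine map_mem_degreeCompletion (der_mem_fil hd) fun n => ?_
  refine der_lieSpan_le (L := lieC) (S := {f | ∃ i, 1 ≤ i ∧ f = C i}) ?_ ?_ (hf n)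
  · rintro _ ⟨i, hi, rfl⟩
    exact C_mem_lieC hi
  · rintro _ ⟨i, hi, rfl⟩
    obtain ⟨i, rfl⟩ := Nat.exists_eq_add_of_le' hi
    exact hC i

/-- Although x is not in `lieC`, ad x is a derivation sending C_i to C_(i+1). -/
theorem lie_X_mem_lieC {f : Series} (hf : f ∈ lieC) : ⁅X, f⁆ ∈ lieC := by
  rw [← der_lie_letter X f]
  refine der_mem_lieC (fun c => lie_apply_nil _ _) (fun i => ?_) hf
  rw [der_lie_letter, ← C_succ_succ]
  exact C_mem_lieC (by omega)

theorem der_ihara_mem_lieC {b f : Series} (hb : b ∈ lieC) (hf : f ∈ lieC) :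
    der (iharaValues b) f ∈ lieC := by
  refine der_mem_lieC (iharaValues_nil b) (fun i => ?_) hf
  induction i with
  | zero =>
    rw [zero_add, C_one, der_ihara_Y]
    exact lieC.lie_mem hb (C_mem_lieC (le_refl 1))
  | succ i ih =>
    rw [C_succ_succ, der_lie, der_ihara_X, zero_lie, zero_add]
    exact lie_X_mem_lieC ih

theorem iharaBracket_mem_lieC {b b' : Series} (hb : b ∈ lieC) (hb' : b' ∈ lieC) :
    iharaBracket b b' ∈ lieC :=
  sub_mem (sub_mem (der_ihara_mem_lieC hb hb') (der_ihara_mem_lieC hb' hb)) (lieC.lie_mem hb hb')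

/-! ### `lieC` inside `lie2`, and closure of `lkv` under its bracket. -/

theorem C_mem_lieSpan (i : ℕ) : C (i + 1) ∈ LieSubalgebra.lieSpan ℚ Series {X, Y} := by
  induction i with
  | zero => exact letter_mem_lieSpan 1
  | succ i ih =>
    rw [C_succ_succ]
    exact LieSubalgebra.lie_mem _ (letter_mem_lieSpan 0) ih

theorem lieC_le_lie2 : lieC ≤ lie2 := fun f hf n => by
  refine LieSubalgebra.lieSpan_le.2 ?_ (hf n)
  rintro _ ⟨i, hi, rfl⟩
  obtain ⟨i, rfl⟩ := Nat.exists_eq_add_of_le' hi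
  exact C_mem_lieSpan i

theorem noDepthZero_C (i : ℕ) : NoDepthZero (C (i + 1)) := by
  cases i with
  | zero =>
    intro k
    rcases k with _ | k <;> simp [C_one, Y, single, List.replicate_succ]
  | succ i =>
    rw [C_succ_succ]
    exact noDepthZero_lie _ _

theorem noDepthZero_of_mem_lieC {f : Series} (hf : f ∈ lieC) : NoDepthZero f := by
  have key : ∀ g ∈ LieSubalgebra.lieSpan ℚ Series {f | ∃ i, 1 ≤ i ∧ f = C i}, NoDepthZero g := by
    intro g hg
    induction hg using LieSubalgebra.lieSpan_induction with
    | mem s hs =>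
      obtain ⟨i, hi, rfl⟩ := hs
      obtain ⟨i, rfl⟩ := Nat.exists_eq_add_of_le' hi
      exact noDepthZero_C i
    | zero => exact fun _ => rfl
    | add f g _ _ hf hg => exact fun k => by rw [Series.add_apply, hf, hg, add_zero]
    | smul a f _ hf => exact fun k => by rw [Series.smul_apply, hf, mul_zero]
    | lie f g _ _ _ _ => exact noDepthZero_lie f g
  intro k
  have := key _ (hf k) k
  simpa [weightPart_apply] using this

theorem iharaBracket_mem_lkv {b b' : Series} (hb : b ∈ lkv) (hb' : b' ∈ lkv) :
    iharaBracket b b' ∈ lkv := by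
  obtain ⟨h1, h2, h3, h4⟩ := hb
  obtain ⟨k1, k2, k3, k4⟩ := hb'
  have n1 := noDepthZero_of_mem_lieC h1
  have n2 := noDepthZero_of_mem_lieC k1
  refine ⟨iharaBracket_mem_lieC h1 k1, fun n hn => ?_, push_iharaBracket n1 n2 h3 k3,
    circNeutral_iharaBracket n1 n2 h3 k3 h4 k4⟩
  refine weightPart_eq_zero_of_mem_fil (n := 3) ?_ hn
  have f1 := mem_fil_of_weightPart h2
  have f2 := mem_fil_of_weightPart k2
  exact sub_mem (sub_mem (der_mem_fil (iharaValues_nil b) 3 _ f2)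
    (der_mem_fil (iharaValues_nil b') 3 _ f1)) (fil_anti (by omega) (lie_mem_fil f1 f2))

/-- The substitution fixes x and sends C_1 to C_2, hence commutes with ad x and shifts all indices
by one. This shift is the factor u₁ ⋯ uᵣ of the theorem. -/
theorem substitute_C (i : ℕ) : substitute ellSubst (C (i + 1)) = C (i + 2) := by
  induction i with
  | zero =>
    rw [zero_add, C_succ_succ, C_one]
    exact substitute_letter ellSubst_nil 1
  | succ i ih =>
    rw [C_succ_succ, substitute_lie ellSubst_nil, substitute_ellSubst_X, ih, ← C_succ_succ]

theorem substitute_mem_lieC {f : Series} (hf : f ∈ lieC) : substitute ellSubst f ∈ lieC := by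
  refine map_mem_degreeCompletion (T := substLin ellSubst) (substitute_mem_fil ellSubst_nil)
    fun n => ?_
  refine substitute_lieSpan_le (L := lieC) ellSubst_nil ?_ (hf n)
  rintro _ ⟨i, hi, rfl⟩
  obtain ⟨i, rfl⟩ := Nat.exists_eq_add_of_le' hi
  rw [substitute_C]
  exact C_mem_lieC (by omega)


/-! ### Moulds in the variables `t₀, …, tᵣ` -/

theorem linearMap_eq_of_monomial {σ M : Type*} [AddCommGroup M] [Module ℚ M]
    {T T' : MvPolynomial σ ℚ →ₗ[ℚ] M}
    (h : ∀ m, T (MvPolynomial.monomial m 1) = T' (MvPolynomial.monomial m 1))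
    (p : MvPolynomial σ ℚ) : T p = T' p := by
  have : T = T' := (MvPolynomial.basisMonomials σ ℚ).ext fun m => by
    simpa only [MvPolynomial.coe_basisMonomials] using h m
  rw [this]

/-- The linear map sending the monomial `t₀^a₀ ⋯ tᵣ^aᵣ` to the word `x^a₀ y ⋯ y x^aᵣ`. -/
noncomputable def wordSeries (r : ℕ) : MvPolynomial (Fin (r + 1)) ℚ →ₗ[ℚ] Series :=
  (MvPolynomial.basisMonomials (Fin (r + 1)) ℚ).constr ℚ fun m => single (wordOf (List.ofFn m))

theorem wordSeries_monomial (r : ℕ) (m : Fin (r + 1) →₀ ℕ) :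
    wordSeries r (MvPolynomial.monomial m 1) = single (wordOf (List.ofFn m)) := by
  have := (MvPolynomial.basisMonomials (Fin (r + 1)) ℚ).constr_basis ℚ
    (fun m => single (wordOf (List.ofFn m))) m
  rwa [MvPolynomial.coe_basisMonomials] at this

theorem polyToSeries_monomial (r : ℕ) (m : Fin r →₀ ℕ) :
    polyToSeries r (MvPolynomial.monomial m 1) = (List.ofFn fun i => C (m i + 1)).prod := by
  have := (MvPolynomial.basisMonomials (Fin r) ℚ).constr_basis ℚ
    (fun m => (List.ofFn fun i => C (m i + 1)).prod) m
  rwa [MvPolynomial.coe_basisMonomials] at this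

theorem ofFn_ne_nil {r : ℕ} (a : Fin (r + 1) → ℕ) : List.ofFn a ≠ [] := by
  rw [List.ofFn_succ]
  exact List.cons_ne_nil _ _

theorem wordSeries_apply (r : ℕ) (p : MvPolynomial (Fin (r + 1)) ℚ) (a : Fin (r + 1) →₀ ℕ) :
    wordSeries r p (wordOf (List.ofFn a)) = p.coeff a := by
  let ev : Series →ₗ[ℚ] ℚ :=
    { toFun := fun f => f (wordOf (List.ofFn a)), map_add' := fun _ _ => rfl, map_smul' := fun _ _ => rfl }
  refine linearMap_eq_of_monomial (T := ev ∘ₗ wordSeries r) (T' := MvPolynomial.lcoeff ℚ a)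
    (fun m => ?_) p
  change wordSeries r (MvPolynomial.monomial m 1) (wordOf (List.ofFn a)) =
    (MvPolynomial.monomial m 1).coeff a
  rw [wordSeries_monomial, MvPolynomial.coeff_monomial, single]
  refine if_congr ⟨fun h => ?_, fun h => by rw [h]⟩ rfl rfl
  have := List.ofFn_injective (wordOf_injective (ofFn_ne_nil a) (ofFn_ne_nil m) h)
  exact (DFunLike.coe_injective this).symm

theorem wordSeries_injective (r : ℕ) : Function.Injective (wordSeries r) := fun p q h => by
  ext a
  rw [← wordSeries_apply, ← wordSeries_apply, h]

theorem single_cons (c : Fin 2) (w : Word) : letter c * single w = single (c :: w) := by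
  ext v
  cases v with
  | nil => rw [letter_mul_nil]; simp [single]
  | cons e v =>
    rw [letter_mul_cons]
    by_cases h : e = c <;> simp [single, h]

theorem single_concat (c : Fin 2) (w : Word) : single w * letter c = single (w ++ [c]) := by
  ext v
  rcases List.eq_nil_or_concat' v with rfl | ⟨v, e, rfl⟩
  · rw [mul_letter_nil]
    simp [single]
  · rw [mul_letter_concat]
    by_cases h : e = c <;> simp [single, h]

theorem wordOf_succ_cons (m : ℕ) (l : List ℕ) : wordOf ((m + 1) :: l) = 0 :: wordOf (m :: l) := by
  rcases eq_or_ne l [] with rfl | h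
  · rw [wordOf_singleton, wordOf_singleton]
    rfl
  · rw [wordOf_cons _ h, wordOf_cons _ h]
    rfl

theorem wordOf_concat_succ (m : ℕ) (l : List ℕ) :
    wordOf (l ++ [m + 1]) = wordOf (l ++ [m]) ++ [0] := by
  rcases eq_or_ne l [] with rfl | h
  · rw [List.nil_append, List.nil_append, wordOf_singleton, wordOf_singleton, List.replicate_succ']
  · rw [wordOf_concat _ h, wordOf_concat _ h, List.replicate_succ']
    simp

theorem X_mul_wordSeries (r : ℕ) (p : MvPolynomial (Fin (r + 1)) ℚ) :
    X * wordSeries r p = wordSeries r (MvPolynomial.X 0 * p) := by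
  refine linearMap_eq_of_monomial (T := LinearMap.mulLeft ℚ X ∘ₗ wordSeries r)
    (T' := wordSeries r ∘ₗ LinearMap.mulLeft ℚ (MvPolynomial.X 0)) (fun m => ?_) p
  have hX : (MvPolynomial.X 0 : MvPolynomial (Fin (r + 1)) ℚ) =
    MvPolynomial.monomial (Finsupp.single 0 1) 1 := rfl
  rw [LinearMap.comp_apply, LinearMap.comp_apply, LinearMap.mulLeft_apply, LinearMap.mulLeft_apply,
    hX, MvPolynomial.monomial_mul, one_mul, wordSeries_monomial, wordSeries_monomial,
    ← letter_zero, single_cons]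
  simp only [List.ofFn_succ]
  have h0 : (Finsupp.single 0 1 + m : Fin (r + 1) →₀ ℕ) 0 = m 0 + 1 := by
    simp [add_comm]
  have h1 : ∀ i : Fin r, (Finsupp.single 0 1 + m : Fin (r + 1) →₀ ℕ) i.succ = m i.succ := by
    intro i
    simp
  simp only [h0, h1, wordOf_succ_cons]

theorem wordSeries_mul_X (r : ℕ) (p : MvPolynomial (Fin (r + 1)) ℚ) :
    wordSeries r p * X = wordSeries r (MvPolynomial.X (Fin.last r) * p) := by
  refine linearMap_eq_of_monomial (T := LinearMap.mulRight ℚ X ∘ₗ wordSeries r)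
    (T' := wordSeries r ∘ₗ LinearMap.mulLeft ℚ (MvPolynomial.X (Fin.last r))) (fun m => ?_) p
  have hX : (MvPolynomial.X (Fin.last r) : MvPolynomial (Fin (r + 1)) ℚ) =
    MvPolynomial.monomial (Finsupp.single (Fin.last r) 1) 1 := rfl
  rw [LinearMap.comp_apply, LinearMap.comp_apply, LinearMap.mulRight_apply, LinearMap.mulLeft_apply,
    hX, MvPolynomial.monomial_mul, one_mul, wordSeries_monomial, wordSeries_monomial,
    ← letter_zero, single_concat]
  simp only [List.ofFn_succ', List.concat_eq_append]
  have h0 : (Finsupp.single (Fin.last r) 1 + m : Fin (r + 1) →₀ ℕ) (Fin.last r) = m (Fin.last r) + 1 := by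
    simp [add_comm]
  have h1 : ∀ i : Fin r, (Finsupp.single (Fin.last r) 1 + m : Fin (r + 1) →₀ ℕ) i.castSucc = m i.castSucc := by
    intro i
    simp
  simp only [h0, h1, wordOf_concat_succ]

theorem Y_mul_wordSeries (r : ℕ) (p : MvPolynomial (Fin (r + 1)) ℚ) :
    Y * wordSeries r p = wordSeries (r + 1) (MvPolynomial.rename Fin.succ p) := by
  refine linearMap_eq_of_monomial (T := LinearMap.mulLeft ℚ Y ∘ₗ wordSeries r)
    (T' := wordSeries (r + 1) ∘ₗ (MvPolynomial.rename Fin.succ).toLinearMap) (fun m => ?_) p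
  change Y * wordSeries r (MvPolynomial.monomial m 1) =
    wordSeries (r + 1) (MvPolynomial.rename Fin.succ (MvPolynomial.monomial m 1))
  rw [MvPolynomial.rename_monomial, wordSeries_monomial, wordSeries_monomial, ← letter_one,
    single_cons, List.ofFn_succ (n := r + 1)]
  have h0 : (Finsupp.mapDomain Fin.succ m) (0 : Fin (r + 2)) = 0 :=
    Finsupp.mapDomain_of_notMem_range _ _ (by simp)
  have h1 : ∀ i, (Finsupp.mapDomain Fin.succ m) (Fin.succ i) = m i :=
    fun i => Finsupp.mapDomain_apply (Fin.succ_injective _) m i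
  simp only [h0, h1]
  rw [wordOf_cons _ (ofFn_ne_nil _)]
  rfl

/-- An x to the left of C_(k+1) increases the exponent of t₀; one between C_(k+1) and the following
word increases that of t₁. So each ad x in C_(k+1) contributes a factor t₀ - t₁. -/
theorem C_mul_wordSeries (k r : ℕ) (p : MvPolynomial (Fin (r + 1)) ℚ) :
    C (k + 1) * wordSeries r p = wordSeries (r + 1)
      ((MvPolynomial.X 0 - MvPolynomial.X 1) ^ k * MvPolynomial.rename Fin.succ p) := by
  induction k generalizing p with
  | zero => rw [pow_zero, one_mul, zero_add, C_one, Y_mul_wordSeries]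
  | succ k ih =>
    have e : C (k + 2) * wordSeries r p =
        X * (C (k + 1) * wordSeries r p) - C (k + 1) * (X * wordSeries r p) := by
      rw [C_succ_succ, Ring.lie_def]
      noncomm_ring
    rw [e, X_mul_wordSeries, ih, ih, X_mul_wordSeries, ← map_sub, map_mul, MvPolynomial.rename_X]
    congr 1
    rw [Fin.succ_zero_eq_one]
    ring

/-- The substitution `uᵢ ↦ tᵢ₋₁ - tᵢ`. -/
noncomputable def diffHom (r : ℕ) : MvPolynomial (Fin r) ℚ →ₐ[ℚ] MvPolynomial (Fin (r + 1)) ℚ :=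
  MvPolynomial.aeval fun i => MvPolynomial.X i.castSucc - MvPolynomial.X i.succ

theorem diffHom_X (r : ℕ) (i : Fin r) :
    diffHom r (MvPolynomial.X i) = MvPolynomial.X i.castSucc - MvPolynomial.X i.succ :=
  MvPolynomial.aeval_X _ i

theorem prod_C_eq_wordSeries (r : ℕ) (m : Fin r → ℕ) :
    (List.ofFn fun i => C (m i + 1)).prod = wordSeries r
      (∏ i : Fin r, (MvPolynomial.X i.castSucc - MvPolynomial.X i.succ) ^ m i) := by
  induction r with
  | zero =>
    have h1 : (1 : MvPolynomial (Fin 1) ℚ) = MvPolynomial.monomial 0 1 := rfl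
    rw [Finset.univ_eq_empty, Finset.prod_empty, h1, wordSeries_monomial]
    have h2 : wordOf (List.ofFn ⇑(0 : Fin (0 + 1) →₀ ℕ)) = [] := by simp [wordOf]
    rw [h2]
    rfl
  | succ r ih =>
    rw [List.ofFn_succ, List.prod_cons, ih, C_mul_wordSeries, Fin.prod_univ_succ, map_prod]
    simp only [map_pow, map_sub, MvPolynomial.rename_X, Fin.castSucc_zero, Fin.succ_zero_eq_one,
      Fin.succ_castSucc]

/-- The dictionary between the expansion in the C_i and the expansion in words, used to translate
all conditions on coefficients. -/
theorem polyToSeries_eq (r : ℕ) (p : MvPolynomial (Fin r) ℚ) :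
    polyToSeries r p = wordSeries r (diffHom r p) := by
  refine linearMap_eq_of_monomial (T := polyToSeries r)
    (T' := wordSeries r ∘ₗ (diffHom r).toLinearMap) (fun m => ?_) p
  change _ = wordSeries r (diffHom r (MvPolynomial.monomial m 1))
  rw [polyToSeries_monomial, prod_C_eq_wordSeries, diffHom, MvPolynomial.aeval_monomial, map_one,
    one_mul, Finsupp.prod_fintype _ _ (fun i => pow_zero _)]

theorem sum_telescope {A : Type*} [AddCommGroup A] (r : ℕ) (F : Fin (r + 1) → A) :
    ∑ i : Fin r, (F i.castSucc - F i.succ) = F 0 - F (Fin.last r) := by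
  have h1 := Fin.sum_univ_castSucc F
  rw [Fin.sum_univ_succ] at h1
  rw [sum_sub_distrib, sub_eq_sub_iff_add_eq_add, h1]

theorem diffHom_sum (r : ℕ) :
    diffHom r (∑ i, MvPolynomial.X i) = MvPolynomial.X 0 - MvPolynomial.X (Fin.last r) := by
  rw [map_sum]
  simp only [diffHom_X]
  exact sum_telescope r fun i => (MvPolynomial.X i : MvPolynomial (Fin (r + 1)) ℚ)

theorem diffHom_injective (r : ℕ) : Function.Injective (diffHom r) := by
  -- The left inverse is the normalization t₀ = 0, tᵢ = -(u₁ + ⋯ + uᵢ).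
  let V : MvPolynomial (Fin (r + 1)) ℚ →ₐ[ℚ] MvPolynomial (Fin r) ℚ :=
    MvPolynomial.aeval fun i => -Fin.partialSum MvPolynomial.X i
  refine Function.LeftInverse.injective (g := V) fun p => ?_
  have : V.comp (diffHom r) = AlgHom.id ℚ _ := by
    ext i : 1
    rw [AlgHom.comp_apply, diffHom_X, map_sub, MvPolynomial.aeval_X, MvPolynomial.aeval_X,
      Fin.partialSum_succ]
    simp
  exact DFunLike.congr_fun this p

/-- The products C_a₁ ⋯ C_aᵣ are linearly independent; this makes the associated family unique. -/
theorem polyToSeries_injective (r : ℕ) : Function.Injective (polyToSeries r) := fun p q h => by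
  rw [polyToSeries_eq, polyToSeries_eq] at h
  exact diffHom_injective r (wordSeries_injective r h)

theorem isHomogeneous_diffHom {r d : ℕ} {p : MvPolynomial (Fin r) ℚ} (hp : p.IsHomogeneous d) :
    (diffHom r p).IsHomogeneous d := by
  have := hp.aeval (fun i : Fin r => (MvPolynomial.X i.castSucc - MvPolynomial.X i.succ :
    MvPolynomial (Fin (r + 1)) ℚ)) (n := 1) fun i =>
      (MvPolynomial.isHomogeneous_X _ _).sub (MvPolynomial.isHomogeneous_X _ _)
  rwa [one_mul] at this

theorem exists_ofFn_of_length {r : ℕ} {l : List ℕ} (h : l.length = r) :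
    ∃ a : Fin r → ℕ, l = List.ofFn a := by
  subst h
  exact ⟨l.get, (List.ofFn_get l).symm⟩

theorem wordSeries_apply_ne {r : ℕ} (p : MvPolynomial (Fin (r + 1)) ℚ) {l : List ℕ} (hl : l ≠ [])
    (h : l.length ≠ r + 1) : wordSeries r p (wordOf l) = 0 := by
  let ev : Series →ₗ[ℚ] ℚ :=
    { toFun := fun f => f (wordOf l), map_add' := fun _ _ => rfl, map_smul' := fun _ _ => rfl }
  refine linearMap_eq_of_monomial (T := ev ∘ₗ wordSeries r) (T' := 0) (fun m => ?_) p
  change wordSeries r (MvPolynomial.monomial m 1) (wordOf l) = 0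
  rw [wordSeries_monomial, single, if_neg]
  intro e
  refine h ?_
  rw [wordOf_injective hl (ofFn_ne_nil m) e, List.length_ofFn]

theorem coe_equivFunOnFinite_symm {r : ℕ} (a : Fin r → ℕ) :
    ⇑(Finsupp.equivFunOnFinite.symm a) = a := rfl

theorem parts_wordSeries {r d : ℕ} {p : MvPolynomial (Fin (r + 1)) ℚ} (hp : p.IsHomogeneous d)
    (n s : ℕ) : weightPart n (depthPart s (wordSeries r p)) =
      if n = d + r ∧ s = r then wordSeries r p else 0 := by
  ext w
  rw [weightPart_apply, depthPart_apply]
  obtain ⟨l, hl, rfl⟩ := exists_wordOf w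
  have h0 : ∀ c : Prop, [Decidable c] → (if c then wordSeries r p else 0) (wordOf l) =
      if c then wordSeries r p (wordOf l) else 0 := by
    intro c _
    split_ifs <;> rfl
  rw [h0, count_wordOf, length_wordOf]
  have hpos := List.length_pos_iff.2 hl
  by_cases hr : l.length = r + 1
  · obtain ⟨a, rfl⟩ := exists_ofFn_of_length hr
    have ha := wordSeries_apply r p (Finsupp.equivFunOnFinite.symm a)
    rw [coe_equivFunOnFinite_symm] at ha
    by_cases hd : (List.ofFn a).sum = d
    · rw [hr, hd]
      rw [← ite_and]
      exact if_congr (by omega) rfl rfl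
    · have : wordSeries r p (wordOf (List.ofFn a)) = 0 := by
        rw [ha]
        refine hp.coeff_eq_zero ?_
        rw [Finsupp.degree_eq_sum]
        rwa [List.sum_ofFn] at hd
      rw [this]
      simp
  · rw [wordSeries_apply_ne p hl hr]
    simp

theorem parts_polyToSeries {r d : ℕ} {p : MvPolynomial (Fin r) ℚ} (hp : p.IsHomogeneous d)
    (n s : ℕ) : weightPart n (depthPart s (polyToSeries r p)) =
      if n = d + r ∧ s = r then polyToSeries r p else 0 := by
  rw [polyToSeries_eq]
  exact parts_wordSeries (isHomogeneous_diffHom hp) n s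

/-! ### Existence and uniqueness of the associated family of polynomials -/

theorem isMouldOf_unique {b : Series} {B B' : PolyFamily} (h : IsMouldOf b B)
    (h' : IsMouldOf b B') : B = B' := by
  funext r d
  exact polyToSeries_injective r ((h r d).2.symm.trans (h' r d).2)

/-- A Lie polynomial in the C_i is a linear combination of products of C_i's, and each product is
homogeneous in both weight and depth, hence contributes a monomial or nothing. -/
theorem parts_mem_of_mem_lieSpan {f : Series}
    (hf : f ∈ LieSubalgebra.lieSpan ℚ Series {f | ∃ i, 1 ≤ i ∧ f = C i}) (r d : ℕ) :
    ∃ p : MvPolynomial (Fin r) ℚ, p.IsHomogeneous d ∧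
      weightPart (d + r) (depthPart r f) = polyToSeries r p := by
  have h1 : f ∈ Algebra.adjoin ℚ {f : Series | ∃ i, 1 ≤ i ∧ f = C i} := by
    induction hf using LieSubalgebra.lieSpan_induction with
    | mem s hs => exact Algebra.subset_adjoin hs
    | zero => exact zero_mem _
    | add f g _ _ hf hg => exact add_mem hf hg
    | smul a f _ hf => exact Subalgebra.smul_mem _ hf a
    | lie f g _ _ hf hg => exact sub_mem (mul_mem hf hg) (mul_mem hg hf)
  rw [← Subalgebra.mem_toSubmodule, Algebra.adjoin_eq_span] at h1
  clear hf
  induction h1 using Submodule.span_induction with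
  | mem s hs =>
    obtain ⟨L, hL, rfl⟩ := Submonoid.exists_list_of_mem_closure hs
    have hL' : ∃ l : List ℕ, L = l.map fun i => C (i + 1) := by
      clear hs
      induction L with
      | nil => exact ⟨[], rfl⟩
      | cons a L ih =>
        obtain ⟨l, rfl⟩ := ih fun y hy => hL y (List.mem_cons_of_mem _ hy)
        obtain ⟨i, hi, rfl⟩ := hL a List.mem_cons_self
        obtain ⟨i, rfl⟩ := Nat.exists_eq_add_of_le' hi
        exact ⟨i :: l, rfl⟩
    obtain ⟨l, rfl⟩ := hL'
    set m : Fin l.length →₀ ℕ := Finsupp.equivFunOnFinite.symm l.get with hm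
    have e : (l.map fun i => C (i + 1)).prod =
        polyToSeries l.length (MvPolynomial.monomial m 1) := by
      rw [polyToSeries_monomial, hm, coe_equivFunOnFinite_symm]
      conv_lhs => rw [← List.ofFn_get l, List.map_ofFn]
      rfl
    have hhom : (MvPolynomial.monomial m (1 : ℚ)).IsHomogeneous m.degree :=
      MvPolynomial.isHomogeneous_monomial _ rfl
    rw [e, parts_polyToSeries hhom]
    by_cases hc : d + r = m.degree + l.length ∧ r = l.length
    · obtain ⟨h1, h2⟩ := hc
      subst h2
      have h3 : m.degree = d := by omega
      exact ⟨_, h3 ▸ hhom, by rw [if_pos ⟨h1, rfl⟩]⟩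
    · exact ⟨0, MvPolynomial.isHomogeneous_zero _ _ _, by rw [if_neg hc, map_zero]⟩
  | zero => exact ⟨0, MvPolynomial.isHomogeneous_zero _ _ _, by simp only [map_zero]⟩
  | add f g _ _ hf hg =>
    obtain ⟨p, hp, e⟩ := hf
    obtain ⟨q, hq, e'⟩ := hg
    exact ⟨p + q, hp.add hq, by rw [map_add, map_add, map_add, e, e']⟩
  | smul a f _ hf =>
    obtain ⟨p, hp, e⟩ := hf
    exact ⟨a • p, (MvPolynomial.homogeneousSubmodule _ ℚ d).smul_mem a hp, by
      rw [map_smul, map_smul, map_smul, e]⟩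

theorem exists_isMouldOf {b : Series} (hb : b ∈ lieC) : ∃ B, IsMouldOf b B := by
  choose B hB using fun r d => parts_mem_of_mem_lieSpan (hb (d + r)) r d
  refine ⟨B, fun r d => ⟨(hB r d).1, ?_⟩⟩
  rw [← (hB r d).2]
  ext w
  simp only [weightPart_apply, depthPart_apply]
  split_ifs <;> rfl

/-- Coefficients of b at words of depth r are the coefficients of B^r(t₀ - t₁, …, tᵣ₋₁ - tᵣ). -/
theorem IsMouldOf.apply_wordOf {b : Series} {B : PolyFamily} (h : IsMouldOf b B) {r d : ℕ}
    (a : Fin (r + 1) → ℕ) (ha : ∑ i, a i = d) :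
    b (wordOf (List.ofFn a)) =
      (diffHom r (B r d)).coeff (Finsupp.equivFunOnFinite.symm a) := by
  have h1 := congrArg (fun f : Series => f (wordOf (List.ofFn a))) (h r d).2
  have h2 := wordSeries_apply r (diffHom r (B r d)) (Finsupp.equivFunOnFinite.symm a)
  rw [coe_equivFunOnFinite_symm] at h2
  rw [← h2, ← polyToSeries_eq]
  refine Eq.trans ?_ h1
  change _ = (if _ then (if _ then _ else _) else _)
  rw [count_wordOf, length_wordOf, List.length_ofFn, List.sum_ofFn, ha, if_pos (by omega),
    if_pos (by omega)]


/-! ### The map on moulds -/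

/-- The polynomial `u₁ ⋯ uᵣ (u₁ + ⋯ + uᵣ)`. -/
noncomputable def ellFactor (r : ℕ) : MvPolynomial (Fin r) ℚ :=
  (∏ i, MvPolynomial.X i) * ∑ i, MvPolynomial.X i

theorem Delta_of_le {B : PolyFamily} {r d : ℕ} (h : r + 1 ≤ d) :
    Delta B r d = ellFactor r * B r (d - (r + 1)) := if_pos h

theorem Delta_of_lt {B : PolyFamily} {r d : ℕ} (h : d < r + 1) : Delta B r d = 0 :=
  if_neg (by omega)

theorem isHomogeneous_ellFactor (r : ℕ) : (ellFactor r).IsHomogeneous (r + 1) := by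
  refine MvPolynomial.IsHomogeneous.mul ?_
    (MvPolynomial.IsHomogeneous.sum _ _ _ fun i _ => MvPolynomial.isHomogeneous_X _ i)
  have := MvPolynomial.IsHomogeneous.prod (univ : Finset (Fin r))
    (fun i => (MvPolynomial.X i : MvPolynomial (Fin r) ℚ)) (fun _ => 1)
    fun i _ => MvPolynomial.isHomogeneous_X _ i
  simpa using this

/-- Left multiplication by x is multiplication by t₀ and right multiplication by tᵣ; the difference
telescopes to the sum of the uᵢ. -/
theorem lie_X_polyToSeries (r : ℕ) (p : MvPolynomial (Fin r) ℚ) :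
    ⁅X, polyToSeries r p⁆ = polyToSeries r ((∑ i, MvPolynomial.X i) * p) := by
  rw [polyToSeries_eq, polyToSeries_eq, Ring.lie_def, X_mul_wordSeries, wordSeries_mul_X, ← map_sub,
    map_mul, diffHom_sum, sub_mul]

theorem substitute_list_prod {g : Fin 2 → Series} (hg : ∀ c, g c [] = 0) (L : List Series) :
    substitute g L.prod = (L.map (substitute g)).prod := by
  induction L with
  | nil => exact substitute_one hg
  | cons f L ih => rw [List.prod_cons, substitute_mul hg, ih, List.map_cons, List.prod_cons]

theorem polyToSeries_prod_X_pow (r : ℕ) (m : Fin r → ℕ) :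
    polyToSeries r (∏ i, MvPolynomial.X i ^ m i) = (List.ofFn fun i => C (m i + 1)).prod := by
  rw [polyToSeries_eq, prod_C_eq_wordSeries, map_prod]
  simp only [map_pow, diffHom_X]

theorem substitute_polyToSeries (r : ℕ) (p : MvPolynomial (Fin r) ℚ) :
    substitute ellSubst (polyToSeries r p) = polyToSeries r ((∏ i, MvPolynomial.X i) * p) := by
  let u : MvPolynomial (Fin r) ℚ := ∏ i, MvPolynomial.X i
  refine linearMap_eq_of_monomial (T := substLin ellSubst ∘ₗ polyToSeries r)
    (T' := polyToSeries r ∘ₗ LinearMap.mulLeft ℚ u) (fun m => ?_) p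
  have hm : (MvPolynomial.monomial m 1 : MvPolynomial (Fin r) ℚ) =
      ∏ i, MvPolynomial.X i ^ m i := by
    rw [MvPolynomial.monomial_eq, map_one, one_mul, Finsupp.prod_fintype _ _ fun i => pow_zero _]
  rw [LinearMap.comp_apply, LinearMap.comp_apply, LinearMap.mulLeft_apply, hm, ← prod_mul_distrib]
  simp only [← pow_succ']
  rw [polyToSeries_prod_X_pow, polyToSeries_prod_X_pow r fun i => m i + 1]
  refine (substitute_list_prod ellSubst_nil _).trans ?_
  rw [List.map_ofFn]
  simp only [Function.comp_def, substitute_C]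

/-! ### Weight and depth under y ↦ [x, y], and the resulting family. -/

theorem lie_letter_letter_ne_zero {c e : Fin 2} {v : Word} (h : (letter c * letter e) v ≠ 0) :
    v = [c, e] := by
  cases v with
  | nil => exact absurd (letter_mul_nil c _) h
  | cons a v =>
    rw [letter_mul_cons] at h
    split_ifs at h with hc
    · subst hc
      rw [letter, single] at h
      split_ifs at h with hv
      · rw [hv]
      · exact absurd rfl h
    · exact absurd rfl h

theorem ellSubst_ne_zero {c : Fin 2} {v : Word} (h : ellSubst c v ≠ 0) :
    v.length = 1 + [c].count 1 ∧ v.count 1 = [c].count 1 := by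
  fin_cases c
  · have h' : letter 0 v ≠ 0 := h
    have : v = [0] := by
      by_contra hv
      exact h' (if_neg hv)
    subst this
    decide
  · have h' : ⁅X, Y⁆ v ≠ 0 := h
    rw [Ring.lie_def, sub_apply, ← letter_zero, ← letter_one] at h'
    by_cases h1 : (letter 0 * letter 1) v = 0
    · rw [h1, zero_sub, neg_ne_zero] at h'
      rw [lie_letter_letter_ne_zero h']
      decide
    · rw [lie_letter_letter_ne_zero h1]
      decide

theorem prod_ellSubst_ne_zero {w v : Word} (h : (w.map ellSubst).prod v ≠ 0) :
    v.length = w.length + w.count 1 ∧ v.count 1 = w.count 1 := by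
  induction w generalizing v with
  | nil =>
    have h' : (1 : Series) v ≠ 0 := h
    rw [one_apply] at h'
    have : v = [] := by
      by_contra hv
      exact h' (if_neg hv)
    subst this
    simp
  | cons c w ih =>
    rw [List.map_cons, List.prod_cons, mul_apply] at h
    obtain ⟨i, -, hi⟩ := exists_ne_zero_of_sum_ne_zero h
    obtain ⟨h1, h2⟩ := ellSubst_ne_zero (left_ne_zero_of_mul hi)
    obtain ⟨h3, h4⟩ := ih (right_ne_zero_of_mul hi)
    have hlen := congrArg List.length (List.take_append_drop i v)
    have hcnt := congrArg (List.count 1) (List.take_append_drop i v)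
    rw [List.length_append] at hlen
    rw [List.count_append] at hcnt
    have h5 : (c :: w).count 1 = [c].count 1 + w.count 1 := by
      rw [← List.count_append, List.singleton_append]
    rw [h5, List.length_cons]
    omega

/-- Each y becomes a bracket of weight 2 and depth 1, so depth is kept and weight increases by the
depth. The substitution can therefore be computed on each B^r_d separately. -/
theorem parts_substitute_ellSubst (r n : ℕ) (f : Series) :
    weightPart (n + r) (depthPart r (substitute ellSubst f)) =
      substitute ellSubst (weightPart n (depthPart r f)) := by
  ext v
  rw [weightPart_apply, depthPart_apply]
  simp only [substitute, ofFn_prod_eq]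
  have key : ∀ w : Word, weightPart n (depthPart r f) w * (w.map ellSubst).prod v =
      if v.length = n + r ∧ v.count 1 = r then f w * (w.map ellSubst).prod v else 0 := by
    intro w
    by_cases h : (w.map ellSubst).prod v = 0
    · simp [h]
    · obtain ⟨h1, h2⟩ := prod_ellSubst_ne_zero h
      rw [weightPart_apply, depthPart_apply, ← ite_and, ite_mul, zero_mul]
      exact if_congr (by omega) rfl rfl
  simp only [key]
  split_ifs with h1 h2 h3 h3 h3 <;> simp_all

theorem depthPart_letter_zero_mul (r : ℕ) (f : Series) :
    depthPart r (X * f) = X * depthPart r f := by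
  ext w
  rw [depthPart_apply, ← letter_zero]
  cases w with
  | nil => rw [letter_mul_nil, letter_mul_nil, ite_self]
  | cons e w =>
    rw [letter_mul_cons, letter_mul_cons, depthPart_apply]
    by_cases h : e = 0
    · subst h
      simp
    · simp [h]

theorem depthPart_mul_letter_zero (r : ℕ) (f : Series) :
    depthPart r (f * X) = depthPart r f * X := by
  ext w
  rw [depthPart_apply, ← letter_zero]
  rcases List.eq_nil_or_concat' w with rfl | ⟨w, e, rfl⟩
  · rw [mul_letter_nil, mul_letter_nil, ite_self]
  · rw [mul_letter_concat, mul_letter_concat, depthPart_apply]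
    by_cases h : e = 0
    · subst h
      simp [List.count_append]
    · simp [h]

theorem depthPart_lie_X (r : ℕ) (f : Series) : depthPart r ⁅X, f⁆ = ⁅X, depthPart r f⁆ := by
  rw [Ring.lie_def, Ring.lie_def, map_sub, depthPart_letter_zero_mul, depthPart_mul_letter_zero]

theorem weightPart_depthPart_eq_zero {n r : ℕ} (h : n < r) (f : Series) :
    weightPart n (depthPart r f) = 0 := by
  ext w
  rw [weightPart_apply, depthPart_apply]
  have := List.count_le_length (a := (1 : Fin 2)) (l := w)
  split_ifs
  · omega
  · rfl
  · rfl

/-- The family associated with `[x, b(x, [x, y])]`. -/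
theorem IsMouldOf.delta {b : Series} {B : PolyFamily} (h : IsMouldOf b B) :
    IsMouldOf ⁅X, substitute ellSubst b⁆ (Delta B) := by
  intro r d
  by_cases hd : r + 1 ≤ d
  · rw [Delta_of_le hd]
    obtain ⟨e, rfl⟩ := Nat.exists_eq_add_of_le hd
    rw [Nat.add_sub_cancel_left]
    refine ⟨(isHomogeneous_ellFactor r).mul (h r e).1, ?_⟩
    rw [depthPart_lie_X, show r + 1 + e + r = (e + r) + r + 1 by omega, ← letter_zero,
      weightPart_succ_lie_letter, parts_substitute_ellSubst, (h r e).2, letter_zero,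
      substitute_polyToSeries, lie_X_polyToSeries, ellFactor]
    congr 1
    ring
  -- Here d ≤ r. In depth r the substitution produces weight at least 2r and ad x adds one, so the
  -- part of weight d + r vanishes.
  · rw [Delta_of_lt (by omega), map_zero]
    refine ⟨MvPolynomial.isHomogeneous_zero _ _ _, ?_⟩
    rw [depthPart_lie_X]
    rcases hn : d + r with _ | m
    · exact weightPart_zero_of_nil (lie_apply_nil _ _)
    · rw [← letter_zero, weightPart_succ_lie_letter]
      have h0 : weightPart m (depthPart r (substitute ellSubst b)) = 0 := by
        by_cases hm : r ≤ m
        · obtain ⟨n, rfl⟩ := Nat.exists_eq_add_of_le' hm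
          rw [parts_substitute_ellSubst, weightPart_depthPart_eq_zero (by omega)]
          exact map_zero (substLin ellSubst)
        · exact weightPart_depthPart_eq_zero (by omega) _
      rw [h0, lie_zero]

/-! ### Push-invariance in terms of moulds -/

theorem ofFn_rotate {r : ℕ} (a : Fin (r + 1) → ℕ) (j : Fin (r + 1)) :
    (List.ofFn a).rotate j = List.ofFn fun i => a (i + j) := by
  refine List.ext_getElem (by simp) fun i h1 h2 => ?_
  rw [List.getElem_rotate, List.getElem_ofFn, List.getElem_ofFn]
  congr 1
  refine Fin.ext ?_
  rw [Fin.val_add]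
  simp

theorem ofFn_rotate_one {r : ℕ} (a : Fin (r + 1) → ℕ) :
    (List.ofFn a).rotate 1 = List.ofFn fun i => a (i + 1) := by
  rw [← ofFn_rotate a 1, ← List.rotate_mod _ 1, List.length_ofFn]
  rfl

theorem coeff_rename_equiv {σ : Type*} [Finite σ] (e : σ ≃ σ) (p : MvPolynomial σ ℚ) (a : σ → ℕ) :
    (MvPolynomial.rename e p).coeff (Finsupp.equivFunOnFinite.symm a) =
      p.coeff (Finsupp.equivFunOnFinite.symm (a ∘ e)) := by
  have : Finsupp.equivFunOnFinite.symm a =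
      Finsupp.mapDomain e (Finsupp.equivFunOnFinite.symm (a ∘ e)) := by
    ext i
    obtain ⟨j, rfl⟩ := e.surjective i
    rw [Finsupp.mapDomain_apply e.injective]
    rfl
  rw [this, MvPolynomial.coeff_rename_mapDomain _ e.injective]

theorem coeff_eq_zero_of_sum_ne {r d : ℕ} {p : MvPolynomial (Fin r) ℚ} (hp : p.IsHomogeneous d)
    {a : Fin r → ℕ} (ha : ∑ i, a i ≠ d) : p.coeff (Finsupp.equivFunOnFinite.symm a) = 0 :=
  hp.coeff_eq_zero (by rwa [Finsupp.degree_eq_sum])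

/-- Push rotates the exponents of a word, hence the variables t₀, …, tᵣ. -/
theorem IsMouldOf.push_eq_self_iff {b : Series} {B : PolyFamily} (h : IsMouldOf b B) :
    push b = b ↔ ∀ r d, MvPolynomial.rename (Equiv.addRight (1 : Fin (r + 1)))
      (diffHom r (B r d)) = diffHom r (B r d) := by
  have hsum : ∀ {r : ℕ} (a : Fin (r + 1) → ℕ), ∑ i, a (i + 1) = ∑ i, a i :=
    fun a => Equiv.sum_comp (Equiv.addRight (1 : Fin _)) a
  rw [push_eq_self_iff_wordOf]
  constructor
  · intro hb r d
    ext m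
    obtain ⟨a, rfl⟩ := Finsupp.equivFunOnFinite.symm.surjective m
    rw [coeff_rename_equiv]
    by_cases ha : ∑ i, a i = d
    · rw [← h.apply_wordOf a ha, ← h.apply_wordOf (a ∘ Equiv.addRight 1) ((hsum a).trans ha),
        ← hb _ (ofFn_ne_nil a), ofFn_rotate_one]
      rfl
    · have hh := isHomogeneous_diffHom (h r d).1
      rw [coeff_eq_zero_of_sum_ne hh ha, coeff_eq_zero_of_sum_ne hh]
      rwa [← hsum] at ha
  · intro hB l hl
    obtain ⟨r, hr⟩ : ∃ r, l.length = r + 1 :=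
      ⟨l.length - 1, by have := List.length_pos_iff.2 hl; omega⟩
    obtain ⟨a, rfl⟩ := exists_ofFn_of_length hr
    have e := coeff_rename_equiv (Equiv.addRight 1) (diffHom r (B r (∑ i, a i))) a
    rw [hB r] at e
    rw [ofFn_rotate_one, h.apply_wordOf a rfl, h.apply_wordOf _ (hsum a), e]
    rfl

/-- The arguments `(u₀, u₁, …, uᵣ₋₁)`, as polynomials. -/
noncomputable def pushPolyArgs (s : ℕ) : Fin (s + 1) → MvPolynomial (Fin (s + 1)) ℚ :=
  Fin.cons (-∑ j, MvPolynomial.X j) fun i => MvPolynomial.X i.castSucc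

theorem pushArgs_ratVar (s : ℕ) : pushArgs (ratVar (s + 1)) = fun i =>
    algebraMap (MvPolynomial (Fin (s + 1)) ℚ) (RatFun (s + 1)) (pushPolyArgs s i) := by
  funext i
  refine Fin.cases ?_ (fun i => ?_) i
  · simp [pushArgs, pushPolyArgs, ratVar]
  · simp only [pushArgs, pushPolyArgs, ratVar, Fin.cons_succ]
    rw [if_neg (by simp)]
    rfl

theorem eval₂_algebraMap {r : ℕ} (q : Fin r → MvPolynomial (Fin r) ℚ)
    (p : MvPolynomial (Fin r) ℚ) :
    MvPolynomial.eval₂ (Rat.castHom (RatFun r))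
      (fun i => algebraMap (MvPolynomial (Fin r) ℚ) (RatFun r) (q i)) p =
      algebraMap (MvPolynomial (Fin r) ℚ) (RatFun r) (MvPolynomial.aeval q p) := by
  rw [MvPolynomial.aeval_def, MvPolynomial.eval₂_comp_left]
  congr 1
  exact RingHom.ext_rat _ _

theorem starValue_algebraMap {r : ℕ} (q : Fin r → MvPolynomial (Fin r) ℚ)
    (p : MvPolynomial (Fin r) ℚ) :
    starValue p (fun i => algebraMap (MvPolynomial (Fin r) ℚ) (RatFun r) (q i)) =
      algebraMap (MvPolynomial (Fin r) ℚ) (RatFun r) (MvPolynomial.aeval q p) /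
        algebraMap (MvPolynomial (Fin r) ℚ) (RatFun r) (MvPolynomial.aeval q (ellFactor r)) := by
  rw [starValue, eval₂_algebraMap, ellFactor]
  simp only [map_mul, map_prod, map_sum, MvPolynomial.aeval_X]

/-- The sum becomes u₀ + ⋯ + uᵣ₋₁ = -uᵣ and the product acquires u₀ = -(u₁ + ⋯ + uᵣ) in place of uᵣ;
the two signs cancel. -/
theorem aeval_pushPolyArgs_ellFactor (s : ℕ) :
    MvPolynomial.aeval (pushPolyArgs s) (ellFactor (s + 1)) = ellFactor (s + 1) := by
  simp only [ellFactor, map_mul, map_prod, map_sum, MvPolynomial.aeval_X]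
  rw [Fin.prod_univ_succ, Fin.sum_univ_succ (f := pushPolyArgs s)]
  simp only [pushPolyArgs, Fin.cons_zero, Fin.cons_succ]
  rw [Fin.prod_univ_castSucc, Fin.sum_univ_castSucc]
  ring

theorem ellFactor_ne_zero (s : ℕ) : ellFactor (s + 1) ≠ 0 := by
  refine mul_ne_zero (prod_ne_zero_iff.2 fun i _ => MvPolynomial.X_ne_zero i) fun h => ?_
  have := congrArg (MvPolynomial.eval fun _ => (1 : ℚ)) h
  simp only [map_sum, MvPolynomial.eval_X, map_zero, sum_const, card_univ, Fintype.card_fin,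
    nsmul_eq_mul, mul_one] at this
  push_cast at this
  exact Nat.cast_add_one_ne_zero s this

/-- The denominator is nonzero and push-invariant, so it cancels and only a polynomial identity
remains. -/
theorem starPushInvariant_iff (s : ℕ) (p : MvPolynomial (Fin (s + 1)) ℚ) :
    StarPushInvariant p ↔ MvPolynomial.aeval (pushPolyArgs s) p = p := by
  have h0 : algebraMap (MvPolynomial (Fin (s + 1)) ℚ) (RatFun (s + 1)) (ellFactor (s + 1)) ≠ 0 :=
    (map_ne_zero_iff _ (IsFractionRing.injective (MvPolynomial (Fin (s + 1)) ℚ) _)).2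
      (ellFactor_ne_zero s)
  have h1 : starValue p (ratVar (s + 1)) =
      algebraMap _ (RatFun (s + 1)) p / algebraMap _ (RatFun (s + 1)) (ellFactor (s + 1)) := by
    have := starValue_algebraMap MvPolynomial.X p
    rwa [MvPolynomial.aeval_X_left_apply, MvPolynomial.aeval_X_left_apply] at this
  rw [StarPushInvariant, pushArgs_ratVar, starValue_algebraMap, aeval_pushPolyArgs_ellFactor, h1]
  constructor
  · intro h
    have h2 := congrArg (· * algebraMap _ (RatFun (s + 1)) (ellFactor (s + 1))) h
    simp only [div_mul_cancel₀ _ h0] at h2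
    exact IsFractionRing.injective (MvPolynomial (Fin (s + 1)) ℚ) (RatFun (s + 1)) h2
  · intro h
    rw [h]

/-- In the t variables u₀ = tᵣ - t₀, so the rotation tⱼ ↦ tⱼ₊₁ (indices modulo r + 1) takes each
uᵢ₋₁ to uᵢ and undoes the change of arguments. -/
theorem rename_diffHom_aeval (s : ℕ) (p : MvPolynomial (Fin (s + 1)) ℚ) :
    MvPolynomial.rename (Equiv.addRight (1 : Fin (s + 2)))
      (diffHom (s + 1) (MvPolynomial.aeval (pushPolyArgs s) p)) = diffHom (s + 1) p := by
  have : ((MvPolynomial.rename (Equiv.addRight (1 : Fin (s + 2)))).comp (diffHom (s + 1))).comp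
      (MvPolynomial.aeval (pushPolyArgs s)) = diffHom (s + 1) := by
    refine MvPolynomial.algHom_ext fun i => ?_
    rw [AlgHom.comp_apply, AlgHom.comp_apply, MvPolynomial.aeval_X, diffHom_X]
    refine Fin.cases ?_ (fun i => ?_) i
    · rw [pushPolyArgs, Fin.cons_zero, map_neg, diffHom_sum]
      simp
    · rw [pushPolyArgs, Fin.cons_succ, diffHom_X]
      rw [map_sub, MvPolynomial.rename_X, MvPolynomial.rename_X]
      change MvPolynomial.X (i.castSucc.castSucc + 1) - MvPolynomial.X (i.castSucc.succ + 1) = _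
      rw [Fin.coeSucc_eq_succ, Fin.succ_castSucc, Fin.coeSucc_eq_succ, ← Fin.succ_castSucc]
  exact DFunLike.congr_fun this p

theorem rename_diffHom_eq_iff (s : ℕ) (p : MvPolynomial (Fin (s + 1)) ℚ) :
    MvPolynomial.rename (Equiv.addRight (1 : Fin (s + 2))) (diffHom (s + 1) p) =
      diffHom (s + 1) p ↔ MvPolynomial.aeval (pushPolyArgs s) p = p := by
  constructor
  · intro h
    refine diffHom_injective _ (MvPolynomial.rename_injective _
      (Equiv.addRight (1 : Fin (s + 2))).injective ?_)
    rw [rename_diffHom_aeval, h]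
  · intro h
    conv_lhs => rw [← h]
    rw [rename_diffHom_aeval]

theorem rename_diffHom_zero (p : MvPolynomial (Fin 0) ℚ) :
    MvPolynomial.rename (Equiv.addRight (1 : Fin 1)) (diffHom 0 p) = diffHom 0 p := by
  have : (Equiv.addRight (1 : Fin 1) : Fin 1 → Fin 1) = id := Subsingleton.elim _ _
  rw [this, MvPolynomial.rename_id_apply]

/-- Depth 0 imposes no condition, a single variable t₀ having no nontrivial rotation. -/
theorem push_eq_self_iff_star {b : Series} {B : PolyFamily} (h : IsMouldOf b B) :
    push b = b ↔ ∀ r d, 1 ≤ r → StarPushInvariant (B r d) := by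
  rw [h.push_eq_self_iff]
  constructor
  · intro hb r d hr
    obtain ⟨s, rfl⟩ := Nat.exists_eq_add_of_le' hr
    rw [starPushInvariant_iff, ← rename_diffHom_eq_iff]
    exact hb _ _
  · intro hb r d
    cases r with
    | zero => exact rename_diffHom_zero _
    | succ s =>
      rw [rename_diffHom_eq_iff, ← starPushInvariant_iff]
      exact hb _ _ (by omega)

theorem StarPushInvariant.ellFactor_mul {s : ℕ} {p : MvPolynomial (Fin (s + 1)) ℚ}
    (h : StarPushInvariant p) : StarPushInvariant (ellFactor (s + 1) * p) := by
  rw [starPushInvariant_iff] at h ⊢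
  rw [map_mul, aeval_pushPolyArgs_ellFactor, h]

/-! ### Circ-neutrality in terms of moulds -/

theorem aeval_cons_zero_eq {r : ℕ} (p : MvPolynomial (Fin (r + 1)) ℚ) :
    MvPolynomial.aeval (Fin.cons 0 MvPolynomial.X : Fin (r + 1) → MvPolynomial (Fin r) ℚ) p =
      (MvPolynomial.finSuccEquiv ℚ r p).coeff 0 := by
  have : (MvPolynomial.aeval
      (Fin.cons 0 MvPolynomial.X : Fin (r + 1) → MvPolynomial (Fin r) ℚ)).toRingHom =
      Polynomial.constantCoeff.comp (MvPolynomial.finSuccEquiv ℚ r).toRingEquiv.toRingHom := by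
    refine MvPolynomial.ringHom_ext (fun a => ?_) fun i => ?_
    · simp [MvPolynomial.finSuccEquiv_apply]
    · refine Fin.cases ?_ (fun i => ?_) i
      · simp [MvPolynomial.finSuccEquiv_apply]
      · simp [MvPolynomial.finSuccEquiv_apply]
  exact DFunLike.congr_fun this p

/-- Exponent 0 of t₀ means that the word starts with y, so setting t₀ = 0 passes from b to b^y. -/
theorem coeff_aeval_cons_zero {r : ℕ} (p : MvPolynomial (Fin (r + 1)) ℚ) (a : Fin r → ℕ) :
    (MvPolynomial.aeval (Fin.cons 0 MvPolynomial.X : Fin (r + 1) → MvPolynomial (Fin r) ℚ) p).coeff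
      (Finsupp.equivFunOnFinite.symm a) =
      p.coeff (Finsupp.equivFunOnFinite.symm (Fin.cons 0 a : Fin (r + 1) → ℕ)) := by
  rw [aeval_cons_zero_eq, MvPolynomial.finSuccEquiv_coeff_coeff]
  congr 1

/-- The cyclic sum of `B(-t₁, t₁ - t₂, …, tᵣ₋₁ - tᵣ)` vanishes. -/
theorem IsMouldOf.sum_rename_eq_zero {b : Series} {B : PolyFamily} (h : IsMouldOf b B)
    (hc : CircNeutral b) {s : ℕ} (hs : 1 ≤ s) (d : ℕ) :
    ∑ j : Fin (s + 1), MvPolynomial.rename (Equiv.addRight j)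
      (MvPolynomial.aeval (Fin.cons 0 MvPolynomial.X : Fin (s + 2) → MvPolynomial (Fin (s + 1)) ℚ)
        (diffHom (s + 1) (B (s + 1) d))) = 0 := by
  ext m
  obtain ⟨a, rfl⟩ := Finsupp.equivFunOnFinite.symm.surjective m
  rw [MvPolynomial.coeff_sum, MvPolynomial.coeff_zero]
  simp only [coeff_rename_equiv, coeff_aeval_cons_zero]
  by_cases ha : ∑ i, a i = d
  · rw [CircNeutral, pushNeutral_iff] at hc
    have h1 := hc (List.ofFn a) (by rw [List.length_ofFn]; omega)
    rw [List.length_ofFn, sum_range] at h1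
    rw [← h1]
    refine sum_congr rfl fun j _ => ?_
    have h2 : ∑ i, (Fin.cons 0 (a ∘ Equiv.addRight j) : Fin (s + 2) → ℕ) i = d := by
      rw [Fin.sum_univ_succ]
      simp only [Fin.cons_zero, Fin.cons_succ, zero_add, Function.comp_apply]
      rw [← ha]
      exact Equiv.sum_comp (Equiv.addRight j) a
    rw [← h.apply_wordOf _ h2, ofFn_rotate, tailPart_apply, List.ofFn_succ]
    simp only [Fin.cons_zero, Fin.cons_succ]
    rw [wordOf_cons _ (ofFn_ne_nil _)]
    rfl
  · refine sum_eq_zero fun j _ => coeff_eq_zero_of_sum_ne (isHomogeneous_diffHom (h _ d).1) ?_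
    rw [Fin.sum_univ_succ]
    simp only [Fin.cons_zero, Fin.cons_succ, zero_add, Function.comp_apply]
    intro h2
    refine ha (Eq.trans ?_ h2)
    exact (Equiv.sum_comp (Equiv.addRight j) a).symm

/-! ### The swap of variables and its denominators. -/

theorem swapArgs_zero {s : ℕ} (v : Fin (s + 1) → RatFun (s + 1)) :
    swapArgs v 0 = v (Fin.last s) := by
  simp [swapArgs]

theorem swapArgs_succ {s : ℕ} (v : Fin (s + 1) → RatFun (s + 1)) (i : Fin s) :
    swapArgs v i.succ = v (Fin.rev i.succ) - v (Fin.rev i.castSucc) := by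
  rw [swapArgs, if_neg (by simp)]
  rfl

/-- With t₀ = 0 the arguments are -t₁, t₁ - t₂, …, and t_m = -v_(r+1-m) turns them into vᵣ, vᵣ₋₁ -
vᵣ, …. The substitution reverses the order of the variables, so rotation by j on one side is
rotation by -j on the other. -/
theorem eval₂_swapArgs {s : ℕ} (p : MvPolynomial (Fin (s + 1)) ℚ) (j : Fin (s + 1)) :
    MvPolynomial.eval₂ (Rat.castHom (RatFun (s + 1)))
      (swapArgs fun i => ratVar (s + 1) (i + -j)) p =
    MvPolynomial.aeval (fun m => -ratVar (s + 1) (Fin.rev m))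
      (MvPolynomial.rename (Equiv.addRight j)
        (MvPolynomial.aeval (Fin.cons 0 MvPolynomial.X : Fin (s + 2) → MvPolynomial (Fin (s + 1)) ℚ)
          (diffHom (s + 1) p))) := by
  have h1 : MvPolynomial.eval₂ (Rat.castHom (RatFun (s + 1)))
      (swapArgs fun i => ratVar (s + 1) (i + -j)) p =
      MvPolynomial.aeval (swapArgs fun i => ratVar (s + 1) (i + -j)) p := by
    rw [MvPolynomial.aeval_def]
    congr 1
  have h2 : (MvPolynomial.aeval (swapArgs fun i => ratVar (s + 1) (i + -j)) :
      MvPolynomial (Fin (s + 1)) ℚ →ₐ[ℚ] RatFun (s + 1)) =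
      (((MvPolynomial.aeval (fun m => -ratVar (s + 1) (Fin.rev m))).comp
        (MvPolynomial.rename (Equiv.addRight j))).comp (MvPolynomial.aeval
          (Fin.cons 0 MvPolynomial.X : Fin (s + 2) → MvPolynomial (Fin (s + 1)) ℚ))).comp
            (diffHom (s + 1)) := by
    refine MvPolynomial.algHom_ext fun i => ?_
    rw [AlgHom.comp_apply, AlgHom.comp_apply, AlgHom.comp_apply, MvPolynomial.aeval_X, diffHom_X]
    refine Fin.cases ?_ (fun i => ?_) i
    · rw [swapArgs_zero, Fin.castSucc_zero, map_sub, MvPolynomial.aeval_X, MvPolynomial.aeval_X,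
        Fin.cons_zero, Fin.cons_succ, zero_sub, map_neg, map_neg, MvPolynomial.rename_X,
        MvPolynomial.aeval_X, neg_neg, Equiv.coe_addRight, Fin.rev_add, Fin.rev_zero, sub_eq_add_neg]
    · rw [swapArgs_succ, ← Fin.succ_castSucc, map_sub, MvPolynomial.aeval_X, MvPolynomial.aeval_X,
        Fin.cons_succ, Fin.cons_succ, map_sub, map_sub, MvPolynomial.rename_X,
        MvPolynomial.rename_X, MvPolynomial.aeval_X, MvPolynomial.aeval_X, Equiv.coe_addRight,
        Fin.rev_add, Fin.rev_add, sub_eq_add_neg (Fin.rev _), sub_eq_add_neg (Fin.rev _)]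
      ring
  rw [h1, h2]
  rfl

theorem ratVar_injective (r : ℕ) : Function.Injective (ratVar r) :=
  (IsFractionRing.injective (MvPolynomial (Fin r) ℚ) (RatFun r)).comp MvPolynomial.X_injective

theorem ratVar_ne_zero (r : ℕ) (i : Fin r) : ratVar r i ≠ 0 :=
  (map_ne_zero_iff _ (IsFractionRing.injective (MvPolynomial (Fin r) ℚ) _)).2
    (MvPolynomial.X_ne_zero i)

/-- The factors are a variable and differences of distinct variables, and the sum telescopes to a
single variable. -/
theorem swapArgs_factor_ne_zero {s : ℕ} (k : Fin (s + 1)) :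
    (∏ i, swapArgs (fun i => ratVar (s + 1) (i + k)) i) *
      ∑ i, swapArgs (fun i => ratVar (s + 1) (i + k)) i ≠ 0 := by
  refine mul_ne_zero (prod_ne_zero_iff.2 fun i _ => ?_) ?_
  · refine Fin.cases ?_ (fun i => ?_) i
    · rw [swapArgs_zero]
      exact ratVar_ne_zero _ _
    · rw [swapArgs_succ, sub_ne_zero]
      intro h
      have := Fin.rev_injective (add_right_cancel (ratVar_injective _ h))
      exact (Fin.castSucc_lt_succ (i := i)).ne' this
  · rw [Fin.sum_univ_succ, swapArgs_zero]
    simp only [swapArgs_succ]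
    have := sum_telescope s fun i => ratVar (s + 1) (Fin.rev i + k)
    rw [← neg_inj, ← sum_neg_distrib] at this
    simp only [neg_sub] at this
    rw [this, Fin.rev_zero, add_sub_cancel]
    exact ratVar_ne_zero _ _

theorem starValue_ellFactor_mul {r : ℕ} (p : MvPolynomial (Fin r) ℚ) {g : Fin r → RatFun r}
    (hg : (∏ i, g i) * ∑ i, g i ≠ 0) :
    starValue (ellFactor r * p) g = MvPolynomial.eval₂ (Rat.castHom (RatFun r)) g p := by
  have : MvPolynomial.eval₂ (Rat.castHom (RatFun r)) g (ellFactor r) = (∏ i, g i) * ∑ i, g i := by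
    rw [ellFactor, MvPolynomial.eval₂_mul, MvPolynomial.eval₂_prod, MvPolynomial.eval₂_sum]
    simp only [MvPolynomial.eval₂_X]
  rw [starValue, MvPolynomial.eval₂_mul, this, mul_div_cancel_left₀ _ hg]

theorem IsMouldOf.starCircNeutralAdd_delta {b : Series} {B : PolyFamily} (h : IsMouldOf b B)
    (hc : CircNeutral b) {r : ℕ} (hr : 1 < r) (d : ℕ) : StarCircNeutralAdd (Delta B r d) 0 := by
  obtain ⟨s, rfl⟩ := Nat.exists_eq_add_of_le' (le_of_lt hr)
  rw [StarCircNeutralAdd]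
  by_cases hd : s + 1 + 1 ≤ d
  · rw [Delta_of_le hd]
    have h1 := congrArg (MvPolynomial.aeval fun m => -ratVar (s + 1) (Fin.rev m))
      (h.sum_rename_eq_zero hc (by omega : 1 ≤ s) (d - (s + 1 + 1)))
    rw [map_sum, map_zero] at h1
    simp only [← eval₂_swapArgs] at h1
    -- The cyclic sum is reindexed by k ↦ -k to match the reversed rotations. The factor introduced
    -- by `Delta` cancels the denominator, so no constant is needed.
    rw [← h1, ← Equiv.sum_comp (Equiv.neg (Fin (s + 1)))]
    refine sum_congr rfl fun k _ => ?_
    rw [starValue_ellFactor_mul _ (swapArgs_factor_ne_zero _), Rat.cast_zero, add_zero]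
    rfl
  · rw [Delta_of_lt (by omega)]
    simp [starValue]

theorem IsMouldOf.starPushInvariant_delta {b : Series} {B : PolyFamily} (h : IsMouldOf b B)
    (hp : push b = b) {r : ℕ} (hr : 1 ≤ r) (d : ℕ) : StarPushInvariant (Delta B r d) := by
  obtain ⟨s, rfl⟩ := Nat.exists_eq_add_of_le' hr
  by_cases hd : s + 1 + 1 ≤ d
  · rw [Delta_of_le hd]
    exact ((push_eq_self_iff_star h).1 hp _ _ hr).ellFactor_mul
  · rw [Delta_of_lt (by omega)]
    simp [StarPushInvariant, starValue]


/-! ### The embedding of `lkv` into `krv_ell` -/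

theorem krvEllStrict_le_krvEll : krvEllStrict ≤ krvEll := fun _ ⟨h, B, hB, hp, hc⟩ =>
  ⟨h, B, hB, hp, fun r d hr => (hc r d hr).imp fun _ hc => ⟨Submodule.mem_top, hc.2⟩⟩

theorem lie_X_substitute_mem_krvEllStrict {b : Series} (hb : b ∈ lkv) :
    ⁅X, substitute ellSubst b⁆ ∈ krvEllStrict := by
  obtain ⟨hC, -, hp, hc⟩ := hb
  obtain ⟨B, hB⟩ := exists_isMouldOf hC
  exact ⟨lie_X_mem_lieC (substitute_mem_lieC hC), Delta B, hB.delta,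
    fun r d hr => hB.starPushInvariant_delta hp hr d,
    fun r d hr => ⟨0, zero_mem _, hB.starCircNeutralAdd_delta hc hr d⟩⟩

theorem existsUnique_oder2_of_mem_krvEll {b : Series} (hb : b ∈ krvEll) :
    ∃! D : LieDerivation ℚ lie2 lie2, D ∈ oder2 ∧ (D xLie : Series) = b := by
  obtain ⟨hC, B, hB, hp, -⟩ := hb
  exact existsUnique_oder2 (lieC_le_lie2 hC) (noDepthZero_of_mem_lieC hC)
    ((push_eq_self_iff_star hB).2 hp)

/-- In depth at least 1 the map multiplies B^r by a nonzero polynomial, and elements of `lieC` have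
no depth 0 terms. -/
theorem eq_zero_of_lie_X_substitute_eq_zero {b : Series} (hb : b ∈ lieC)
    (h : ⁅X, substitute ellSubst b⁆ = 0) : b = 0 := by
  obtain ⟨B, hB⟩ := exists_isMouldOf hb
  have hD : Delta B = 0 := isMouldOf_unique (h ▸ hB.delta) IsMouldOf.zero
  ext w
  rcases hw : w.count 1 with _ | s
  · have : w = List.replicate w.length 0 := List.eq_replicate_of_mem fun a ha => by
      have h1 : (1 : Fin 2) ∉ w := List.count_eq_zero.1 hw
      by_contra h0
      exact h1 ((show a = 1 by omega) ▸ ha)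
    rw [this]
    exact noDepthZero_of_mem_lieC hb _
  · have hle : s + 1 ≤ w.length := hw ▸ List.count_le_length
    have hBz : B (s + 1) (w.length - (s + 1)) = 0 := by
      have h1 := congrFun (congrFun hD (s + 1)) (w.length - (s + 1) + (s + 2))
      rw [Delta_of_le (by omega), Nat.add_sub_cancel] at h1
      exact (mul_eq_zero.1 h1).resolve_left (ellFactor_ne_zero s)
    have h2 := congrArg (fun f : Series => f w) (hB (s + 1) (w.length - (s + 1))).2
    simpa [hBz, weightPart_apply, depthPart_apply, hw, Nat.sub_add_cancel hle] using h2

/-- The map `b ↦ [x, b(x, [x, y])]` from `lkv` to `krv_ell`. -/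
noncomputable def lkvToKrvEll : lkv →ₗ[ℚ] krvEll where
  toFun b := ⟨⁅X, substitute ellSubst (b : Series)⁆,
    krvEllStrict_le_krvEll (lie_X_substitute_mem_krvEllStrict b.2)⟩
  map_add' b b' := Subtype.ext <| by
    simp only [Submodule.coe_add, substitute_add, lie_add]
  map_smul' c b := Subtype.ext <| by
    simp only [Submodule.coe_smul, substitute_smul, lie_smul, RingHom.id_apply]

theorem lkvToKrvEll_injective : Function.Injective lkvToKrvEll :=
  (injective_iff_map_eq_zero _).2 fun b hb =>
    Subtype.ext (eq_zero_of_lie_X_substitute_eq_zero b.2.1 (congrArg Subtype.val hb))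

/-- The derivations in `oder₂` whose value at `x` lies in the image of `lkv`. -/
def lkvDerivations : LieSubalgebra ℚ (LieDerivation ℚ lie2 lie2) where
  carrier := {D | D ∈ oder2 ∧ ∃ b : lkv, (D xLie : Series) = (lkvToKrvEll b : Series)}
  add_mem' := by
    rintro D D' ⟨hD, b, hb⟩ ⟨hD', b', hb'⟩
    refine ⟨add_mem hD hD', b + b', ?_⟩
    rw [map_add, Submodule.coe_add, ← hb, ← hb']
    rfl
  zero_mem' := ⟨zero_mem _, 0, by rw [map_zero]; rfl⟩
  smul_mem' := by
    rintro c D ⟨hD, b, hb⟩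
    refine ⟨oder2.smul_mem c hD, c • b, ?_⟩
    rw [map_smul, Submodule.coe_smul, ← hb]
    rfl
  lie_mem' := by
    rintro D D' ⟨hD, b, hb⟩ ⟨hD', b', hb'⟩
    -- The preimage of the bracket is the bracket `iharaBracket` of the preimages.
    exact ⟨lie_mem_oder2 hD hD', ⟨_, iharaBracket_mem_lkv b.2 b'.2⟩, lie_apply_xLie hD hD' hb hb'⟩

end EllKV

theorem mainTheorem8 :
    -- each element of `krv_ell` is `D x` for exactly one `D` in `oder₂`; the bracket of `krv_ell`
    -- is the one of derivations, carried over by `D ↦ D x`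
    (∀ b ∈ krvEll, ∃! D : LieDerivation ℚ lie2 lie2, D ∈ oder2 ∧ (D xLie : Series) = b) ∧
    ∃ φ : lkv →ₗ[ℚ] krvEll,
      (∀ b : lkv, (φ b : Series) = ⁅X, substitute ![X, ⁅X, Y⁆] (b : Series)⁆) ∧
      Function.Injective φ ∧
      (∀ b : lkv, (φ b : Series) ∈ krvEllStrict) ∧
      -- the image of `φ` is a Lie subalgebra
      (∃ L : LieSubalgebra ℚ (LieDerivation ℚ lie2 lie2),
        ∀ D : LieDerivation ℚ lie2 lie2,
          D ∈ L ↔ D ∈ oder2 ∧ ∃ b : lkv, (D xLie : Series) = (φ b : Series)) ∧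
      -- the description of `φ` on the associated families of polynomials
      (∀ b : lkv, (∃! B : PolyFamily, IsMouldOf (b : Series) B) ∧
        ∀ B : PolyFamily, IsMouldOf (b : Series) B → IsMouldOf (φ b : Series) (Delta B)) :=
  ⟨fun _ hb => existsUnique_oder2_of_mem_krvEll hb, lkvToKrvEll, fun _ => rfl,
    lkvToKrvEll_injective, fun b => lie_X_substitute_mem_krvEllStrict b.2,
    ⟨lkvDerivations, fun _ => Iff.rfl⟩, fun b =>
      ⟨(exists_isMouldOf b.2.1).imp fun _ hB => ⟨hB, fun _ hB' => isMouldOf_unique hB' hB⟩,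
        fun _ hB => hB.delta⟩⟩
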